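/- **Setting.** For each number $K\ge 1$ of data streams let $p=p_K\ge 1$ and let $\Theta=\Theta_K\subseteq\mathbb{R}^p$ be a convex parameter set. Stream $k\le K$ has a random parameter $\theta_k$ and $n_k=n_{K,k}\ge 1$ observations $(X_{(k,i)},Y_{(k,i)})$. The streams are independent. The discrepancies $\Delta(\theta^*)=\theta_k-\theta^*$ are identically distributed in $k$, and given $\theta_k-\theta^*=\delta$ the observations of stream $k$ are i.i.d. with a law that depends only on $\delta$. The loss $l(x,y,\theta)$ is twice continuously differentiable in $\theta\in\Theta$, with gradient $\dot l$ and Hessian $\ddot l$, and is integrable. The target $\theta^*$ minimizes $F(\theta)=\mathbb{E}[\mathbb{E}\{l(X,Y,\theta)\mid\Delta(\theta^*)\}]$ over $\Theta$, and $\{\theta:\|\theta-\theta^*\|\le\rho\}\subseteq\Theta$. Assume, with constants $\rho,\lambda,C_1,s,C_3>0$ that do not depend on $K$, for all $\theta,\theta'\in\Theta$ and $j,j_1,j_2\in\{1,\dots,p\}$: 1. $l(x,y,\cdot)$ is convex on $\Theta$; 2. the eigenvalues of $\mathbb{E}\{\ddot l(X,Y,\theta)\}$ lie in $[\lambda^{-1},\lambda]$;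 3. $\|\ddot l(X,Y,\theta)-\ddot l(X,Y,\theta')\|\le C(X,Y)\|\theta-\theta'\|$ in spectral norm, with $\mathbb{E}\{C(X,Y)^2\}\le C_1^2$; 4. $\mathbb{E}[\exp\{s|\dot l_j(X,Y,\theta)|\}]\le 2$; 5. $\mathbb{E}\{\ddot l_{j_1j_2}(X,Y,\theta)^2\}\le C_3$. Let $\alpha\in(0,1)$, let $L_k(\theta)=n_k^{-1}\sum_{i\le n_k} l(X_{(k,i)},Y_{(k,i)},\theta)$ with gradient $\dot L_k$ and Hessian $\ddot L_k$, let $\hat\theta_{stage,0}$ be a (measurable) minimizer over $\Theta$ of $\lfloor K^\alpha\rfloor^{-1}\sum_{k\le\lfloor K^\alpha\rfloor}L_k(\theta)$ (arbitrary if no minimizer exists), and let $$\hat\theta_{stage,1}=\hat\theta_{stage,0}-\Big\{\frac1K\sum_{k=1}^K\ddot L_k(\hat\theta_{stage,0})\Big\}^{-1}\Big\{\frac1K\sum_{k=1}^K\dot L_k(\hat\theta_{stage,0})\Big\}$$ be the one-stage Newton estimator (with $\alpha_1=1$; the inverse is read as $0$ if the matrix is singular). Put $\Sigma=\mathbb{E}\{\ddot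 l(X,Y,\theta^*)\}$, $Z=\mathbb{E}\{\dot l(X,Y,\theta^*)\mid\Delta(\theta^*)\}$ and, for $v\in\mathbb{R}^p$, $\sigma^2(v)=v^\top\Sigma^{-1}\mathbb{E}[ZZ^\top]\Sigma^{-1}v$. **Theorem.** (i) If $pK/K^{2\alpha}\to0$ as $K\to\infty$, then $\|\hat\theta_{stage,1}-\theta^*\|=O_p(\sqrt{p/K})$. (ii) Suppose that $p^2K/K^{2\alpha}\to0$ and that the following Berry–Esseen condition holds: for every choice of vectors $w=w_K\in\mathbb{R}^{p}$ there is a constant $C_{BE}>0$ with $\mathbb{E}[|w^\top Z|^3]^{2/3}\le C_{BE}\,\mathbb{E}[(w^\top Z)^2]$ for all $K$. Suppose also that the within-stream sample sizes are adequate, $p\cdot\frac1K\sum_{k=1}^K n_k^{-1}\to0$. Then, for all nonzero vectors $v=v_K\in\mathbb{R}^p$ in whose direction the stream parameters vary at constant order, i.e. $\sigma^2(v_K)\ge c\|v_K\|^2$ for some $c>0$ and all $K$, $$\frac{\sqrt K\,v^\top(\hat\theta_{stage,1}-\theta^*)}{\sigma(v)}\stackrel{d}{\to}\mathbf{N}(0,1)\qquad(K\to\infty).$$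 -/

import Mathlib

open MeasureTheory ProbabilityTheory Filter Topology

noncomputable section

/-- The parameter space `ℝ^p` with its Euclidean norm. -/
abbrev Vec (p : ℕ) : Type := EuclideanSpace ℝ (Fin p)

/-- `X_K = O_p(r_K)`: for every `ε > 0` there is `M > 0` such that
`P(|X_K / r_K| < M) > 1 - ε` for all large `K`. -/
def IsBigOInProb {Ω : ℕ → Type*} [∀ K, MeasurableSpace (Ω K)] (P : ∀ K, Measure (Ω K))
    (X : ∀ K, Ω K → ℝ) (r : ℕ → ℝ) : Prop :=
  ∀ ε : ℝ, 0 < ε → ∃ M : ℝ, 0 < M ∧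
    ∀ᶠ K in atTop, 1 - ε < (P K).real {ω | |X K ω / r K| < M}

/-- The population objects of an online continual learning problem with `p` parameters.
An observation `z : 𝒵` is a covariate-response pair `(x, y)`. The parameter `θ_k` of a data stream
is random; the discrepancy `Δ(θ*) = θ_k - θ*` has law `taskLaw`, and `obsLaw δ` is the law of an
observation of a stream whose discrepancy is `δ`. -/
structure ContinualModel (p : ℕ) (𝒵 : Type*) [MeasurableSpace 𝒵] where
  /-- the parameter set -/
  Θ : Set (Vec p)
  /-- the loss `l(z, θ)` -/
  loss : 𝒵 → Vec p → ℝ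
  /-- the law of `Δ(θ*) = θ_k - θ*` -/
  taskLaw : Measure (Vec p)
  /-- the law of an observation given `Δ(θ*)` -/
  obsLaw : Kernel (Vec p) 𝒵
  /-- the target parameter `θ*` -/
  θstar : Vec p
  isProb_taskLaw : IsProbabilityMeasure taskLaw
  isMarkov_obsLaw : IsMarkovKernel obsLaw

namespace ContinualModel

variable {p : ℕ} {𝒵 : Type*} [MeasurableSpace 𝒵]

/-- The gradient of the loss in `θ`. -/
def grad (M : ContinualModel p 𝒵) (z : 𝒵) (θ : Vec p) : Vec p := gradient (M.loss z) θ

/-- The Hessian of the loss in `θ`, as a linear map (with the operator, i.e. spectral, norm). -/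
def hess (M : ContinualModel p 𝒵) (z : 𝒵) (θ : Vec p) : Vec p →L[ℝ] Vec p :=
  fderiv ℝ (M.grad z) θ

/-- The entry `(j₁, j₂)` of the Hessian matrix. -/
def hessEntry (M : ContinualModel p 𝒵) (z : 𝒵) (θ : Vec p) (j₁ j₂ : Fin p) : ℝ :=
  M.hess z θ (EuclideanSpace.single j₂ 1) j₁

/-- The unconditional law of one observation `(X, Y)`. -/
def marginal (M : ContinualModel p 𝒵) : Measure 𝒵 := M.taskLaw.bind M.obsLaw

/-- The global loss `F(θ) = E_Δ [E {l(X, Y, θ) | Δ}]`. -/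
def globalLoss (M : ContinualModel p 𝒵) (θ : Vec p) : ℝ :=
  ∫ δ, (∫ z, M.loss z θ ∂(M.obsLaw δ)) ∂M.taskLaw

/-- The expected Hessian `E {l̈(X, Y, θ)}`. -/
def expHess (M : ContinualModel p 𝒵) (θ : Vec p) : Vec p →L[ℝ] Vec p :=
  ∫ z, M.hess z θ ∂M.marginal

/-- `Σ = E {l̈(X, Y, θ*)}`. -/
def Sig (M : ContinualModel p 𝒵) : Vec p →L[ℝ] Vec p := M.expHess M.θstar

/-- `E {l̇(X, Y, θ*) | Δ(θ*) = δ}`. -/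
def condGrad (M : ContinualModel p 𝒵) (δ : Vec p) : Vec p :=
  ∫ z, M.grad z M.θstar ∂(M.obsLaw δ)

/-- `E [E {l̇(X, Y, θ*) | Δ(θ*)} ^ ⊗2]`. -/
def condGradCov (M : ContinualModel p 𝒵) : Vec p →L[ℝ] Vec p :=
  ∫ δ, InnerProductSpace.rankOne ℝ (M.condGrad δ) (M.condGrad δ) ∂M.taskLaw

/-- The asymptotic variance `vᵀ Σ⁻¹ E [E {l̇(X, Y, θ*) | Δ(θ*)} ^ ⊗2] Σ⁻¹ v`. -/
def asympVar (M : ContinualModel p 𝒵) (v : Vec p) : ℝ :=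
  inner ℝ v (M.Sig.inverse (M.condGradCov (M.Sig.inverse v)))

/-- The standing set-up: the loss is measurable, twice continuously differentiable in `θ` at the
points of `Θ` and integrable, and `θ*` minimizes the global loss over `Θ` and is an interior point
of `Θ`, with the closed ball of radius `ρ` about `θ*` inside `Θ`. -/
structure IsRegular (M : ContinualModel p 𝒵) (ρ : ℝ) : Prop where
  measurable_loss : Measurable (fun q : 𝒵 × Vec p => M.loss q.1 q.2)
  measurable_grad : Measurable (fun q : 𝒵 × Vec p => M.grad q.1 q.2)
  measurable_hess : Measurable (fun q : 𝒵 × Vec p => M.hess q.1 q.2)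
  contDiffAt_loss : ∀ z, ∀ θ ∈ M.Θ, ContDiffAt ℝ 2 (M.loss z) θ
  integrable_loss : ∀ θ ∈ M.Θ, Integrable (fun z => M.loss z θ) M.marginal
  isMinOn_θstar : IsMinOn M.globalLoss M.Θ M.θstar
  closedBall_subset : Metric.closedBall M.θstar ρ ⊆ M.Θ

/-- Convexity: `Θ` is convex and the loss is convex in `θ ∈ Θ`. -/
def ConvexLoss (M : ContinualModel p 𝒵) : Prop :=
  ∀ z, ConvexOn ℝ M.Θ (M.loss z)

/-- Bounded eigenvalues: for every `θ ∈ Θ` the eigenvalues of the symmetric matrix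
`E {l̈(X, Y, θ)}` lie in `[lam⁻¹, lam]`. -/
def BoundedEigenvalues (M : ContinualModel p 𝒵) (lam : ℝ) : Prop :=
  ∀ θ ∈ M.Θ, ∀ u : Vec p,
    lam⁻¹ * ‖u‖ ^ 2 ≤ inner ℝ u (M.expHess θ u) ∧ inner ℝ u (M.expHess θ u) ≤ lam * ‖u‖ ^ 2

/-- Lipschitz condition on the Hessian, in spectral norm, with a random Lipschitz constant
`C(X, Y)` such that `E {C(X, Y)²} ≤ C₁²`. -/
def LipschitzHess (M : ContinualModel p 𝒵) (C₁ : ℝ) : Prop :=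
  ∃ C : 𝒵 → ℝ, Measurable C ∧
    (∀ z, ∀ θ ∈ M.Θ, ∀ θ' ∈ M.Θ, ‖M.hess z θ - M.hess z θ'‖ ≤ C z * ‖θ - θ'‖) ∧
    ∫⁻ z, ENNReal.ofReal (C z ^ 2) ∂M.marginal ≤ ENNReal.ofReal (C₁ ^ 2)

/-- Sub-exponential gradient: `E [exp {s |l̇_j(X, Y, θ)|}] ≤ 2` for `θ ∈ Θ` and `j ∈ [p]`. -/
def SubExpGrad (M : ContinualModel p 𝒵) (s : ℝ) : Prop :=
  ∀ θ ∈ M.Θ, ∀ j : Fin p,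
    ∫⁻ z, ENNReal.ofReal (Real.exp (s * |M.grad z θ j|)) ∂M.marginal ≤ 2

/-- Moment restriction: `E {l̈_{j₁ j₂}(X, Y, θ)²} ≤ C₃` for `θ ∈ Θ` and `j₁, j₂ ∈ [p]`. -/
def MomentHess (M : ContinualModel p 𝒵) (C₃ : ℝ) : Prop :=
  ∀ θ ∈ M.Θ, ∀ j₁ j₂ : Fin p,
    ∫⁻ z, ENNReal.ofReal (M.hessEntry z θ j₁ j₂ ^ 2) ∂M.marginal ≤ ENNReal.ofReal C₃

/-- The Berry-Esseen bound in the direction `w`, with constant `C`: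
`E [|wᵀ Z|³] ^ (2/3) ≤ C E [(wᵀ Z)²]` for `Z = E {l̇(X, Y, θ*) | Δ(θ*)}`. -/
def BerryEsseenBound (M : ContinualModel p 𝒵) (w : Vec p) (C : ℝ) : Prop :=
  (∫ δ, |inner ℝ w (M.condGrad δ)| ^ 3 ∂M.taskLaw) ^ (2 / 3 : ℝ)
    ≤ C * ∫ δ, (inner ℝ w (M.condGrad δ)) ^ 2 ∂M.taskLaw

section Data

variable {Ω : Type*}

/-- The data of `K` streams. The streams are independent, stream `k < K` has a random parameter
`task k` and `n k` observations `obs k i`, `i < n k`; `task k - θ*` has law `taskLaw`, and given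
its value `δ` the observations of the stream are i.i.d. with law `obsLaw δ`. -/
structure IsSample [MeasurableSpace Ω] (M : ContinualModel p 𝒵) (P : Measure Ω) (K : ℕ) (n : ℕ → ℕ)
    (task : ℕ → Ω → Vec p) (obs : ℕ → ℕ → Ω → 𝒵) : Prop where
  measurable_task : ∀ k < K, Measurable (task k)
  measurable_obs : ∀ k < K, ∀ i < n k, Measurable (obs k i)
  indep : iIndepFun
    (fun (k : Fin K) (ω : Ω) => (task k ω, fun i : Fin (n k) => obs k i ω)) P
  law : ∀ k < K, ∀ B : Set (Vec p), MeasurableSet B →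
    ∀ S : Fin (n k) → Set 𝒵, (∀ i, MeasurableSet (S i)) →
      P {ω | task k ω - M.θstar ∈ B ∧ ∀ i : Fin (n k), obs k i ω ∈ S i}
        = ∫⁻ δ in B, ∏ i, M.obsLaw δ (S i) ∂M.taskLaw

variable (M : ContinualModel p 𝒵) (n : ℕ → ℕ) (obs : ℕ → ℕ → Ω → 𝒵)

/-- The number `⌊K ^ a⌋` of streams. -/
def numStreams (K : ℕ) (a : ℝ) : ℕ := ⌊(K : ℝ) ^ a⌋₊

/-- `m⁻¹ ∑_{k ≤ m} L_k(θ)` with `L_k(θ) = n_k⁻¹ ∑_i l(X_(k,i), Y_(k,i), θ)`. -/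
def avgLoss (m : ℕ) (θ : Vec p) (ω : Ω) : ℝ :=
  (m : ℝ)⁻¹ * ∑ k ∈ Finset.range m, (n k : ℝ)⁻¹ * ∑ i ∈ Finset.range (n k), M.loss (obs k i ω) θ

/-- `m⁻¹ ∑_{k ≤ m} L̇_k(θ)`. -/
def avgGrad (m : ℕ) (θ : Vec p) (ω : Ω) : Vec p :=
  (m : ℝ)⁻¹ • ∑ k ∈ Finset.range m, (n k : ℝ)⁻¹ • ∑ i ∈ Finset.range (n k), M.grad (obs k i ω) θ

/-- `m⁻¹ ∑_{k ≤ m} L̈_k(θ)`. -/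
def avgHess (m : ℕ) (θ : Vec p) (ω : Ω) : Vec p →L[ℝ] Vec p :=
  (m : ℝ)⁻¹ • ∑ k ∈ Finset.range m, (n k : ℝ)⁻¹ • ∑ i ∈ Finset.range (n k), M.hess (obs k i ω) θ

/-- `θ₀` is an initial estimator from the first `⌊K ^ α⌋` streams: whenever the empirical loss of
these streams has a minimizer over `Θ`, `θ₀` is one. -/
def IsInitialEstimator (K : ℕ) (α : ℝ) (θ₀ : Ω → Vec p) : Prop :=
  ∀ ω, (∃ θ ∈ M.Θ, IsMinOn (fun θ => M.avgLoss n obs (numStreams K α) θ ω) M.Θ θ) →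
    θ₀ ω ∈ M.Θ ∧ IsMinOn (fun θ => M.avgLoss n obs (numStreams K α) θ ω) M.Θ (θ₀ ω)

/-- The one-stage Newton estimator, one Newton step from `θ₀` with the first `⌊K ^ α₁⌋` streams. -/
def oneStage (K : ℕ) (α₁ : ℝ) (θ₀ : Ω → Vec p) (ω : Ω) : Vec p :=
  θ₀ ω - (M.avgHess n obs (numStreams K α₁) (θ₀ ω) ω).inverse
    (M.avgGrad n obs (numStreams K α₁) (θ₀ ω) ω)

end Data

end ContinualModel

end

/-! Write m = ⌊K^α⌋, let G be the averaged gradient of all K streams at θ*, and w = Σ⁻¹v. If θ₀ lies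
within r of θ* and the averaged Hessian H at θ₀ is coercive, one Newton step leaves the error d =
H⁻¹(e − G), where e is a Taylor remainder of size O(r²) (`newton_step`). Chebyshev gives ‖G‖ =
O_p(√(p/K)), and convexity places the minimizer over m streams within r = O_p(√(p/m)) of θ*
(`exists_isMinOn_avgLoss`). So ‖d‖ = O_p(√(p/K) + p/m), and pK/m² → 0 makes the second term
negligible.

For normality, ⟨v, d⟩ + ⟨w, G⟩ = ⟨(H − Σ)w, H⁻¹G⟩ + ⟨v, H⁻¹e⟩ is of order ‖v‖ p/m, which is
o(K^(-1/2)‖v‖) when p²K/m² → 0. Only the one deterministic vector w meets H − Σ, so Chebyshev in a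
single direction suffices there. Replacing G by the average of the conditional gradients Z_k costs
conditionally centred noise, whose variance in direction w is at most a constant times ‖w‖² (p/K)
times the mean of 1/n_k (`measureReal_noise_ge_le`). What remains is a normalized sum of i.i.d.
variables with bounded standardized third moments, treated by characteristic functions.

The hard point is coercivity of the empirical Hessian at θ*, simultaneously in all directions, from
second moments only and with growing p (`Matrix.measure_not_posSemidef_sum_sub_le`). The summands
are positive semidefinite, so the lower tail is light. Follow E tr (a + S)^(-q) for q a power of
two: adding an independent summand with mean at least μ lowers it at least as much as adding
(μ/2)·1, provided a is of order qB/μ, where B bounds the second moment. This rests on the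
Lieb-Thirring trace inequality and a scalar second-order bound. Markov's inequality then gives
failure probability p·2^(-q). Since B is of order p, q can be of order m/p, which is at least of
order K^(1−α), so the bound vanishes.

The value of B comes from a Taylor comparison of gradients at two points at distance ρ, which bounds
E((l̈(θ*)u)_j²) by a constant times ‖u‖² without a factor p. -/

noncomputable section

/-! ### Trace inequalities of Hölder and Lieb-Thirring type for dyadic exponents. -/

namespace Matrix

variable {ι : Type*} [Fintype ι]

/-- Cauchy-Schwarz for the Frobenius inner product. -/
theorem sq_trace_mul_le (A B : Matrix ι ι ℝ) :
    (A * B).trace ^ 2 ≤ (A * Aᵀ).trace * (B * Bᵀ).trace := by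
  have e1 : (A * B).trace = ∑ x : ι × ι, A x.1 x.2 * B x.2 x.1 := by
    simp [Matrix.trace, Matrix.mul_apply, Fintype.sum_prod_type]
  have e2 : (A * Aᵀ).trace = ∑ x : ι × ι, A x.1 x.2 ^ 2 := by
    simp [Matrix.trace, Matrix.mul_apply, Fintype.sum_prod_type, sq]
  have e3 : (B * Bᵀ).trace = ∑ x : ι × ι, B x.2 x.1 ^ 2 := by
    rw [Matrix.trace_mul_comm]
    simp [Matrix.trace, Matrix.mul_apply, Fintype.sum_prod_type, sq]
  rw [e1, e2, e3]
  exact Finset.sum_mul_sq_le_sq_mul_sq _ _ _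

variable [DecidableEq ι]

theorem trace_pow_mul_transpose_nonneg (A : Matrix ι ι ℝ) (k : ℕ) :
    0 ≤ ((A * Aᵀ) ^ k).trace := by
  simpa using ((posSemidef_self_mul_conjTranspose A).pow k).trace_nonneg

theorem trace_mul_pow_comm (A B : Matrix ι ι ℝ) (k : ℕ) :
    ((A * B) ^ k).trace = ((B * A) ^ k).trace := by
  cases k with
  | zero => simp
  | succ k =>
    have : (A * B) ^ (k + 1) = A * ((B * A) ^ k * B) := by
      rw [pow_succ', mul_assoc]
      congr 1
      induction k with
      | zero => simp
      | succ k ih => rw [pow_succ', pow_succ', mul_assoc, ih]; simp only [mul_assoc]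
    rw [this, Matrix.trace_mul_comm, mul_assoc, ← pow_succ]

end Matrix

theorem List.prod_map_range_two_mul {M : Type*} [Monoid M] (X : ℕ → M) (n : ℕ) :
    ((List.range (2 * n)).map X).prod
      = ((List.range n).map fun i => X (2 * i) * X (2 * i + 1)).prod := by
  induction n with
  | zero => simp
  | succ n ih =>
    rw [show 2 * (n + 1) = 2 * n + 1 + 1 by ring, List.range_succ, List.range_succ, List.range_succ]
    simp [ih]

theorem Finset.prod_range_two_mul_pairs {M : Type*} [CommMonoid M] (X : ℕ → M) (n : ℕ) :
    ∏ i ∈ Finset.range (2 * n), X i = ∏ i ∈ Finset.range n, X (2 * i) * X (2 * i + 1) := by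
  induction n with
  | zero => simp
  | succ n ih =>
    rw [show 2 * (n + 1) = 2 * n + 1 + 1 by ring, Finset.prod_range_succ, Finset.prod_range_succ,
      Finset.prod_range_succ, ih, mul_assoc]

namespace Matrix

variable {ι : Type*} [Fintype ι] [DecidableEq ι]

/-- Hölder's inequality for the trace of a product of `2 ^ (k + 1)` matrices. -/
theorem trace_prod_pow_le (k : ℕ) (X : ℕ → Matrix ι ι ℝ) :
    (((List.range (2 ^ (k + 1))).map X).prod).trace ^ 2 ^ (k + 1)
      ≤ ∏ i ∈ Finset.range (2 ^ (k + 1)), ((X i * (X i)ᵀ) ^ 2 ^ k).trace := by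
  induction k generalizing X with
  | zero => simpa [List.range_succ, Finset.prod_range_succ] using sq_trace_mul_le (X 0) (X 1)
  | succ k ih =>
    set N := 2 ^ (k + 1) with hN
    have hN2 : 2 ^ (k + 1 + 1) = 2 * N := by rw [hN]; ring
    rw [hN2, List.prod_map_range_two_mul, Finset.prod_range_two_mul_pairs, mul_comm 2 N, pow_mul]
    -- Neighbouring factors are paired and the induction hypothesis is used twice: on the
    -- half-length product of pairs, and here on the alternating word A'B'A'B'… of the same length,
    -- which has the trace of the power attached to one pair.
    have key (A B : Matrix ι ι ℝ) : ((A * B * (A * B)ᵀ) ^ 2 ^ k).trace ^ 2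
        ≤ ((A * Aᵀ) ^ N).trace * ((B * Bᵀ) ^ N).trace := by
      set A' := Aᵀ * A
      set B' := B * Bᵀ
      have hA' : A'ᵀ = A' := by simp [A']
      have hB' : B'ᵀ = B' := by simp [B']
      have e1 : ((A * B * (A * B)ᵀ) ^ 2 ^ k).trace = ((A' * B') ^ 2 ^ k).trace := by
        have : A * B * (A * B)ᵀ = A * (B * Bᵀ * Aᵀ) := by simp [mul_assoc]
        rw [this, trace_mul_pow_comm, trace_mul_pow_comm A' B']
        simp [A', B', mul_assoc]
      have e2 : ((List.range N).map fun i => if i % 2 = 0 then A' else B').prod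
          = (A' * B') ^ 2 ^ k := by
        rw [hN, pow_succ', List.prod_map_range_two_mul]
        simp [Nat.add_mod]
      have h := ih fun i => if i % 2 = 0 then A' else B'
      rw [e2, hN, pow_succ' 2 k, Finset.prod_range_two_mul_pairs] at h
      simp only [Nat.mul_mod_right, if_true, Nat.mul_add_mod, Nat.one_mod, one_ne_zero, if_false,
        Finset.prod_const, Finset.card_range, hA', hB', ← pow_two, ← pow_mul] at h
      rw [pow_mul] at h
      have e3 : ((A * Aᵀ) ^ N).trace = (A' ^ N).trace := trace_mul_pow_comm _ _ _
      rw [e1, e3, hN]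
      rw [← pow_succ' 2 k] at h
      -- The right side of `h` consists of 2^k equal pairs of traces, so taking the root of order
      -- 2^k leaves the square wanted.
      refine le_of_pow_le_pow_left₀ (pow_ne_zero k two_ne_zero) ?_ h
      rw [← hN, ← e3]
      exact mul_nonneg (trace_pow_mul_transpose_nonneg _ _) (trace_pow_mul_transpose_nonneg _ _)
    have h := ih fun i => X (2 * i) * X (2 * i + 1)
    refine (pow_le_pow_left₀ (Even.pow_nonneg ⟨2 ^ k, by rw [hN]; ring⟩ _) h 2).trans ?_
    rw [← Finset.prod_pow]
    exact Finset.prod_le_prod (fun _ _ => sq_nonneg _) fun i _ => key _ _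

/-- Hölder's inequality with all factors equal, after a root of order 2^(k+1). This is the step that
symmetrizes a product AB in the Lieb-Thirring induction. -/
theorem trace_pow_two_mul_le (X : Matrix ι ι ℝ) (k : ℕ) :
    (X ^ (2 ^ (k + 1))).trace ≤ ((X * Xᵀ) ^ 2 ^ k).trace := by
  have h := trace_prod_pow_le k fun _ => X
  simp only [List.map_const', List.length_range, List.prod_replicate, Finset.prod_const,
    Finset.card_range] at h
  refine (le_abs_self _).trans (le_of_pow_le_pow_left₀ (pow_ne_zero (k + 1) two_ne_zero)
    (trace_pow_mul_transpose_nonneg _ _) ?_)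
  rwa [Even.pow_abs ⟨2 ^ k, by ring⟩]

/-- The Lieb-Thirring trace inequality for dyadic exponents. -/
theorem trace_mul_pow_two_pow_le {A B : Matrix ι ι ℝ} (hA : Aᵀ = A) (hB : Bᵀ = B) (j : ℕ) :
    ((A * B) ^ 2 ^ j).trace ≤ (A ^ 2 ^ j * B ^ 2 ^ j).trace := by
  induction j generalizing A B with
  | zero => simp
  | succ j ih =>
    -- For symmetric A and B, AB(AB)ᵀ = AB²A, whose powers have the same traces as those of A²B².
    -- The hypothesis then applies to the pair A², B².
    refine (trace_pow_two_mul_le _ j).trans ?_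
    have : A * B * (A * B)ᵀ = A * (B * B * A) := by simp [hA, hB, mul_assoc]
    rw [this, trace_mul_pow_comm, mul_assoc, trace_mul_pow_comm, pow_succ' 2 j, pow_mul, pow_mul,
      pow_two, pow_two]
    exact ih (by simp [hA]) (by simp [hB])

/-! ### Traces of powers of resolvents: second-order expansion and comparison with a scalar shift.
-/

/-- The functional calculus of a symmetric real matrix. -/
theorem exists_algHom_diagonalization {Z : Matrix ι ι ℝ} (hZ : Z.PosSemidef) :
    ∃ (z : ι → ℝ) (φ : (ι → ℝ) →ₐ[ℝ] Matrix ι ι ℝ), (∀ i, 0 ≤ z i) ∧ φ z = Z ∧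
      (∀ f, (φ f)ᵀ = φ f) ∧ (∀ f, (∀ i, 0 ≤ f i) → (φ f).PosSemidef) ∧
      (∀ f, (φ f).trace = ∑ i, f i) ∧
      ∀ W : Matrix ι ι ℝ, W.PosSemidef →
        ∃ w : ι → ℝ, (∀ i, 0 ≤ w i) ∧ ∀ f, (W * φ f).trace = ∑ i, w i * f i := by
  set U := hZ.1.eigenvectorUnitary with hU
  set φ : (ι → ℝ) →ₐ[ℝ] Matrix ι ι ℝ :=
    ((Unitary.conjStarAlgAut ℝ (Matrix ι ι ℝ) U : Matrix ι ι ℝ ≃⋆ₐ[ℝ] Matrix ι ι ℝ) :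
      Matrix ι ι ℝ →ₐ[ℝ] Matrix ι ι ℝ).comp (diagonalAlgHom ℝ) with hφ
  have happ (f : ι → ℝ) : φ f = (U : Matrix ι ι ℝ) * diagonal f * (U : Matrix ι ι ℝ)ᴴ := by
    simp [hφ, Unitary.conjStarAlgAut_apply, star_eq_conjTranspose]
  refine ⟨hZ.1.eigenvalues, φ, hZ.eigenvalues_nonneg, ?_, ?_, ?_, ?_, ?_⟩
  · rw [happ]
    conv_rhs => rw [hZ.1.spectral_theorem, Unitary.conjStarAlgAut_apply]
    simp [star_eq_conjTranspose, hU]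
  · intro f
    rw [happ]
    simp [mul_assoc]
  · intro f hf
    rw [happ]
    exact (PosSemidef.diagonal hf).mul_mul_conjTranspose_same _
  · intro f
    have hU1 : (U : Matrix ι ι ℝ)ᴴ * (U : Matrix ι ι ℝ) = 1 := Unitary.coe_star_mul_self U
    rw [happ, trace_mul_comm, ← mul_assoc, hU1, one_mul, trace_diagonal]
  · intro W hW
    -- The weights are the diagonal entries of W in the eigenbasis of Z. Being nonnegative, they
    -- turn scalar inequalities on the spectrum into trace inequalities against W.
    refine ⟨fun i => ((U : Matrix ι ι ℝ)ᴴ * W * (U : Matrix ι ι ℝ)) i i, fun i =>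
      (hW.conjTranspose_mul_mul_same _).diag_nonneg, fun f => ?_⟩
    rw [happ, mul_assoc (U : Matrix ι ι ℝ), ← mul_assoc W, ← mul_assoc, trace_mul_comm,
      ← mul_assoc, ← mul_assoc]
    simp [Matrix.trace, mul_diagonal]

theorem PosSemidef.exists_sqrt {W : Matrix ι ι ℝ} (hW : W.PosSemidef) :
    ∃ Q : Matrix ι ι ℝ, Qᵀ = Q ∧ Q * Q = W := by
  obtain ⟨z, φ, hz, rfl, hsymm, -⟩ := exists_algHom_diagonalization hW
  refine ⟨φ fun i => √(z i), hsymm _, ?_⟩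
  rw [← map_mul]
  congr 1
  ext i
  exact Real.mul_self_sqrt (hz i)

/-- Bernoulli gives (1 + z)^q ≥ 1 + x with x = qz, and (1 + x)(1 − x + x²) = 1 + x³ ≥ 1. -/
theorem one_add_pow_inv_le {z : ℝ} (hz : 0 ≤ z) (q : ℕ) :
    ((1 + z)⁻¹) ^ q ≤ 1 - q * z + q ^ 2 * z ^ 2 := by
  rcases q.eq_zero_or_pos with rfl | hq
  · simp
  have hq1 : (1 : ℝ) ≤ q := by exact_mod_cast hq
  have h := one_add_mul_le_pow (show (-2 : ℝ) ≤ z by linarith) q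
  have h1 : 0 < 1 + (q : ℝ) * z := by positivity
  rw [inv_pow]
  refine (inv_anti₀ h1 h).trans ?_
  rw [inv_le_iff_one_le_mul₀ h1]
  nlinarith [pow_nonneg (mul_nonneg (zero_le_one.trans hq1) hz) 3]

/-- Scalar form of the shift comparison: r plays an eigenvalue of N⁻¹, and r/(1 + dr) is then that
of (N + d)⁻¹. It follows from 1/(1 + dr) ≥ 1 − dr and Bernoulli. -/
theorem pow_le_shift_pow {r d : ℝ} (hr : 0 ≤ r) (hd : 0 ≤ d) (q : ℕ) :
    r ^ q ≤ (r * (1 + d * r)⁻¹) ^ q + q * d * r ^ (q + 1) := by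
  have h1 : 0 < 1 + d * r := by positivity
  have hlt : (-2 : ℝ) ≤ (1 + d * r)⁻¹ - 1 := by
    have := inv_nonneg.2 h1.le
    linarith
  have h := one_add_mul_le_pow hlt q
  have h2 : 1 - d * r ≤ (1 + d * r)⁻¹ := by
    rw [← one_div, le_div_iff₀ h1]
    nlinarith [sq_nonneg (d * r)]
  have h3 : 1 - (q : ℝ) * (d * r) ≤ ((1 + d * r)⁻¹) ^ q := by
    rw [add_sub_cancel] at h
    nlinarith [(Nat.cast_nonneg q : (0 : ℝ) ≤ q)]
  rw [mul_pow]
  have h4 := mul_le_mul_of_nonneg_left h3 (pow_nonneg hr q)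
  rw [pow_succ]
  linarith

/-- Runs opposite to `trace_inv_add_pow_le`: a first-order decrease of size q·d·tr N^(-(q+1))
already brings the trace below its value after the deterministic shift by d. -/
theorem trace_inv_pow_shift_le {N : Matrix ι ι ℝ} (hN : N.PosDef) {d : ℝ} (hd : 0 ≤ d) (q : ℕ) :
    (N⁻¹ ^ q).trace ≤ ((N + d • (1 : Matrix ι ι ℝ))⁻¹ ^ q).trace
      + q * d * (N⁻¹ ^ (q + 1)).trace := by
  have hR : N⁻¹.PosSemidef := hN.inv.posSemidef
  have hNu : IsUnit N.det := (isUnit_iff_isUnit_det _).1 hN.isUnit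
  obtain ⟨r, φ, hr, hφ, -, -, -, h⟩ := exists_algHom_diagonalization hR
  obtain ⟨w, hw, h⟩ := h 1 PosSemidef.one
  have h0 (i) : 1 + d * r i ≠ 0 := by have := mul_nonneg hd (hr i); positivity
  have hinv : (N + d • (1 : Matrix ι ι ℝ))⁻¹ = φ fun i => r i * (1 + d * r i)⁻¹ := by
    apply inv_eq_left_inv
    have e1 : N + d • (1 : Matrix ι ι ℝ) = (1 + d • N⁻¹) * N := by
      rw [add_mul, one_mul, smul_mul_assoc, nonsing_inv_mul _ hNu]
    have e2 : (1 + d • N⁻¹) = φ fun i => 1 + d * r i := by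
      rw [← hφ, ← map_one φ, ← map_smul, ← map_add]
      rfl
    rw [e1, ← mul_assoc, e2, ← map_mul]
    have e3 : ((fun i => r i * (1 + d * r i)⁻¹) * fun i => 1 + d * r i) = r := by
      ext i
      simp [mul_assoc, inv_mul_cancel₀ (h0 i)]
    rw [e3, hφ, nonsing_inv_mul _ hNu]
  rw [hinv, ← hφ, ← map_pow, ← map_pow, ← map_pow, ← one_mul (φ (r ^ q)),
    ← one_mul (φ (r ^ (q + 1))), ← one_mul (φ ((fun i => r i * (1 + d * r i)⁻¹) ^ q)), h, h, h,
    Finset.mul_sum, ← Finset.sum_add_distrib]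
  refine Finset.sum_le_sum fun i _ => ?_
  have := mul_le_mul_of_nonneg_left (pow_le_shift_pow (hr i) hd q) (hw i)
  simp only [Pi.pow_apply]
  linarith

/-- Second-order upper bound for the trace of a dyadic power of a resolvent. -/
theorem trace_inv_add_pow_le {N X : Matrix ι ι ℝ} (hN : N.PosDef) (hX : X.PosSemidef) (j : ℕ) :
    ((N + X)⁻¹ ^ 2 ^ j).trace ≤ (N⁻¹ ^ 2 ^ j).trace - (2 ^ j : ℕ) * (N⁻¹ ^ (2 ^ j + 1) * X).trace
      + (2 ^ j : ℕ) ^ 2 * (N⁻¹ ^ (2 ^ j + 1) * (X * N⁻¹ * X)).trace := by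
  set q := 2 ^ j with hq
  set R := N⁻¹ with hRdef
  have hR : R.PosSemidef := hN.inv.posSemidef
  have hNu : IsUnit N.det := (isUnit_iff_isUnit_det _).1 hN.isUnit
  obtain ⟨Q, hQt, hQQ⟩ := hR.exists_sqrt
  set Z := Q * X * Q with hZdef
  have hZ : Z.PosSemidef := by
    have := hX.mul_mul_conjTranspose_same Q
    rwa [conjTranspose_eq_transpose_of_trivial, hQt] at this
  obtain ⟨z, ψ, hz, hψ, hsymm', -, -, h⟩ := exists_algHom_diagonalization hZ
  set D := ψ fun i => (1 + z i)⁻¹ with hDdef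
  have hD : D * (1 + Z) = 1 := by
    rw [← hψ, ← map_one ψ, ← map_add, hDdef, ← map_mul]
    congr 1
    ext i
    have := hz i
    simp only [Pi.mul_apply, Pi.add_apply, Pi.one_apply]
    exact inv_mul_cancel₀ (by positivity)
  have hQN : Q * N * Q = 1 := by
    have h1 : Q * (Q * N) = 1 := by rw [← mul_assoc, hQQ, hRdef, nonsing_inv_mul _ hNu]
    exact mul_eq_one_comm.1 h1
  have hQu : Q * (N * Q) = 1 := by rw [← mul_assoc, hQN]
  have hinv : (N + X)⁻¹ = Q * D * Q := by
    apply inv_eq_right_inv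
    have h2 : Q * ((N + X) * (Q * D * Q)) * (N * Q) = Q * (N * Q) := by
      calc Q * ((N + X) * (Q * D * Q)) * (N * Q)
          = (Q * N * Q + Q * X * Q) * D * (Q * (N * Q)) := by
            simp only [mul_assoc, mul_add, add_mul]
        _ = Q * (N * Q) := by rw [hQN, hQu, ← hZdef, mul_eq_one_comm.1 hD, one_mul]
    have h3 : (N * Q) * Q = 1 := mul_eq_one_comm.1 hQu
    have h4 : Q * ((N + X) * (Q * D * Q)) * (N * Q) * Q = Q * (N * Q) * Q := by rw [h2]
    rw [mul_assoc _ (N * Q), h3, mul_one, hQu, one_mul] at h4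
    calc (N + X) * (Q * D * Q) = (N * Q) * Q * ((N + X) * (Q * D * Q)) := by rw [h3, one_mul]
      _ = (N * Q) * (Q * ((N + X) * (Q * D * Q))) := by simp only [mul_assoc]
      _ = 1 := by rw [h4, h3]
  have hRt : Rᵀ = R := hR.1
  have hcomm : Commute Q R := by
    rw [← hQQ]
    exact (Commute.refl Q).mul_right (Commute.refl Q)
  -- Lieb-Thirring separates the noncommuting R and D. After this, D^q is a function of Z alone and
  -- the scalar bound can be applied with weights from R^q.
  have step1 : ((N + X)⁻¹ ^ q).trace ≤ (R ^ q * D ^ q).trace := by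
    rw [hinv, trace_mul_pow_comm, ← mul_assoc, hQQ]
    exact trace_mul_pow_two_pow_le hRt (hsymm' _) j
  obtain ⟨w, hw, h⟩ := h (R ^ q) (hR.pow q)
  have step2 : (R ^ q * D ^ q).trace ≤ (R ^ q * (1 - (q : ℝ) • Z + ((q : ℝ) ^ 2) • (Z * Z))).trace := by
    have e : (1 - (q : ℝ) • Z + ((q : ℝ) ^ 2) • (Z * Z))
        = ψ fun i => 1 - q * z i + q ^ 2 * z i ^ 2 := by
      rw [← hψ, ← map_mul, ← map_one ψ, ← map_smul, ← map_smul, ← map_sub, ← map_add]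
      congr 1
      ext i
      simp [sq]
    rw [e, hDdef, ← map_pow, h, h]
    exact Finset.sum_le_sum fun i _ => mul_le_mul_of_nonneg_left (one_add_pow_inv_le (hz i) q) (hw i)
  refine step1.trans (step2.trans_eq ?_)
  have e1 : (R ^ q * Z).trace = (R ^ (q + 1) * X).trace := by
    rw [hZdef, ← mul_assoc, trace_mul_comm, ← mul_assoc, ← mul_assoc,
      (hcomm.pow_right q).eq, mul_assoc (R ^ q), hQQ, ← pow_succ]
  have e2 : (R ^ q * (Z * Z)).trace = (R ^ (q + 1) * (X * R * X)).trace := by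
    have : R ^ q * (Z * Z) = R ^ q * Q * (X * R * X) * Q := by
      simp only [hZdef, mul_assoc, ← hQQ]
    rw [this, trace_mul_comm, mul_assoc (R ^ q), ← mul_assoc, ← mul_assoc,
      (hcomm.pow_right q).eq, mul_assoc (R ^ q), hQQ, ← pow_succ]
  rw [mul_add, mul_sub, trace_add, trace_sub, mul_one, mul_smul_comm, mul_smul_comm, trace_smul,
    trace_smul, e1, e2, smul_eq_mul, smul_eq_mul]

end Matrix

/-! ### Lower tail of the smallest eigenvalue of a sum of independent positive semidefinite
matrices. -/

instance Matrix.instMeasurableSpaceReal {m n : Type*} : MeasurableSpace (Matrix m n ℝ) :=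
  inferInstanceAs (MeasurableSpace (m → n → ℝ))

instance Matrix.instBorelSpaceReal {m n : Type*} [Finite m] [Finite n] :
    BorelSpace (Matrix m n ℝ) :=
  inferInstanceAs (BorelSpace (m → n → ℝ))

instance Matrix.instSecondCountableTopologyReal {m n : Type*} [Finite m] [Finite n] :
    SecondCountableTopology (Matrix m n ℝ) :=
  inferInstanceAs (SecondCountableTopology (m → n → ℝ))

theorem ProbabilityTheory.IndepFun.lintegral_comp_eq {Ω β γ : Type*} [MeasurableSpace Ω]
    [MeasurableSpace β] [MeasurableSpace γ] {P : Measure Ω} [IsProbabilityMeasure P]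
    {X : Ω → β} {Y : Ω → γ} (hX : Measurable X) (hY : Measurable Y) (h : IndepFun X Y P)
    {F : β × γ → ENNReal} (hF : Measurable F) :
    ∫⁻ ω, F (X ω, Y ω) ∂P = ∫⁻ ω, ∫⁻ ω', F (X ω, Y ω') ∂P ∂P := by
  have h1 := (indepFun_iff_map_prod_eq_prod_map_map hX.aemeasurable hY.aemeasurable).1 h
  rw [Measure.map_prod_map _ _ hX hY] at h1
  calc ∫⁻ ω, F (X ω, Y ω) ∂P = ∫⁻ z, F z ∂(P.map fun ω => (X ω, Y ω)) :=
        (lintegral_map hF (hX.prodMk hY)).symm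
    _ = ∫⁻ z, F (Prod.map X Y z) ∂(P.prod P) := by
        rw [h1, lintegral_map hF (hX.prodMap hY)]
    _ = _ := lintegral_prod _ (hF.comp (hX.prodMap hY)).aemeasurable

namespace Matrix

variable {ι : Type*} [Fintype ι] [DecidableEq ι]

theorem measurable_trace_inv_pow (b : ℝ) (q : ℕ) :
    Measurable fun S : Matrix ι ι ℝ => ((b • (1 : Matrix ι ι ℝ) + S)⁻¹ ^ q).trace := by
  -- The formula det⁻¹ · adjugate also covers singular matrices, where the inverse is 0 by
  -- convention.
  have h1 : Measurable fun S : Matrix ι ι ℝ => S⁻¹ := by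
    simp only [inv_def, Ring.inverse_eq_inv']
    exact (continuous_id.matrix_det.measurable.inv).smul continuous_id.matrix_adjugate.measurable
  have h2 : Continuous fun S : Matrix ι ι ℝ => (S ^ q).trace := (continuous_id.pow q).matrix_trace
  have h3 : Continuous fun S : Matrix ι ι ℝ => b • (1 : Matrix ι ι ℝ) + S := by fun_prop
  exact h2.measurable.comp (h1.comp h3.measurable)

/-- With y = N⁻¹v, the bound N ≥ a reads a‖y‖² ≤ v·y, and Cauchy-Schwarz for v·y finishes. -/
theorem dotProduct_inv_mulVec_le {N : Matrix ι ι ℝ} {a : ℝ} (ha : 0 < a) (hN : N.PosDef)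
    (hNa : (N - a • (1 : Matrix ι ι ℝ)).PosSemidef) (v : ι → ℝ) :
    v ⬝ᵥ (N⁻¹ *ᵥ v) ≤ a⁻¹ * (v ⬝ᵥ v) := by
  have hNu : IsUnit N.det := (isUnit_iff_isUnit_det _).1 hN.isUnit
  set y := N⁻¹ *ᵥ v with hy
  have hv : N *ᵥ y = v := by rw [hy, mulVec_mulVec, mul_nonsing_inv _ hNu, one_mulVec]
  have h1 : a * (y ⬝ᵥ y) ≤ v ⬝ᵥ y := by
    have := hNa.dotProduct_mulVec_nonneg y
    simp only [star_trivial, sub_mulVec, smul_mulVec, one_mulVec, dotProduct_sub,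
      dotProduct_smul, hv, smul_eq_mul] at this
    rw [dotProduct_comm v y]
    linarith
  have h2 : (v ⬝ᵥ y) ^ 2 ≤ (v ⬝ᵥ v) * (y ⬝ᵥ y) := by
    simpa [dotProduct, sq] using Finset.sum_mul_sq_le_sq_mul_sq Finset.univ v y
  have hyy : 0 ≤ y ⬝ᵥ y := by simpa using dotProduct_star_self_nonneg y
  have hvv : 0 ≤ v ⬝ᵥ v := by simpa using dotProduct_star_self_nonneg v
  have hvy : 0 ≤ v ⬝ᵥ y := (mul_nonneg ha.le hyy).trans h1
  rw [inv_mul_eq_div, le_div_iff₀ ha]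
  rcases hvy.eq_or_lt with h0 | h0
  · rw [← h0]; simpa using hvv
  · refine le_of_mul_le_mul_left ?_ h0
    nlinarith

omit [DecidableEq ι] in
-- Expands a weighted trace into quadratic forms of X along fixed vectors, the only quantities that
-- `IsMomentBounded` controls.
theorem trace_sq_mul {P X : Matrix ι ι ℝ} (hP : Pᵀ = P) :
    (P * P * X).trace = ∑ i, P.row i ⬝ᵥ (X *ᵥ P.row i) := by
  rw [mul_assoc, trace_mul_comm, trace]
  refine Finset.sum_congr rfl fun i _ => ?_
  have : (P * X * P) i i = P.row i ⬝ᵥ (X *ᵥ P.row i) := by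
    rw [mul_assoc, mul_apply_eq_vecMul]
    have h2 (j : ι) : X *ᵥ P.row j = fun k => (X * P) k j := by
      ext k
      conv_lhs => rw [← hP]
      rfl
    rw [h2]
    rfl
  exact this

variable {Ω : Type*} [MeasurableSpace Ω] {P : Measure Ω} [IsProbabilityMeasure P]

/-- A random positive semidefinite matrix with a lower bound on its mean and an upper bound on its
second moment. -/
structure IsMomentBounded (A : Ω → Matrix ι ι ℝ) (P : Measure Ω) (μ B : ℝ) : Prop where
  measurable : Measurable A
  posSemidef : ∀ ω, (A ω).PosSemidef
  integrable_sq : ∀ u, Integrable (fun ω => (A ω *ᵥ u) ⬝ᵥ (A ω *ᵥ u)) P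
  le_integral : ∀ u, μ * (u ⬝ᵥ u) ≤ ∫ ω, u ⬝ᵥ (A ω *ᵥ u) ∂P
  integral_sq_le : ∀ u, ∫ ω, (A ω *ᵥ u) ⬝ᵥ (A ω *ᵥ u) ∂P ≤ B * (u ⬝ᵥ u)

omit [DecidableEq ι] [IsProbabilityMeasure P] in
theorem IsMomentBounded.measurable_dotProduct {A : Ω → Matrix ι ι ℝ} {μ B : ℝ}
    (hA : IsMomentBounded A P μ B) (u v : ι → ℝ) :
    Measurable fun ω => v ⬝ᵥ (A ω *ᵥ u) := by
  have : Continuous fun M : Matrix ι ι ℝ => v ⬝ᵥ (M *ᵥ u) := by fun_prop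
  exact this.measurable.comp hA.measurable

omit [DecidableEq ι] in
theorem IsMomentBounded.integrable {A : Ω → Matrix ι ι ℝ} {μ B : ℝ}
    (hA : IsMomentBounded A P μ B) (u : ι → ℝ) :
    Integrable (fun ω => u ⬝ᵥ (A ω *ᵥ u)) P := by
  refine ((hA.integrable_sq u).add (integrable_const (u ⬝ᵥ u))).mono'
    (hA.measurable_dotProduct u u).aestronglyMeasurable (ae_of_all _ fun ω => ?_)
  have h2 : (u ⬝ᵥ (A ω *ᵥ u)) ^ 2 ≤ (u ⬝ᵥ u) * ((A ω *ᵥ u) ⬝ᵥ (A ω *ᵥ u)) := by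
    simpa [dotProduct, sq] using Finset.sum_mul_sq_le_sq_mul_sq Finset.univ u (A ω *ᵥ u)
  have hvv : 0 ≤ u ⬝ᵥ u := by simpa using dotProduct_star_self_nonneg u
  have hyy : 0 ≤ (A ω *ᵥ u) ⬝ᵥ (A ω *ᵥ u) := by simpa using dotProduct_star_self_nonneg (A ω *ᵥ u)
  rw [Real.norm_eq_abs]
  refine abs_le_of_sq_le_sq ?_ (by simpa using add_nonneg hyy hvv)
  simp only [Pi.add_apply]
  nlinarith

/-- Averaging the second-order expansion over A gains q·μ·tr R^(q+1) from the mean and loses at most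
q²(B/a)·tr R^(q+1), since R ≤ 1/a. Under `hcond` the net gain is at least q·d·tr R^(q+1), which pays
for a deterministic shift by d. -/
theorem lintegral_trace_inv_add_pow_le {A : Ω → Matrix ι ι ℝ} {μ B a d : ℝ}
    (hA : IsMomentBounded A P μ B) (ha : 0 < a) (hd : 0 ≤ d)
    {b : ℝ} (hab : a ≤ b) {S : Matrix ι ι ℝ} (hS : S.PosSemidef) (j : ℕ)
    (hcond : d + (2 ^ j : ℕ) * B / a ≤ μ) :
    ∫⁻ ω, ENNReal.ofReal (((b • (1 : Matrix ι ι ℝ) + (S + A ω))⁻¹ ^ 2 ^ j).trace) ∂P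
      ≤ ENNReal.ofReal ((((b + d) • (1 : Matrix ι ι ℝ) + S)⁻¹ ^ 2 ^ j).trace) := by
  set q := 2 ^ j with hq
  set N := b • (1 : Matrix ι ι ℝ) + S with hNdef
  have hb : 0 < b := ha.trans_le hab
  have hN : N.PosDef := (PosDef.one.smul hb).add_posSemidef hS
  have hNa : (N - a • (1 : Matrix ι ι ℝ)).PosSemidef := by
    have : N - a • (1 : Matrix ι ι ℝ) = (b - a) • (1 : Matrix ι ι ℝ) + S := by
      rw [hNdef, sub_smul]; abel
    rw [this]
    exact (PosSemidef.one.smul (sub_nonneg.2 hab)).add hS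
  set R := N⁻¹ with hR
  have hRps : R.PosSemidef := hN.inv.posSemidef
  obtain ⟨Q, hQt, hQQ⟩ := (hRps.pow (q + 1)).exists_sqrt
  have htr : (R ^ (q + 1)).trace = ∑ i, Q.row i ⬝ᵥ Q.row i := by
    rw [← hQQ, ← mul_one (Q * Q), trace_sq_mul hQt]
    simp
  have hX1 (X : Matrix ι ι ℝ) : (R ^ (q + 1) * X).trace = ∑ i, Q.row i ⬝ᵥ (X *ᵥ Q.row i) := by
    rw [← hQQ, trace_sq_mul hQt]
  have hX2 (X : Matrix ι ι ℝ) (hX : X.PosSemidef) : (R ^ (q + 1) * (X * R * X)).trace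
      ≤ a⁻¹ * ∑ i, (X *ᵥ Q.row i) ⬝ᵥ (X *ᵥ Q.row i) := by
    rw [hX1, Finset.mul_sum]
    refine Finset.sum_le_sum fun i _ => ?_
    have hXt : Xᵀ = X := hX.1
    have : Q.row i ⬝ᵥ ((X * R * X) *ᵥ Q.row i) = (X *ᵥ Q.row i) ⬝ᵥ (R *ᵥ (X *ᵥ Q.row i)) := by
      rw [← mulVec_mulVec, ← mulVec_mulVec, dotProduct_mulVec, ← mulVec_transpose, hXt]
    rw [this]
    exact dotProduct_inv_mulVec_le ha hN hNa _
  set f : Ω → ℝ := fun ω => (R ^ q).trace - q * ∑ i, Q.row i ⬝ᵥ (A ω *ᵥ Q.row i)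
      + q ^ 2 * (a⁻¹ * ∑ i, (A ω *ᵥ Q.row i) ⬝ᵥ (A ω *ᵥ Q.row i)) with hf
  have hle (ω : Ω) : ((b • (1 : Matrix ι ι ℝ) + (S + A ω))⁻¹ ^ q).trace ≤ f ω := by
    have h1 := trace_inv_add_pow_le hN (hA.posSemidef ω) j
    rw [← hq, ← hR, hX1] at h1
    rw [← add_assoc, ← hNdef, hf]
    refine h1.trans ?_
    have := mul_le_mul_of_nonneg_left (hX2 _ (hA.posSemidef ω)) (sq_nonneg (q : ℝ))
    linarith
  have hnn (ω : Ω) : 0 ≤ ((b • (1 : Matrix ι ι ℝ) + (S + A ω))⁻¹ ^ q).trace := by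
    refine PosSemidef.trace_nonneg (PosSemidef.pow (PosSemidef.inv ?_) q)
    exact (PosSemidef.one.smul hb.le).add (hS.add (hA.posSemidef ω))
  have hi1 : Integrable (fun ω => ∑ i, Q.row i ⬝ᵥ (A ω *ᵥ Q.row i)) P :=
    integrable_finsetSum _ fun i _ => hA.integrable _
  have hi2 : Integrable (fun ω => ∑ i, (A ω *ᵥ Q.row i) ⬝ᵥ (A ω *ᵥ Q.row i)) P :=
    integrable_finsetSum _ fun i _ => hA.integrable_sq _
  have hfi : Integrable f P := ((integrable_const _).sub (hi1.const_mul _)).add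
    ((hi2.const_mul _).const_mul _)
  refine (lintegral_mono fun ω => ENNReal.ofReal_le_ofReal (hle ω)).trans ?_
  rw [← ofReal_integral_eq_lintegral_ofReal hfi (ae_of_all _ fun ω => (hnn ω).trans (hle ω))]
  refine ENNReal.ofReal_le_ofReal ?_
  have hint : ∫ ω, f ω ∂P = (R ^ q).trace - q * ∑ i, ∫ ω, Q.row i ⬝ᵥ (A ω *ᵥ Q.row i) ∂P
      + q ^ 2 * (a⁻¹ * ∑ i, ∫ ω, (A ω *ᵥ Q.row i) ⬝ᵥ (A ω *ᵥ Q.row i) ∂P) := by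
    have e1 := integral_add ((integrable_const (R ^ q).trace).sub (hi1.const_mul (q : ℝ)))
      ((hi2.const_mul a⁻¹).const_mul ((q : ℝ) ^ 2))
    have e2 := integral_sub (integrable_const (R ^ q).trace) (hi1.const_mul (q : ℝ))
    refine e1.trans ?_
    rw [integral_const_mul, integral_const_mul,
      integral_finsetSum _ fun i _ => hA.integrable_sq _]
    refine congrArg (· + _) (e2.trans ?_)
    rw [integral_const_mul, integral_finsetSum _ fun i _ => hA.integrable _]
    simp
  have hs1 : μ * (R ^ (q + 1)).trace ≤ ∑ i, ∫ ω, Q.row i ⬝ᵥ (A ω *ᵥ Q.row i) ∂P := by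
    rw [htr, Finset.mul_sum]
    exact Finset.sum_le_sum fun i _ => hA.le_integral _
  have hs2 : ∑ i, ∫ ω, (A ω *ᵥ Q.row i) ⬝ᵥ (A ω *ᵥ Q.row i) ∂P ≤ B * (R ^ (q + 1)).trace := by
    rw [htr, Finset.mul_sum]
    exact Finset.sum_le_sum fun i _ => hA.integral_sq_le _
  have hshift := trace_inv_pow_shift_le hN hd q
  have hN2 : N + d • (1 : Matrix ι ι ℝ) = (b + d) • (1 : Matrix ι ι ℝ) + S := by
    rw [hNdef, add_smul]; abel
  rw [hN2, ← hR] at hshift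
  have htnn : 0 ≤ (R ^ (q + 1)).trace := (hRps.pow _).trace_nonneg
  rw [hint]
  have hq0 : (0 : ℝ) ≤ q := Nat.cast_nonneg q
  have h1 := mul_le_mul_of_nonneg_left hs1 hq0
  have h2 := mul_le_mul_of_nonneg_left hs2 (mul_nonneg (sq_nonneg (q : ℝ)) (inv_nonneg.2 ha.le))
  have h3 := mul_le_mul_of_nonneg_right hcond (mul_nonneg hq0 htnn)
  have e : (d + q * B / a) * (q * (R ^ (q + 1)).trace) = q * d * (R ^ (q + 1)).trace
      + (q : ℝ) ^ 2 * a⁻¹ * (B * (R ^ (q + 1)).trace) := by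
    field_simp
  linarith

/-- The summands are integrated out one at a time, each being exchanged for d·1. The level b is kept
general because it grows by d at every exchange, and b ≥ a is preserved. -/
theorem lintegral_trace_inv_sum_pow_le {κ : Type*} [Fintype κ] {A : κ → Ω → Matrix ι ι ℝ}
    {μ B a d : ℝ} (hA : ∀ k, IsMomentBounded (A k) P μ B) (hind : iIndepFun A P)
    (ha : 0 < a) (hd : 0 ≤ d) (j : ℕ) (hcond : d + (2 ^ j : ℕ) * B / a ≤ μ)
    (s : Finset κ) (b : ℝ) (hab : a ≤ b) :
    ∫⁻ ω, ENNReal.ofReal (((b • (1 : Matrix ι ι ℝ) + ∑ k ∈ s, A k ω)⁻¹ ^ 2 ^ j).trace) ∂P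
      ≤ ENNReal.ofReal (Fintype.card ι * ((b + s.card * d)⁻¹) ^ 2 ^ j) := by
  classical
  induction s using Finset.induction_on generalizing b with
  | empty =>
    have hb : b ≠ 0 := (ha.trans_le hab).ne'
    have : (b • (1 : Matrix ι ι ℝ))⁻¹ = b⁻¹ • (1 : Matrix ι ι ℝ) := by
      apply inv_eq_left_inv
      simp [smul_smul, mul_inv_cancel₀ hb]
    simp [this, smul_pow, mul_comm]
  | insert i s hi ih =>
    have hmeas : Measurable fun z : Matrix ι ι ℝ × Matrix ι ι ℝ =>
        ENNReal.ofReal (((b • (1 : Matrix ι ι ℝ) + (z.1 + z.2))⁻¹ ^ 2 ^ j).trace) :=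
      ((measurable_trace_inv_pow b (2 ^ j)).comp
        (measurable_fst.add measurable_snd)).ennreal_ofReal
    have hind' := hind.indepFun_finsetSum_of_notMem (fun k => (hA k).measurable) hi
    have hSm : Measurable (∑ k ∈ s, A k) := by
      rw [show (∑ k ∈ s, A k) = fun ω => ∑ k ∈ s, A k ω from funext fun ω => Finset.sum_apply ..]
      exact Finset.measurable_sum s fun k _ => (hA k).measurable
    have h := hind'.lintegral_comp_eq hSm (hA i).measurable hmeas
    simp only [Finset.sum_apply] at h
    simp only [Finset.sum_insert hi, add_comm (A i _)]
    rw [h]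
    refine (lintegral_mono fun ω => lintegral_trace_inv_add_pow_le (hA i) ha hd hab
      (posSemidef_sum s fun k _ => (hA k).posSemidef ω) j hcond).trans ?_
    refine (ih (b + d) (by linarith)).trans_eq ?_
    rw [Finset.card_insert_of_notMem hi]
    push_cast
    congr 4
    ring

/-- If S ≥ x fails, some eigenvalue of S lies below x, and its term alone gives this much trace. -/
theorem le_trace_inv_pow {S : Matrix ι ι ℝ} (hS : S.PosSemidef) {a x : ℝ} (ha : 0 < a)
    (hx : ¬ (S - x • (1 : Matrix ι ι ℝ)).PosSemidef) (hax : 0 < a + x) (q : ℕ) :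
    ((a + x)⁻¹) ^ q ≤ ((a • (1 : Matrix ι ι ℝ) + S)⁻¹ ^ q).trace := by
  obtain ⟨s, φ, hs, rfl, -, hpos, htr, -⟩ := exists_algHom_diagonalization hS
  have hex : ∃ i, s i < x := by
    by_contra! hcon
    apply hx
    have : φ s - x • (1 : Matrix ι ι ℝ) = φ (fun i => s i - x) := by
      rw [← map_one φ, ← map_smul, ← map_sub]
      congr 1
      ext i
      simp
    rw [this]
    exact hpos _ fun i => sub_nonneg.2 (hcon i)
  obtain ⟨i, hi⟩ := hex
  have hinv : (a • (1 : Matrix ι ι ℝ) + φ s)⁻¹ = φ fun i => (a + s i)⁻¹ := by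
    apply inv_eq_left_inv
    rw [← map_one φ, ← map_smul, ← map_add, ← map_mul]
    congr 1
    ext k
    have := hs k
    simp only [Pi.mul_apply, Pi.add_apply, Pi.smul_apply, Pi.one_apply, smul_eq_mul, mul_one]
    exact inv_mul_cancel₀ (by positivity)
  rw [hinv, ← map_pow, htr]
  have hle : ((a + x)⁻¹) ^ q ≤ ((a + s i)⁻¹) ^ q := by
    have := hs i
    exact pow_le_pow_left₀ (inv_nonneg.2 hax.le) (inv_anti₀ (by positivity) (by linarith)) q
  refine hle.trans (Finset.single_le_sum (f := fun k => ((a + s k)⁻¹) ^ q)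
    (fun k _ => pow_nonneg (inv_nonneg.2 (add_nonneg ha.le (hs k))) q) (Finset.mem_univ i))

/-- Lower tail of the smallest eigenvalue of a sum of independent random positive semidefinite
matrices. -/
theorem measure_not_posSemidef_sum_sub_le {κ : Type*} [Fintype κ] {A : κ → Ω → Matrix ι ι ℝ}
    {μ B : ℝ} (hA : ∀ k, IsMomentBounded (A k) P μ B) (hind : iIndepFun A P) (hB : 0 < B)
    (hμ : 0 < μ) (j : ℕ) (hcard : 8 * (2 ^ j : ℕ) * B ≤ Fintype.card κ * μ ^ 2) :
    P {ω | ¬ (∑ k, A k ω - (Fintype.card κ * (μ / 8)) • (1 : Matrix ι ι ℝ)).PosSemidef}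
      ≤ ENNReal.ofReal (Fintype.card ι * (2⁻¹ : ℝ) ^ 2 ^ j) := by
  set m : ℝ := (Fintype.card κ : ℝ) with hm
  set q := 2 ^ j with hq
  -- Chosen so that qB/a = μ/2, which makes the shift d = μ/2 per summand admissible.
  set a : ℝ := 2 * q * B / μ with ha
  have hq0 : (0 : ℝ) < q := by simp [hq]
  have ha0 : 0 < a := by positivity
  have hacard : a ≤ m * μ / 4 := by
    rw [ha, div_le_iff₀ hμ]
    linarith
  -- Then a + x is half of the final level a + mμ/2, so Markov's inequality yields the ratio 2^(-q).
  -- The cardinality condition gives a ≤ mμ/4, whence x ≥ mμ/8.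
  set x : ℝ := (a + m * (μ / 2)) / 2 - a with hx
  have hxle : m * (μ / 8) ≤ x := by linarith
  have hax : a + x = (a + m * (μ / 2)) / 2 := by ring
  have hax0 : 0 < a + x := by rw [hax]; positivity
  have hcond : μ / 2 + q * B / a ≤ μ := by
    have : q * B / a = μ / 2 := by rw [ha]; field_simp
    linarith
  have hint := lintegral_trace_inv_sum_pow_le hA hind ha0 (by positivity : 0 ≤ μ / 2) j hcond
    Finset.univ a le_rfl
  rw [← hq, Finset.card_univ, ← hm] at hint
  set f : Ω → ENNReal := fun ω =>
    ENNReal.ofReal (((a • (1 : Matrix ι ι ℝ) + ∑ k, A k ω)⁻¹ ^ q).trace) with hf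
  have hfm : Measurable f := ((measurable_trace_inv_pow a q).comp
    (Finset.measurable_fun_sum _ fun k _ => (hA k).measurable)).ennreal_ofReal
  have hsub : {ω | ¬ (∑ k, A k ω - (m * (μ / 8)) • (1 : Matrix ι ι ℝ)).PosSemidef}
      ⊆ {ω | ENNReal.ofReal (((a + x)⁻¹) ^ q) ≤ f ω} := by
    intro ω hω
    have hSps : (∑ k, A k ω).PosSemidef := posSemidef_sum _ fun k _ => (hA k).posSemidef ω
    refine ENNReal.ofReal_le_ofReal (le_trace_inv_pow hSps ha0 (fun hcon => hω ?_) hax0 q)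
    have : ∑ k, A k ω - (m * (μ / 8)) • (1 : Matrix ι ι ℝ)
        = (∑ k, A k ω - x • (1 : Matrix ι ι ℝ)) + (x - m * (μ / 8)) • (1 : Matrix ι ι ℝ) := by
      module
    rw [this]
    exact hcon.add (PosSemidef.one.smul (sub_nonneg.2 hxle))
  have hmk := (mul_meas_ge_le_lintegral hfm (ENNReal.ofReal (((a + x)⁻¹) ^ q))).trans hint
  have hc : 0 < ((a + x)⁻¹) ^ q := by positivity
  refine (measure_mono hsub).trans ?_
  have hc' : ENNReal.ofReal (((a + x)⁻¹) ^ q) ≠ 0 := by simpa using hc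
  rw [mul_comm, ← ENNReal.le_div_iff_mul_le (Or.inl hc') (Or.inl ENNReal.ofReal_ne_top),
    ← ENNReal.ofReal_div_of_pos hc] at hmk
  refine hmk.trans_eq ?_
  congr 1
  rw [mul_div_assoc, ← div_pow]
  congr 2
  rw [hax]
  have : a + m * (μ / 2) ≠ 0 := by positivity
  rw [inv_div, inv_eq_one_div, div_div_div_cancel_right₀ this]
  exact one_div _

end Matrix

/-! ### Gradients and Hessians of convex functions. -/

section Calculus

variable {E : Type*} [NormedAddCommGroup E] [InnerProductSpace ℝ E] [CompleteSpace E]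
  {f : E → ℝ} {S : Set E} {x y : E}

theorem hasDerivAt_comp_lineMap (hx : DifferentiableAt ℝ f x) (u : E) :
    HasDerivAt (fun t : ℝ => f (x + t • u)) (inner ℝ (gradient f x) u) 0 := by
  have h1 : HasDerivAt (fun t : ℝ => x + t • u) u 0 := by
    simpa using ((hasDerivAt_id (0 : ℝ)).smul_const u).const_add x
  have h2 : HasFDerivAt f (fderiv ℝ f x) (x + (0 : ℝ) • u) := by simpa using hx.hasFDerivAt
  simpa [inner_gradient_left] using! h2.comp_hasDerivAt (0 : ℝ) h1

theorem ConvexOn.add_inner_gradient_le (hf : ConvexOn ℝ S f) (hx : x ∈ S) (hy : y ∈ S)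
    (hd : DifferentiableAt ℝ f x) : f x + inner ℝ (gradient f x) (y - x) ≤ f y := by
  have h := hasDerivAt_comp_lineMap hd (y - x)
  have hlim := h.hasDerivWithinAt (s := Set.Ioi 0)
  rw [hasDerivWithinAt_iff_tendsto_slope' (by simp)] at hlim
  have hle : ∀ᶠ t in 𝓝[>] (0 : ℝ), slope (fun t : ℝ => f (x + t • (y - x))) 0 t ≤ f y - f x := by
    filter_upwards [Ioo_mem_nhdsGT (zero_lt_one' ℝ)] with t ht
    have hc := hf.2 hx hy (sub_nonneg.2 ht.2.le) ht.1.le (by ring)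
    have e : (1 - t) • x + t • y = x + t • (y - x) := by module
    rw [e] at hc
    simp only [slope_def_field, zero_smul, add_zero, sub_zero, smul_eq_mul] at hc ⊢
    rw [div_le_iff₀ ht.1]
    linarith
  linarith [le_of_tendsto hlim hle]

theorem ContDiffAt.hasFDerivAt_gradient (hf : ContDiffAt ℝ 2 f x) :
    HasFDerivAt (gradient f) (fderiv ℝ (gradient f) x) x := by
  have h : DifferentiableAt ℝ (fderiv ℝ f) x :=
    (hf.fderiv_right (m := 1) (by norm_num)).differentiableAt one_ne_zero
  exact ((InnerProductSpace.toDual ℝ E).symm.toContinuousLinearEquiv.differentiableAt.comp x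
    h).hasFDerivAt

theorem inner_fderiv_gradient_eq (hf : ContDiffAt ℝ 2 f x) (u v : E) :
    inner ℝ (fderiv ℝ (gradient f) x u) v = fderiv ℝ (fderiv ℝ f) x u v := by
  have h : DifferentiableAt ℝ (fderiv ℝ f) x :=
    (hf.fderiv_right (m := 1) (by norm_num)).differentiableAt one_ne_zero
  have h1 : HasFDerivAt (fun y => inner ℝ (gradient f y) v)
      ((innerSL ℝ v).comp (fderiv ℝ (gradient f) x)) x := by
    have := ((innerSL ℝ v).hasFDerivAt).comp x hf.hasFDerivAt_gradient
    simpa [Function.comp_def, real_inner_comm] using! this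
  have h2 : HasFDerivAt (fun y => inner ℝ (gradient f y) v)
      ((ContinuousLinearMap.apply ℝ ℝ v).comp (fderiv ℝ (fderiv ℝ f) x)) x := by
    have := ((ContinuousLinearMap.apply ℝ ℝ v).hasFDerivAt).comp x h.hasFDerivAt
    simpa [Function.comp_def, inner_gradient_left] using! this
  have := congrArg (fun L => L u) (h1.unique h2)
  simpa [real_inner_comm] using this

theorem inner_fderiv_gradient_symm (hf : ContDiffAt ℝ 2 f x) (u v : E) :
    inner ℝ (fderiv ℝ (gradient f) x u) v = inner ℝ u (fderiv ℝ (gradient f) x v) := by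
  rw [real_inner_comm (fderiv ℝ (gradient f) x v), inner_fderiv_gradient_eq hf,
    inner_fderiv_gradient_eq hf]
  exact hf.isSymmSndFDerivAt (by simp) u v

/-- The gradient of a convex function is monotone (add the two gradient inequalities), so the right
difference quotients of t ↦ ⟨u, ∇f(x + tu)⟩ at 0 are nonnegative. -/
theorem ConvexOn.inner_fderiv_gradient_nonneg (hf : ConvexOn ℝ S f) (hx : S ∈ 𝓝 x)
    (hd : ∀ y ∈ S, DifferentiableAt ℝ f y) (hf2 : ContDiffAt ℝ 2 f x) (u : E) :
    0 ≤ inner ℝ u (fderiv ℝ (gradient f) x u) := by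
  have hxS := mem_of_mem_nhds hx
  have h1 : HasDerivAt (fun t : ℝ => x + t • u) u 0 := by
    simpa using ((hasDerivAt_id (0 : ℝ)).smul_const u).const_add x
  have h2 : HasFDerivAt (gradient f) (fderiv ℝ (gradient f) x) (x + (0 : ℝ) • u) := by
    simpa using hf2.hasFDerivAt_gradient
  have h3 := ((innerSL ℝ u).hasFDerivAt).comp_hasDerivAt (0 : ℝ) (h2.comp_hasDerivAt (0 : ℝ) h1)
  have hlim := h3.hasDerivWithinAt (s := Set.Ioi 0)
  rw [hasDerivWithinAt_iff_tendsto_slope' (by simp)] at hlim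
  refine ge_of_tendsto hlim ?_
  have hc : Tendsto (fun t : ℝ => x + t • u) (𝓝[>] 0) (𝓝 x) := by
    have : Continuous fun t : ℝ => x + t • u := by fun_prop
    simpa using (this.tendsto 0).mono_left nhdsWithin_le_nhds
  filter_upwards [hc hx, self_mem_nhdsWithin] with t ht ht0
  have ht0' : (0 : ℝ) < t := ht0
  have e1 := hf.add_inner_gradient_le hxS ht (hd x hxS)
  have e2 := hf.add_inner_gradient_le ht hxS (hd _ ht)
  simp only [slope_def_field, Function.comp_apply, innerSL_apply_apply, zero_smul, add_zero,
    sub_zero]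
  refine div_nonneg ?_ ht0'.le
  have a1 : x + t • u - x = t • u := by module
  have a2 : x - (x + t • u) = -(t • u) := by module
  rw [a1, inner_smul_right] at e1
  rw [a2, inner_neg_right, inner_smul_right] at e2
  rw [← inner_sub_right, real_inner_comm, inner_sub_left]
  have : 0 ≤ t * (inner ℝ (gradient f (x + t • u)) u - inner ℝ (gradient f x) u) := by linarith
  exact (mul_nonneg_iff_of_pos_left ht0').1 this

/-- Mean value inequality on the segment, where the Hessian moves by at most C‖y − x‖. The constant
C in place of C/2 is the price of using this one bound along the whole segment. -/
theorem norm_gradient_sub_sub_le (hS : Convex ℝ S) (hf : ∀ y ∈ S, ContDiffAt ℝ 2 f y) {C : ℝ}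
    (hC : ∀ y ∈ S, ∀ z ∈ S,
      ‖fderiv ℝ (gradient f) y - fderiv ℝ (gradient f) z‖ ≤ C * ‖y - z‖)
    (hx : x ∈ S) (hy : y ∈ S) :
    ‖gradient f y - gradient f x - fderiv ℝ (gradient f) x (y - x)‖ ≤ C * ‖y - x‖ ^ 2 := by
  rcases eq_or_ne x y with rfl | hxy
  · simp
  have hpos : 0 < ‖y - x‖ := norm_pos_iff.2 (sub_ne_zero.2 hxy.symm)
  have hC0 : 0 ≤ C := by
    have := (norm_nonneg _).trans (hC y hy x hx)
    exact (mul_nonneg_iff_of_pos_right hpos).1 this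
  have hseg := hS.segment_subset hx hy
  have h := (convex_segment x y).norm_image_sub_le_of_norm_hasFDerivWithin_le'
    (f := gradient f) (f' := fderiv ℝ (gradient f)) (φ := fderiv ℝ (gradient f) x)
    (C := C * ‖y - x‖) (fun z hz => (hf z (hseg hz)).hasFDerivAt_gradient.hasFDerivWithinAt)
    (fun z hz => (hC z (hseg hz) x hx).trans
      (mul_le_mul_of_nonneg_left (norm_sub_le_of_mem_segment hz) hC0))
    (left_mem_segment ℝ x y) (right_mem_segment ℝ x y)
  rwa [mul_assoc, ← sq] at h

end Calculus

/-! ### Moments from exponential bounds; vectors and coercive operators in coordinates. -/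

theorem integrable_and_integral_le_of_lintegral_le {α : Type*} [MeasurableSpace α] {μ : Measure α}
    {f : α → ℝ} (hf : Measurable f) (hf0 : ∀ x, 0 ≤ f x) {c : ℝ} (hc : 0 ≤ c)
    (h : ∫⁻ x, ENNReal.ofReal (f x) ∂μ ≤ ENNReal.ofReal c) :
    Integrable f μ ∧ ∫ x, f x ∂μ ≤ c := by
  refine ⟨⟨hf.aestronglyMeasurable, ?_⟩, ?_⟩
  · rw [hasFiniteIntegral_iff_ofReal (ae_of_all _ hf0)]
    exact h.trans_lt ENNReal.ofReal_lt_top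
  · rw [integral_eq_lintegral_of_nonneg_ae (ae_of_all _ hf0) hf.aestronglyMeasurable]
    exact ENNReal.toReal_le_of_le_ofReal hc h

/-- One term of the exponential series: (s|g|)^k / k! ≤ exp(s|g|). -/
theorem integrable_abs_pow_of_exp {α : Type*} [MeasurableSpace α] {μ : Measure α}
    {g : α → ℝ} (hg : Measurable g) {s : ℝ} (hs : 0 < s)
    (h : ∫⁻ x, ENNReal.ofReal (Real.exp (s * |g x|)) ∂μ ≤ 2) (k : ℕ) :
    Integrable (fun x => |g x| ^ k) μ ∧ ∫ x, |g x| ^ k ∂μ ≤ 2 * k.factorial / s ^ k := by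
  have hm : Measurable fun x => |g x| ^ k := (measurable_norm.comp hg).pow_const k
  refine integrable_and_integral_le_of_lintegral_le hm (fun x => by positivity) (by positivity) ?_
  have hle (x : α) : ENNReal.ofReal (|g x| ^ k)
      ≤ ENNReal.ofReal (k.factorial / s ^ k) * ENNReal.ofReal (Real.exp (s * |g x|)) := by
    rw [← ENNReal.ofReal_mul (by positivity)]
    refine ENNReal.ofReal_le_ofReal ?_
    have := Real.pow_div_factorial_le_exp (s * |g x|) (by positivity) k
    rw [mul_pow, div_le_iff₀ (by positivity)] at this
    rw [div_mul_eq_mul_div, le_div_iff₀ (by positivity)]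
    linarith
  refine (lintegral_mono hle).trans ?_
  rw [lintegral_const_mul' _ _ ENNReal.ofReal_ne_top]
  refine (mul_le_mul_right h _).trans_eq ?_
  rw [show (2 : ENNReal) = ENNReal.ofReal 2 by simp, ← ENNReal.ofReal_mul (by positivity)]
  congr 1
  ring

section Vec

variable {p : ℕ}

theorem Vec.sum_single (u : Vec p) : ∑ j, u j • EuclideanSpace.single j (1 : ℝ) = u := by
  ext i
  simp [Finset.sum_apply, Pi.single_apply]

theorem Vec.abs_apply_le_norm (u : Vec p) (j : Fin p) : |u j| ≤ ‖u‖ := by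
  simpa using PiLp.norm_apply_le u j

theorem Vec.norm_sq_eq_sum (u : Vec p) : ‖u‖ ^ 2 = ∑ j, u j ^ 2 := by
  simp [EuclideanSpace.norm_sq_eq]

theorem Vec.opNorm_le_sum (T : Vec p →L[ℝ] Vec p) :
    ‖T‖ ≤ ∑ j, ‖T (EuclideanSpace.single j 1)‖ := by
  refine T.opNorm_le_bound (Finset.sum_nonneg fun _ _ => norm_nonneg _) fun u => ?_
  conv_lhs => rw [← Vec.sum_single u]
  rw [map_sum, Finset.sum_mul]
  refine (norm_sum_le _ _).trans (Finset.sum_le_sum fun j _ => ?_)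
  rw [map_smul, norm_smul, mul_comm]
  exact mul_le_mul_of_nonneg_left (Vec.abs_apply_le_norm u j) (norm_nonneg _)

/-- A coercive operator of a finite-dimensional space is invertible. -/
theorem ContinuousLinearMap.exists_equiv_of_coercive {T : Vec p →L[ℝ] Vec p} {c : ℝ} (hc : 0 < c)
    (hT : ∀ u, c * ‖u‖ ^ 2 ≤ inner ℝ u (T u)) : ∃ e : Vec p ≃L[ℝ] Vec p, (e : Vec p →L[ℝ] Vec p) = T := by
  have hinj : Function.Injective T.toLinearMap := by
    rw [injective_iff_map_eq_zero]
    intro u hu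
    have h := hT u
    have h0 : T u = 0 := hu
    rw [h0, inner_zero_right] at h
    have : ‖u‖ ^ 2 ≤ 0 := by
      by_contra hcon
      exact absurd h (not_le.2 (mul_pos hc (not_le.1 hcon)))
    simpa using le_antisymm this (sq_nonneg _)
  refine ⟨(LinearEquiv.ofInjectiveEndo T.toLinearMap hinj).toContinuousLinearEquiv, ?_⟩
  ext u
  simp

/-- `inverse` defaults to 0 on singular operators. Coercivity excludes that case and bounds the true
inverse through c‖x‖² ≤ ⟨x, Tx⟩ ≤ ‖x‖‖Tx‖. -/
theorem ContinuousLinearMap.inverse_of_coercive {T : Vec p →L[ℝ] Vec p} {c : ℝ} (hc : 0 < c)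
    (hT : ∀ u, c * ‖u‖ ^ 2 ≤ inner ℝ u (T u)) :
    (∀ y, T (T.inverse y) = y) ∧ (∀ y, T.inverse (T y) = y) ∧ ∀ y, ‖T.inverse y‖ ≤ c⁻¹ * ‖y‖ := by
  obtain ⟨e, rfl⟩ := ContinuousLinearMap.exists_equiv_of_coercive hc hT
  rw [ContinuousLinearMap.inverse_equiv]
  refine ⟨by simp, by simp, fun y => ?_⟩
  have h := (hT (e.symm y)).trans (real_inner_le_norm _ _)
  simp only [ContinuousLinearEquiv.coe_coe, ContinuousLinearEquiv.apply_symm_apply] at h ⊢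
  rw [inv_mul_eq_div, le_div_iff₀ hc]
  rcases (norm_nonneg (e.symm y)).eq_or_lt with h0 | h0
  · rw [← h0]; simp
  · refine le_of_mul_le_mul_left ?_ h0
    linarith

end Vec

/-! ### Population quantities: moments of the Hessian, Σ⁻¹, and the first-order condition. -/

namespace ContinualModel

variable {p : ℕ} {𝒵 : Type*} [MeasurableSpace 𝒵] {M : ContinualModel p 𝒵}

instance : IsProbabilityMeasure M.taskLaw := M.isProb_taskLaw

instance : IsMarkovKernel M.obsLaw := M.isMarkov_obsLaw

instance : IsProbabilityMeasure M.marginal := by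
  unfold marginal
  infer_instance

theorem integral_marginal {E : Type*} [NormedAddCommGroup E] [NormedSpace ℝ E] {f : 𝒵 → E}
    (hf : Integrable f M.marginal) :
    ∫ z, f z ∂M.marginal = ∫ δ, ∫ z, f z ∂M.obsLaw δ ∂M.taskLaw := by
  unfold marginal at hf ⊢
  rw [Measure.comp_eq_comp_const_apply] at hf ⊢
  rw [Kernel.integral_comp hf]
  simp

theorem integrable_integral_obsLaw {E : Type*} [NormedAddCommGroup E] [NormedSpace ℝ E] {f : 𝒵 → E}
    (hf : Integrable f M.marginal) :
    Integrable (fun δ => ∫ z, f z ∂M.obsLaw δ) M.taskLaw := by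
  unfold marginal at hf
  rw [Measure.comp_eq_comp_const_apply] at hf
  simpa using hf.integral_comp

theorem ae_integrable_obsLaw {E : Type*} [NormedAddCommGroup E] {f : 𝒵 → E}
    (hf : Integrable f M.marginal) : ∀ᵐ δ ∂M.taskLaw, Integrable f (M.obsLaw δ) :=
  Measure.ae_integrable_of_integrable_comp hf

/-- The assumptions on the population model. -/
structure Assumptions (M : ContinualModel p 𝒵) (ρ lam C₁ s : ℝ) : Prop where
  ρ_pos : 0 < ρ
  lam_pos : 0 < lam
  C₁_pos : 0 < C₁
  s_pos : 0 < s
  isRegular : M.IsRegular ρ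
  convexLoss : M.ConvexLoss
  boundedEigenvalues : M.BoundedEigenvalues lam
  lipschitzHess : M.LipschitzHess C₁
  subExpGrad : M.SubExpGrad s

namespace Assumptions

variable {ρ lam C₁ s : ℝ} (h : M.Assumptions ρ lam C₁ s)

include h

theorem θstar_mem : M.θstar ∈ M.Θ :=
  h.isRegular.closedBall_subset (Metric.mem_closedBall_self h.ρ_pos.le)

theorem Θ_mem_nhds : M.Θ ∈ 𝓝 M.θstar :=
  mem_of_superset (Metric.closedBall_mem_nhds _ h.ρ_pos) h.isRegular.closedBall_subset

theorem measurable_grad (θ : Vec p) : Measurable fun z => M.grad z θ :=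
  h.isRegular.measurable_grad.comp (measurable_id.prodMk measurable_const)

theorem measurable_hess (θ : Vec p) : Measurable fun z => M.hess z θ :=
  h.isRegular.measurable_hess.comp (measurable_id.prodMk measurable_const)

theorem measurable_grad_apply (θ : Vec p) (j : Fin p) : Measurable fun z => M.grad z θ j :=
  (EuclideanSpace.proj (𝕜 := ℝ) j).continuous.measurable.comp (h.measurable_grad θ)

theorem measurable_hess_apply (θ u : Vec p) : Measurable fun z => M.hess z θ u :=
  (ContinuousLinearMap.apply ℝ (Vec p) u).continuous.measurable.comp (h.measurable_hess θ)

theorem contDiffAt {θ : Vec p} (hθ : θ ∈ M.Θ) (z : 𝒵) : ContDiffAt ℝ 2 (M.loss z) θ :=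
  h.isRegular.contDiffAt_loss z θ hθ

theorem differentiableAt {θ : Vec p} (hθ : θ ∈ M.Θ) (z : 𝒵) : DifferentiableAt ℝ (M.loss z) θ :=
  (h.contDiffAt hθ z).differentiableAt (by norm_num)

theorem loss_add_inner_grad_le (z : 𝒵) {θ θ' : Vec p} (hθ : θ ∈ M.Θ) (hθ' : θ' ∈ M.Θ) :
    M.loss z θ + inner ℝ (M.grad z θ) (θ' - θ) ≤ M.loss z θ' :=
  (h.convexLoss z).add_inner_gradient_le hθ hθ' (h.differentiableAt hθ z)

theorem hess_symm (z : 𝒵) {θ : Vec p} (hθ : θ ∈ M.Θ) (u v : Vec p) :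
    inner ℝ (M.hess z θ u) v = inner ℝ u (M.hess z θ v) :=
  inner_fderiv_gradient_symm (h.contDiffAt hθ z) u v

theorem hess_nonneg (z : 𝒵) (u : Vec p) : 0 ≤ inner ℝ u (M.hess z M.θstar u) :=
  (h.convexLoss z).inner_fderiv_gradient_nonneg h.Θ_mem_nhds
    (fun _ hy => h.differentiableAt hy z) (h.contDiffAt h.θstar_mem z) u

theorem exists_lipschitz : ∃ C : 𝒵 → ℝ, Measurable C ∧ (∀ z, 0 ≤ C z) ∧
    (∀ z, ∀ θ ∈ M.Θ, ∀ θ' ∈ M.Θ, ‖M.hess z θ - M.hess z θ'‖ ≤ C z * ‖θ - θ'‖) ∧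
    Integrable (fun z => C z ^ 2) M.marginal ∧ ∫ z, C z ^ 2 ∂M.marginal ≤ C₁ ^ 2 := by
  obtain ⟨C, hCm, hC, hC2⟩ := h.lipschitzHess
  have hm : Measurable fun z => |C z| := measurable_norm.comp hCm
  refine ⟨fun z => |C z|, hm, fun z => abs_nonneg _, fun z θ hθ θ' hθ' => ?_, ?_⟩
  · exact (hC z θ hθ θ' hθ').trans (mul_le_mul_of_nonneg_right (le_abs_self _) (norm_nonneg _))
  · exact integrable_and_integral_le_of_lintegral_le (hm.pow_const 2) (fun z => sq_nonneg _)
      (sq_nonneg _) (by simpa using hC2)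

theorem grad_taylor {C : 𝒵 → ℝ} (hC : ∀ z, ∀ θ ∈ M.Θ, ∀ θ' ∈ M.Θ,
    ‖M.hess z θ - M.hess z θ'‖ ≤ C z * ‖θ - θ'‖) (z : 𝒵) {θ θ' : Vec p} (hθ : θ ∈ M.Θ)
    (hθ' : θ' ∈ M.Θ) :
    ‖M.grad z θ' - M.grad z θ - M.hess z θ (θ' - θ)‖ ≤ C z * ‖θ' - θ‖ ^ 2 :=
  norm_gradient_sub_sub_le (h.convexLoss z).1 (fun _ hy => h.contDiffAt hy z) (hC z) hθ hθ'

theorem integrable_grad_apply_pow {θ : Vec p} (hθ : θ ∈ M.Θ) (j : Fin p) (k : ℕ) :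
    Integrable (fun z => |M.grad z θ j| ^ k) M.marginal ∧
      ∫ z, |M.grad z θ j| ^ k ∂M.marginal ≤ 2 * k.factorial / s ^ k :=
  integrable_abs_pow_of_exp (h.measurable_grad_apply θ j) h.s_pos (h.subExpGrad θ hθ j) k

theorem integrable_grad_apply_sq {θ : Vec p} (hθ : θ ∈ M.Θ) (j : Fin p) :
    Integrable (fun z => M.grad z θ j ^ 2) M.marginal ∧
      ∫ z, M.grad z θ j ^ 2 ∂M.marginal ≤ 4 / s ^ 2 := by
  have := h.integrable_grad_apply_pow hθ j 2
  simp only [sq_abs, Nat.factorial_two] at this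
  norm_num at this ⊢
  exact this

theorem integrable_norm_grad_sq {θ : Vec p} (hθ : θ ∈ M.Θ) :
    Integrable (fun z => ‖M.grad z θ‖ ^ 2) M.marginal ∧
      ∫ z, ‖M.grad z θ‖ ^ 2 ∂M.marginal ≤ p * (4 / s ^ 2) := by
  simp only [Vec.norm_sq_eq_sum]
  refine ⟨integrable_finsetSum _ fun j _ => (h.integrable_grad_apply_sq hθ j).1, ?_⟩
  rw [integral_finsetSum _ fun j _ => (h.integrable_grad_apply_sq hθ j).1]
  refine (Finset.sum_le_sum fun j _ => (h.integrable_grad_apply_sq hθ j).2).trans_eq ?_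
  simp

theorem integrable_grad {θ : Vec p} (hθ : θ ∈ M.Θ) :
    Integrable (fun z => M.grad z θ) M.marginal := by
  refine ((integrable_const 1).add (h.integrable_norm_grad_sq hθ).1).mono'
    (h.measurable_grad θ).aestronglyMeasurable (ae_of_all _ fun z => ?_)
  simp only [Pi.add_apply]
  nlinarith [sq_nonneg (‖M.grad z θ‖ - 1)]

/-- Up to a Taylor error C(z)ρ², the number ρ(l̈(θ*)u)_j is the difference of the j-th partial
derivatives at θ* + ρu and θ*. Thus a dense direction u costs no more than a coordinate direction,
whereas summing entrywise bounds would cost a factor p. -/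
theorem hess_apply_sq_le {C : 𝒵 → ℝ} (hC : ∀ z, ∀ θ ∈ M.Θ, ∀ θ' ∈ M.Θ,
    ‖M.hess z θ - M.hess z θ'‖ ≤ C z * ‖θ - θ'‖) (z : 𝒵) {u : Vec p} (hu : ‖u‖ = 1) (j : Fin p) :
    M.hess z M.θstar u j ^ 2 ≤ 3 / ρ ^ 2 * (M.grad z (M.θstar + ρ • u) j ^ 2
      + M.grad z M.θstar j ^ 2 + C z ^ 2 * ρ ^ 4) := by
  have hρ := h.ρ_pos
  have hmem : M.θstar + ρ • u ∈ M.Θ := h.isRegular.closedBall_subset (by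
    simp [norm_smul, hu, abs_of_pos hρ])
  have ht := h.grad_taylor hC z h.θstar_mem hmem
  set a := M.grad z (M.θstar + ρ • u) j with ha
  set b := M.grad z M.θstar j with hb
  set x := M.hess z M.θstar u j with hx
  have h1 : |a - b - ρ * x| ≤ C z * ρ ^ 2 := by
    have h2 := (Vec.abs_apply_le_norm _ j).trans ht
    simpa [norm_smul, hu, abs_of_pos hρ] using h2
  rw [div_mul_eq_mul_div, le_div_iff₀ (by positivity)]
  have h3 : (a - b - ρ * x) ^ 2 ≤ (C z * ρ ^ 2) ^ 2 := sq_le_sq' (abs_le.1 h1).1 (abs_le.1 h1).2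
  nlinarith [sq_nonneg (a + b), sq_nonneg (a + (a - b - ρ * x)), sq_nonneg (b - (a - b - ρ * x))]

end Assumptions

/-- The constant in the second moment bound for the Hessian at the target. -/
def hessBound (ρ C₁ s : ℝ) : ℝ := 3 / ρ ^ 2 * (8 / s ^ 2 + C₁ ^ 2 * ρ ^ 4)

namespace Assumptions

variable {ρ lam C₁ s : ℝ} (h : M.Assumptions ρ lam C₁ s)

include h

theorem hessBound_pos : 0 < hessBound ρ C₁ s := by
  have := h.ρ_pos
  have := h.s_pos
  have := h.C₁_pos
  unfold hessBound
  positivity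

/-- The second moment of `(l̈(X, Y, θ*) u)_j` is bounded, uniformly in the dimension. -/
theorem integrable_hess_apply_sq (u : Vec p) (j : Fin p) :
    Integrable (fun z => M.hess z M.θstar u j ^ 2) M.marginal ∧
      ∫ z, M.hess z M.θstar u j ^ 2 ∂M.marginal ≤ hessBound ρ C₁ s * ‖u‖ ^ 2 := by
  have hρ := h.ρ_pos
  have hm (u : Vec p) : Measurable fun z => M.hess z M.θstar u j :=
    (EuclideanSpace.proj (𝕜 := ℝ) j).continuous.measurable.comp (h.measurable_hess_apply _ u)
  -- The comparison moves by exactly ρ, the radius of the ball inside Θ. Other lengths of u follow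
  -- by homogeneity.
  have hunit (u : Vec p) (hu : ‖u‖ = 1) :
      Integrable (fun z => M.hess z M.θstar u j ^ 2) M.marginal ∧
      ∫ z, M.hess z M.θstar u j ^ 2 ∂M.marginal ≤ hessBound ρ C₁ s := by
    obtain ⟨C, hCm, hC0, hC, hCi, hC2⟩ := h.exists_lipschitz
    have hmem : M.θstar + ρ • u ∈ M.Θ := h.isRegular.closedBall_subset (by
      simp [norm_smul, hu, abs_of_pos hρ])
    obtain ⟨i1, l1⟩ := h.integrable_grad_apply_sq hmem j
    obtain ⟨i2, l2⟩ := h.integrable_grad_apply_sq h.θstar_mem j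
    have i3 := ((i1.add i2).add (hCi.mul_const (ρ ^ 4))).const_mul (3 / ρ ^ 2)
    have hle := h.hess_apply_sq_le hC
    have i4 : Integrable (fun z => M.hess z M.θstar u j ^ 2) M.marginal :=
      i3.mono' ((hm u).pow_const 2).aestronglyMeasurable (ae_of_all _ fun z => by
        rw [Real.norm_of_nonneg (sq_nonneg _)]
        exact hle z hu j)
    refine ⟨i4, (integral_mono i4 i3 fun z => hle z hu j).trans ?_⟩
    rw [integral_const_mul]
    have e1 := integral_add (i1.add i2) (hCi.mul_const (ρ ^ 4))
    have e2 := integral_add i1 i2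
    simp only [Pi.add_apply, integral_mul_const] at e1 e2 ⊢
    rw [e1, e2]
    unfold hessBound
    refine mul_le_mul_of_nonneg_left ?_ (by positivity)
    have := mul_le_mul_of_nonneg_right hC2 (by positivity : 0 ≤ ρ ^ 4)
    have e3 : 8 / s ^ 2 = 4 / s ^ 2 + 4 / s ^ 2 := by ring
    linarith
  rcases eq_or_ne u 0 with rfl | hu
  · simp
  · have hn : ‖u‖ ≠ 0 := norm_ne_zero_iff.2 hu
    obtain ⟨i1, l1⟩ := hunit (‖u‖⁻¹ • u) (by simp [norm_smul, inv_mul_cancel₀ hn])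
    have e (z : 𝒵) : M.hess z M.θstar u j ^ 2
        = ‖u‖ ^ 2 * M.hess z M.θstar (‖u‖⁻¹ • u) j ^ 2 := by
      rw [map_smul]
      simp only [PiLp.smul_apply, smul_eq_mul]
      field_simp
    simp only [e, integral_const_mul]
    refine ⟨i1.const_mul _, ?_⟩
    rw [mul_comm]
    exact mul_le_mul_of_nonneg_right l1 (sq_nonneg _)

theorem integrable_norm_hess_sq (u : Vec p) :
    Integrable (fun z => ‖M.hess z M.θstar u‖ ^ 2) M.marginal ∧
      ∫ z, ‖M.hess z M.θstar u‖ ^ 2 ∂M.marginal ≤ p * hessBound ρ C₁ s * ‖u‖ ^ 2 := by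
  simp only [Vec.norm_sq_eq_sum (M.hess _ _ _)]
  refine ⟨integrable_finsetSum _ fun j _ => (h.integrable_hess_apply_sq u j).1, ?_⟩
  rw [integral_finsetSum _ fun j _ => (h.integrable_hess_apply_sq u j).1]
  refine (Finset.sum_le_sum fun j _ => (h.integrable_hess_apply_sq u j).2).trans_eq ?_
  simp [mul_assoc]

theorem integrable_hess : Integrable (fun z => M.hess z M.θstar) M.marginal := by
  have hi : Integrable (fun z => ∑ j : Fin p, (1 + ‖M.hess z M.θstar (EuclideanSpace.single j 1)‖ ^ 2))
      M.marginal :=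
    integrable_finsetSum _ fun j _ => (integrable_const 1).add (h.integrable_norm_hess_sq _).1
  refine hi.mono' (h.measurable_hess _).aestronglyMeasurable (ae_of_all _ fun z => ?_)
  refine (Vec.opNorm_le_sum _).trans (Finset.sum_le_sum fun j _ => ?_)
  nlinarith [sq_nonneg (‖M.hess z M.θstar (EuclideanSpace.single j 1)‖ - 1)]

theorem Sig_apply (u : Vec p) : M.Sig u = ∫ z, M.hess z M.θstar u ∂M.marginal :=
  ContinuousLinearMap.integral_apply h.integrable_hess u

theorem integrable_hess_apply (u : Vec p) : Integrable (fun z => M.hess z M.θstar u) M.marginal :=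
  h.integrable_hess.apply_continuousLinearMap u

theorem inner_Sig (u v : Vec p) :
    inner ℝ u (M.Sig v) = ∫ z, inner ℝ u (M.hess z M.θstar v) ∂M.marginal := by
  rw [h.Sig_apply, ← integral_inner (h.integrable_hess_apply v)]

theorem Sig_symm (u v : Vec p) : inner ℝ (M.Sig u) v = inner ℝ u (M.Sig v) := by
  rw [real_inner_comm, h.inner_Sig, h.inner_Sig]
  refine integral_congr_ae (ae_of_all _ fun z => ?_)
  simp only
  rw [← h.hess_symm z h.θstar_mem, real_inner_comm]

theorem Sig_coercive (u : Vec p) : lam⁻¹ * ‖u‖ ^ 2 ≤ inner ℝ u (M.Sig u) :=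
  (h.boundedEigenvalues _ h.θstar_mem u).1

theorem Sig_inverse : (∀ y, M.Sig (M.Sig.inverse y) = y) ∧ (∀ y, M.Sig.inverse (M.Sig y) = y) ∧
    ∀ y, ‖M.Sig.inverse y‖ ≤ lam * ‖y‖ := by
  simpa using ContinuousLinearMap.inverse_of_coercive (inv_pos.2 h.lam_pos) h.Sig_coercive

theorem Sig_inverse_symm (u v : Vec p) :
    inner ℝ (M.Sig.inverse u) v = inner ℝ u (M.Sig.inverse v) := by
  conv_lhs => rw [← h.Sig_inverse.1 v]
  rw [← h.Sig_symm, h.Sig_inverse.1]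

/-- The first-order condition at the target. -/
theorem integral_grad_eq_zero : ∫ z, M.grad z M.θstar ∂M.marginal = 0 := by
  set g := ∫ z, M.grad z M.θstar ∂M.marginal with hg
  obtain ⟨C, hCm, hC0, hC, hCi, hC2⟩ := h.exists_lipschitz
  have hCi1 : Integrable C M.marginal := by
    refine ((integrable_const 1).add hCi).mono' hCm.aestronglyMeasurable (ae_of_all _ fun z => ?_)
    rw [Real.norm_of_nonneg (hC0 z)]
    simp only [Pi.add_apply]
    nlinarith [sq_nonneg (C z - 1)]
  set B := ∫ z, C z ∂M.marginal with hB
  -- Minimality of θ* is used through an integrated pointwise bound, so the global loss is never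
  -- differentiated under the integral sign.
  have key (u : Vec p) (hu : ‖u‖ ≤ ρ) :
      0 ≤ inner ℝ g u + inner ℝ u (M.Sig u) + B * ‖u‖ ^ 3 := by
    have hmem : M.θstar + u ∈ M.Θ := h.isRegular.closedBall_subset (by simpa using hu)
    have i0 := h.isRegular.integrable_loss _ h.θstar_mem
    have i1 := h.isRegular.integrable_loss _ hmem
    have hmin : M.globalLoss M.θstar ≤ M.globalLoss (M.θstar + u) := h.isRegular.isMinOn_θstar hmem
    unfold globalLoss at hmin
    rw [← integral_marginal i0, ← integral_marginal i1] at hmin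
    have j1 : Integrable (fun z => inner ℝ u (M.grad z M.θstar)) M.marginal :=
      (h.integrable_grad h.θstar_mem).const_inner u
    have j2 : Integrable (fun z => inner ℝ u (M.hess z M.θstar u)) M.marginal :=
      (h.integrable_hess_apply u).const_inner u
    have hle (z : 𝒵) : M.loss z (M.θstar + u) - M.loss z M.θstar ≤ inner ℝ u (M.grad z M.θstar)
        + inner ℝ u (M.hess z M.θstar u) + C z * ‖u‖ ^ 3 := by
      have h1 := h.loss_add_inner_grad_le z hmem h.θstar_mem
      have h2 := h.grad_taylor hC z h.θstar_mem hmem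
      rw [add_sub_cancel_left] at h2
      have h3 : M.θstar - (M.θstar + u) = -u := by module
      rw [h3, inner_neg_right, real_inner_comm] at h1
      have h4 := (real_inner_le_norm u _).trans (mul_le_mul_of_nonneg_left h2 (norm_nonneg u))
      rw [inner_sub_right, inner_sub_right] at h4
      nlinarith
    have h5 := integral_mono (i1.sub i0) ((j1.add j2).add (hCi1.mul_const _)) hle
    have e1 := integral_add (j1.add j2) (hCi1.mul_const (‖u‖ ^ 3))
    have e2 := integral_add j1 j2
    have e3 := integral_sub i1 i0
    simp only [Pi.add_apply, Pi.sub_apply, integral_mul_const] at h5 e1 e2 e3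
    rw [e1, e2, e3, integral_inner (h.integrable_grad h.θstar_mem), ← h.inner_Sig, ← hg, ← hB,
      real_inner_comm] at h5
    linarith
  by_contra hne
  have hgpos : 0 < ‖g‖ := norm_pos_iff.2 hne
  have hlim : Tendsto (fun t : ℝ => t * inner ℝ g (M.Sig g) + B * (t ^ 2 * ‖g‖ ^ 3)) (𝓝[>] 0)
      (𝓝 0) := by
    have : Continuous fun t : ℝ => t * inner ℝ g (M.Sig g) + B * (t ^ 2 * ‖g‖ ^ 3) := by fun_prop
    simpa using (this.tendsto 0).mono_left nhdsWithin_le_nhds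
  -- Take u = −tg and divide by t. As t → 0 the right side vanishes, which contradicts g ≠ 0.
  have hev : ∀ᶠ t in 𝓝[>] (0 : ℝ), ‖g‖ ^ 2 ≤ t * inner ℝ g (M.Sig g) + B * (t ^ 2 * ‖g‖ ^ 3) := by
    filter_upwards [Ioo_mem_nhdsGT (div_pos h.ρ_pos hgpos)] with t ht
    have hn : ‖-(t • g)‖ = t * ‖g‖ := by rw [norm_neg, norm_smul, Real.norm_of_nonneg ht.1.le]
    have h1 := key (-(t • g)) (by rw [hn]; exact ((lt_div_iff₀ hgpos).1 ht.2).le)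
    rw [hn, inner_neg_right, inner_smul_right, real_inner_self_eq_norm_sq, map_neg, inner_neg_neg,
      map_smul, inner_smul_left, inner_smul_right] at h1
    simp only [conj_trivial] at h1
    have h2 : 0 ≤ t * (-(‖g‖ ^ 2) + (t * inner ℝ g (M.Sig g) + B * (t ^ 2 * ‖g‖ ^ 3))) := by
      refine h1.trans_eq ?_
      ring
    have := (mul_nonneg_iff_of_pos_left ht.1).1 h2
    linarith
  have := ge_of_tendsto hlim hev
  nlinarith

end Assumptions

end ContinualModel

/-! ### Averages over independent streams and their mean squares. -/

/-- The mean square of the deviation of an average of independent random variables. -/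
theorem integral_sq_average_sub_le {Ω κ : Type*} [MeasurableSpace Ω] {P : Measure Ω}
    [IsProbabilityMeasure P] [Fintype κ] [Nonempty κ] {X : κ → Ω → ℝ} {μ : ℝ} {V : κ → ℝ}
    (hm : ∀ k, Measurable (X k)) (hi : ∀ k, Integrable (fun ω => X k ω ^ 2) P)
    (hind : iIndepFun X P) (hmean : ∀ k, ∫ ω, X k ω ∂P = μ)
    (hV : ∀ k, ∫ ω, X k ω ^ 2 ∂P ≤ V k) :
    Integrable (fun ω => ((Fintype.card κ : ℝ)⁻¹ * ∑ k, X k ω - μ) ^ 2) P ∧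
    ∫ ω, ((Fintype.card κ : ℝ)⁻¹ * ∑ k, X k ω - μ) ^ 2 ∂P
      ≤ ((Fintype.card κ : ℝ) ^ 2)⁻¹ * ∑ k, V k := by
  have hL (k : κ) : MemLp (X k) 2 P :=
    (memLp_two_iff_integrable_sq (hm k).aestronglyMeasurable).2 (hi k)
  have hS : MemLp (fun ω => (Fintype.card κ : ℝ)⁻¹ * ∑ k, X k ω) 2 P :=
    (memLp_finsetSum _ fun k _ => hL k).const_mul _
  have hc : (Fintype.card κ : ℝ) ≠ 0 := by simp
  have hES : ∫ ω, (Fintype.card κ : ℝ)⁻¹ * ∑ k, X k ω ∂P = μ := by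
    rw [integral_const_mul, integral_finsetSum _ fun k _ => (hL k).integrable one_le_two]
    simp [hmean]
  have hvar := variance_eq_integral hS.1.aemeasurable
  rw [hES] at hvar
  refine ⟨(memLp_two_iff_integrable_sq (hS.1.sub aestronglyMeasurable_const)).1 (hS.sub (memLp_const μ)), ?_⟩
  rw [← hvar, variance_const_mul, inv_pow]
  refine mul_le_mul_of_nonneg_left ?_ (by positivity)
  have hsum : Var[∑ k, X k; P] = ∑ k, Var[X k; P] :=
    IndepFun.variance_sum (fun k _ => hL k) fun i _ j _ hij => hind.indepFun hij
  have e : (fun ω => ∑ k, X k ω) = ∑ k, X k := funext fun ω => (Finset.sum_apply ..).symm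
  rw [e, hsum]
  exact Finset.sum_le_sum fun k _ =>
    (variance_le_expectation_sq (hm k).aestronglyMeasurable).trans (hV k)

section SampleAverage

variable {𝒵 Ω E F : Type*} [NormedAddCommGroup E] [NormedSpace ℝ E]
  [NormedAddCommGroup F] [NormedSpace ℝ F]

/-- The average over a stream, `n_k⁻¹ ∑_{i < n_k} a(Z_(k,i))`. -/
def streamAvg (n : ℕ → ℕ) (obs : ℕ → ℕ → Ω → 𝒵) (a : 𝒵 → E) (k : ℕ) (ω : Ω) : E :=
  (n k : ℝ)⁻¹ • ∑ i ∈ Finset.range (n k), a (obs k i ω)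

/-- The average of the stream averages over the first `m` streams. -/
def sampleAvg (n : ℕ → ℕ) (obs : ℕ → ℕ → Ω → 𝒵) (a : 𝒵 → E) (m : ℕ) (ω : Ω) : E :=
  (m : ℝ)⁻¹ • ∑ k ∈ Finset.range m, streamAvg n obs a k ω

variable {n : ℕ → ℕ} {obs : ℕ → ℕ → Ω → 𝒵} {m : ℕ} {ω : Ω}

theorem streamAvg_map (L : E →L[ℝ] F) (a : 𝒵 → E) (k : ℕ) :
    L (streamAvg n obs a k ω) = streamAvg n obs (fun z => L (a z)) k ω := by
  simp [streamAvg, map_sum]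

theorem sampleAvg_map (L : E →L[ℝ] F) (a : 𝒵 → E) :
    L (sampleAvg n obs a m ω) = sampleAvg n obs (fun z => L (a z)) m ω := by
  simp [sampleAvg, streamAvg_map, map_sum]

theorem sampleAvg_sub (a b : 𝒵 → E) :
    sampleAvg n obs a m ω - sampleAvg n obs b m ω = sampleAvg n obs (fun z => a z - b z) m ω := by
  simp [sampleAvg, streamAvg, ← smul_sub, ← Finset.sum_sub_distrib]

theorem sampleAvg_add (a b : 𝒵 → E) :
    sampleAvg n obs a m ω + sampleAvg n obs b m ω = sampleAvg n obs (fun z => a z + b z) m ω := by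
  simp [sampleAvg, streamAvg, ← smul_add, ← Finset.sum_add_distrib]

theorem streamAvg_mono {a b : 𝒵 → ℝ} (hab : ∀ z, a z ≤ b z) (k : ℕ) :
    streamAvg n obs a k ω ≤ streamAvg n obs b k ω :=
  mul_le_mul_of_nonneg_left (Finset.sum_le_sum fun i _ => hab _) (by positivity)

theorem sampleAvg_mono {a b : 𝒵 → ℝ} (hab : ∀ z, a z ≤ b z) :
    sampleAvg n obs a m ω ≤ sampleAvg n obs b m ω :=
  mul_le_mul_of_nonneg_left (Finset.sum_le_sum fun k _ => streamAvg_mono hab k) (by positivity)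

theorem norm_streamAvg_le (a : 𝒵 → E) (k : ℕ) :
    ‖streamAvg n obs a k ω‖ ≤ streamAvg n obs (fun z => ‖a z‖) k ω := by
  simp only [streamAvg, norm_smul, norm_inv, RCLike.norm_natCast, smul_eq_mul]
  exact mul_le_mul_of_nonneg_left (norm_sum_le _ _) (by positivity)

theorem norm_sampleAvg_le (a : 𝒵 → E) :
    ‖sampleAvg n obs a m ω‖ ≤ sampleAvg n obs (fun z => ‖a z‖) m ω := by
  simp only [sampleAvg, norm_smul, norm_inv, RCLike.norm_natCast, smul_eq_mul]
  exact mul_le_mul_of_nonneg_left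
    ((norm_sum_le _ _).trans (Finset.sum_le_sum fun k _ => norm_streamAvg_le a k)) (by positivity)

theorem sampleAvg_mul_const (a : 𝒵 → ℝ) (c : ℝ) :
    sampleAvg n obs (fun z => a z * c) m ω = sampleAvg n obs a m ω * c := by
  simp [sampleAvg, streamAvg, ← Finset.sum_mul, ← mul_assoc]

theorem streamAvg_sq_le (a : 𝒵 → ℝ) (k : ℕ) :
    streamAvg n obs a k ω ^ 2 ≤ streamAvg n obs (fun z => a z ^ 2) k ω := by
  rcases (n k).eq_zero_or_pos with h0 | h0
  · simp [streamAvg, h0]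
  have h0' : (0 : ℝ) < n k := by exact_mod_cast h0
  have h := sq_sum_le_card_mul_sum_sq (s := Finset.range (n k)) (f := fun i => a (obs k i ω))
  rw [Finset.card_range] at h
  simp only [streamAvg, smul_eq_mul, mul_pow]
  refine (mul_le_mul_of_nonneg_left h (by positivity)).trans_eq ?_
  field_simp

end SampleAverage

namespace ContinualModel.IsSample

variable {p : ℕ} {𝒵 : Type*} [MeasurableSpace 𝒵] {M : ContinualModel p 𝒵}
  {Ω : Type*} [MeasurableSpace Ω] {P : Measure Ω} [IsProbabilityMeasure P] {K : ℕ} {n : ℕ → ℕ}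
  {task : ℕ → Ω → Vec p} {obs : ℕ → ℕ → Ω → 𝒵}
  (hd : M.IsSample P K n task obs)

include hd

omit [IsProbabilityMeasure P] in
theorem measurable_disc {k : ℕ} (hk : k < K) : Measurable fun ω => task k ω - M.θstar :=
  (hd.measurable_task k hk).sub_const _

omit [IsProbabilityMeasure P] in
theorem map_disc {k : ℕ} (hk : k < K) : P.map (fun ω => task k ω - M.θstar) = M.taskLaw := by
  ext B hB
  rw [Measure.map_apply (hd.measurable_disc hk) hB]
  have h := hd.law k hk B hB (fun _ => Set.univ) fun _ => MeasurableSet.univ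
  simpa using! h

omit [IsProbabilityMeasure P] in
theorem map_obs {k i : ℕ} (hk : k < K) (hi : i < n k) : P.map (obs k i) = M.marginal := by
  classical
  ext S hS
  rw [Measure.map_apply (hd.measurable_obs k hk i hi) hS]
  have h := hd.law k hk Set.univ MeasurableSet.univ
    (fun j => if j = ⟨i, hi⟩ then S else Set.univ) fun j => by
      split_ifs
      exacts [hS, MeasurableSet.univ]
  have e1 : {ω | task k ω - M.θstar ∈ Set.univ ∧
      ∀ j : Fin (n k), obs k j ω ∈ if j = ⟨i, hi⟩ then S else Set.univ} = obs k i ⁻¹' S := by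
    ext ω
    simp only [Set.mem_univ, true_and, Set.mem_ofPred_eq, Set.mem_preimage]
    refine ⟨fun h => by simpa using h ⟨i, hi⟩, fun h j => ?_⟩
    split_ifs with hj
    · subst hj; exact h
    · trivial
  have e2 (δ : Vec p) : ∏ j : Fin (n k), M.obsLaw δ (if j = ⟨i, hi⟩ then S else Set.univ)
      = M.obsLaw δ S := by
    rw [Finset.prod_eq_single ⟨i, hi⟩ (fun j _ hj => by simp [hj]) (by simp)]
    simp
  rw [e1] at h
  simp only [e2, Measure.restrict_univ] at h
  rw [h, marginal, Measure.bind_apply hS M.obsLaw.measurable.aemeasurable]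

omit [IsProbabilityMeasure P] in
theorem measurable_streamAvg {E : Type*} [NormedAddCommGroup E] [NormedSpace ℝ E]
    [MeasurableSpace E] [BorelSpace E] [SecondCountableTopology E] {a : 𝒵 → E} (ha : Measurable a)
    {k : ℕ} (hk : k < K) : Measurable (streamAvg n obs a k) := by
  unfold streamAvg
  exact (Finset.measurable_fun_sum _ fun i hi =>
    ha.comp (hd.measurable_obs k hk i (Finset.mem_range.1 hi))).const_smul _

omit [IsProbabilityMeasure P] in
theorem iIndepFun_streamAvg {E : Type*} [NormedAddCommGroup E] [NormedSpace ℝ E]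
    [MeasurableSpace E] [BorelSpace E] [SecondCountableTopology E] {a : 𝒵 → E} (ha : Measurable a)
    {m : ℕ} (hm : m ≤ K) : iIndepFun (fun k : Fin m => streamAvg n obs a k) P := by
  have h := hd.indep.comp
    (fun k (q : Vec p × (Fin (n k) → 𝒵)) => (n k : ℝ)⁻¹ • ∑ i, a (q.2 i)) fun k => by
      refine (Finset.measurable_fun_sum _ fun i _ => ha.comp ?_).const_smul _
      fun_prop
  have h' := iIndepFun.precomp (Fin.castLE_injective hm) h
  convert h' using 2 with k
  ext ω
  simp [streamAvg, Finset.sum_range]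

omit [IsProbabilityMeasure P] in
theorem integrable_comp_obs {E : Type*} [NormedAddCommGroup E] {a : 𝒵 → E}
    (ha : Integrable a M.marginal) {k i : ℕ} (hk : k < K) (hi : i < n k) :
    Integrable (fun ω => a (obs k i ω)) P := by
  rw [← hd.map_obs hk hi] at ha
  exact ha.comp_measurable (hd.measurable_obs k hk i hi)

omit [IsProbabilityMeasure P] in
theorem integral_comp_obs {E : Type*} [NormedAddCommGroup E] [NormedSpace ℝ E] {a : 𝒵 → E}
    (ha : Integrable a M.marginal) {k i : ℕ} (hk : k < K) (hi : i < n k) :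
    ∫ ω, a (obs k i ω) ∂P = ∫ z, a z ∂M.marginal := by
  have ha' := ha
  rw [← hd.map_obs hk hi] at ha' ⊢
  rw [integral_map (hd.measurable_obs k hk i hi).aemeasurable ha'.1]

omit [IsProbabilityMeasure P] in
theorem integrable_streamAvg {E : Type*} [NormedAddCommGroup E] [NormedSpace ℝ E] {a : 𝒵 → E}
    (ha : Integrable a M.marginal) {k : ℕ} (hk : k < K) : Integrable (streamAvg n obs a k) P :=
  (integrable_finsetSum _ fun _ hi =>
    hd.integrable_comp_obs ha hk (Finset.mem_range.1 hi)).smul _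

omit [IsProbabilityMeasure P] in
theorem integral_streamAvg {E : Type*} [NormedAddCommGroup E] [NormedSpace ℝ E] {a : 𝒵 → E}
    (ha : Integrable a M.marginal) {k : ℕ} (hk : k < K) (hn : 0 < n k) :
    ∫ ω, streamAvg n obs a k ω ∂P = ∫ z, a z ∂M.marginal := by
  unfold streamAvg
  have hn' : (n k : ℝ) ≠ 0 := by exact_mod_cast hn.ne'
  rw [integral_smul, integral_finsetSum _ fun i hi =>
      hd.integrable_comp_obs ha hk (Finset.mem_range.1 hi),
    Finset.sum_congr rfl fun i hi => hd.integral_comp_obs ha hk (Finset.mem_range.1 hi)]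
  simp [← Nat.cast_smul_eq_nsmul ℝ, smul_smul, inv_mul_cancel₀ hn']

omit [IsProbabilityMeasure P] in
-- Observations of one stream share its random parameter and are dependent, so only Jensen's
-- inequality is used within a stream. The decay of variance comes from independence across streams.
theorem integrable_streamAvg_sq {a : 𝒵 → ℝ} (ham : Measurable a)
    (ha : Integrable (fun z => a z ^ 2) M.marginal) {k : ℕ} (hk : k < K) (hn : 0 < n k) :
    Integrable (fun ω => streamAvg n obs a k ω ^ 2) P ∧
      ∫ ω, streamAvg n obs a k ω ^ 2 ∂P ≤ ∫ z, a z ^ 2 ∂M.marginal := by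
  have hi := hd.integrable_streamAvg ha hk
  have h1 : Integrable (fun ω => streamAvg n obs a k ω ^ 2) P :=
    hi.mono' ((hd.measurable_streamAvg ham hk).pow_const 2).aestronglyMeasurable
      (ae_of_all _ fun ω => by
        rw [Real.norm_of_nonneg (sq_nonneg _)]
        exact streamAvg_sq_le a k)
  exact ⟨h1, (integral_mono h1 hi fun ω => streamAvg_sq_le a k).trans_eq
    (hd.integral_streamAvg ha hk hn)⟩

variable (hn : ∀ k < K, 0 < n k) {m : ℕ} (hm0 : 0 < m) (hm : m ≤ K)

include hn hm0 hm

/-- The mean square of the deviation of a sample average from its mean. -/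
theorem integral_sampleAvg_sub_sq_le {a : 𝒵 → ℝ} (ham : Measurable a)
    (ha : Integrable (fun z => a z ^ 2) M.marginal) :
    Integrable (fun ω => (sampleAvg n obs a m ω - ∫ z, a z ∂M.marginal) ^ 2) P ∧
    ∫ ω, (sampleAvg n obs a m ω - ∫ z, a z ∂M.marginal) ^ 2 ∂P
      ≤ (∫ z, a z ^ 2 ∂M.marginal) / m := by
  have hkK (k : Fin m) : (k : ℕ) < K := k.2.trans_le hm
  have ha1 : Integrable a M.marginal :=
    ((memLp_two_iff_integrable_sq ham.aestronglyMeasurable).2 ha).integrable one_le_two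
  have : Nonempty (Fin m) := ⟨⟨0, hm0⟩⟩
  have h := integral_sq_average_sub_le (P := P) (X := fun k : Fin m => streamAvg n obs a k)
    (μ := ∫ z, a z ∂M.marginal) (V := fun _ => ∫ z, a z ^ 2 ∂M.marginal)
    (fun k => hd.measurable_streamAvg ham (hkK k))
    (fun k => (hd.integrable_streamAvg_sq ham ha (hkK k) (hn k (hkK k))).1)
    (hd.iIndepFun_streamAvg ham hm)
    (fun k => hd.integral_streamAvg ha1 (hkK k) (hn k (hkK k)))
    (fun k => (hd.integrable_streamAvg_sq ham ha (hkK k) (hn k (hkK k))).2)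
  have hm0' : (m : ℝ) ≠ 0 := by exact_mod_cast hm0.ne'
  simp only [Fintype.card_fin, Finset.sum_const, Finset.card_univ, nsmul_eq_mul] at h
  simp only [sampleAvg, smul_eq_mul, Finset.sum_range]
  refine ⟨h.1, h.2.trans_eq ?_⟩
  field_simp

theorem integral_norm_sampleAvg_sub_sq_le {a : 𝒵 → Vec p} (ham : Measurable a)
    (ha : Integrable (fun z => ‖a z‖ ^ 2) M.marginal) (ha1 : Integrable a M.marginal) :
    Integrable (fun ω => ‖sampleAvg n obs a m ω - ∫ z, a z ∂M.marginal‖ ^ 2) P ∧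
    ∫ ω, ‖sampleAvg n obs a m ω - ∫ z, a z ∂M.marginal‖ ^ 2 ∂P
      ≤ (∫ z, ‖a z‖ ^ 2 ∂M.marginal) / m := by
  have hmj (j : Fin p) : Measurable fun z => a z j :=
    (EuclideanSpace.proj (𝕜 := ℝ) j).continuous.measurable.comp ham
  have hij (j : Fin p) : Integrable (fun z => a z j ^ 2) M.marginal := by
    refine ha.mono' ((hmj j).pow_const 2).aestronglyMeasurable (ae_of_all _ fun z => ?_)
    rw [Real.norm_of_nonneg (sq_nonneg _), Vec.norm_sq_eq_sum]
    exact Finset.single_le_sum (f := fun j => a z j ^ 2) (fun _ _ => sq_nonneg _)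
      (Finset.mem_univ j)
  have e (ω : Ω) (j : Fin p) : (sampleAvg n obs a m ω - ∫ z, a z ∂M.marginal) j
      = sampleAvg n obs (fun z => a z j) m ω - ∫ z, a z j ∂M.marginal := by
    have h1 := sampleAvg_map (n := n) (obs := obs) (m := m) (ω := ω)
      (EuclideanSpace.proj (𝕜 := ℝ) j) a
    have h2 := (EuclideanSpace.proj (𝕜 := ℝ) j : Vec p →L[ℝ] ℝ).integral_comp_comm ha1
    exact congrArg₂ (· - ·) h1 h2.symm
  have hj (j : Fin p) := hd.integral_sampleAvg_sub_sq_le hn hm0 hm (hmj j) (hij j)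
  simp only [Vec.norm_sq_eq_sum, e]
  refine ⟨integrable_finsetSum _ fun j _ => (hj j).1, ?_⟩
  rw [integral_finsetSum _ fun j _ => (hj j).1, integral_finsetSum _ fun j _ => hij j,
    Finset.sum_div]
  exact Finset.sum_le_sum fun j _ => (hj j).2

end ContinualModel.IsSample

theorem measureReal_ge_le_div {Ω : Type*} [MeasurableSpace Ω] {P : Measure Ω} {f : Ω → ℝ}
    (hf : Integrable f P) (h0 : ∀ ω, 0 ≤ f ω) {V t : ℝ} (hV : ∫ ω, f ω ∂P ≤ V) (ht : 0 < t) :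
    P.real {ω | t ≤ f ω} ≤ V / t := by
  rw [le_div_iff₀ ht, mul_comm]
  exact (mul_meas_ge_le_integral_of_nonneg (ae_of_all _ h0) hf t).trans hV

/-! ### From operators to matrices, and probability bounds at the target. -/

section ToMatrix

variable {p : ℕ}

/-- The matrix of an operator of `ℝ^p`. -/
def Vec.toMat (T : Vec p →L[ℝ] Vec p) : Matrix (Fin p) (Fin p) ℝ :=
  (Matrix.toEuclideanCLM (n := Fin p) (𝕜 := ℝ)).symm T

theorem Vec.toMat_mulVec (T : Vec p →L[ℝ] Vec p) (u : Fin p → ℝ) :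
    (Vec.toMat T).mulVec u = T (WithLp.toLp 2 u) := by
  have := Matrix.ofLp_toEuclideanCLM (𝕜 := ℝ) (Vec.toMat T) (WithLp.toLp 2 u)
  simp only [Vec.toMat, StarAlgEquiv.apply_symm_apply] at this
  exact this.symm

theorem Vec.dotProduct_eq_inner (u v : Vec p) : u.ofLp ⬝ᵥ v.ofLp = inner ℝ u v := by
  rw [EuclideanSpace.inner_eq_star_dotProduct, star_trivial, dotProduct_comm]

theorem Vec.dotProduct_toMat (T : Vec p →L[ℝ] Vec p) (u v : Fin p → ℝ) :
    v ⬝ᵥ (Vec.toMat T).mulVec u = inner ℝ (WithLp.toLp 2 v : Vec p) (T (WithLp.toLp 2 u)) := by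
  rw [Vec.toMat_mulVec, ← Vec.dotProduct_eq_inner]

theorem Vec.measurable_toMat : Measurable (Vec.toMat (p := p)) := by
  have : Continuous ((Matrix.toEuclideanCLM (n := Fin p) (𝕜 := ℝ)).symm.toAlgEquiv.toLinearMap) :=
    LinearMap.continuous_of_finiteDimensional _
  exact this.measurable

theorem Vec.posSemidef_toMat {T : Vec p →L[ℝ] Vec p}
    (hs : ∀ u v, inner ℝ (T u) v = inner ℝ u (T v)) (h0 : ∀ u, 0 ≤ inner ℝ u (T u)) :
    (Vec.toMat T).PosSemidef := by
  refine Matrix.PosSemidef.of_dotProduct_mulVec_nonneg ?_ fun u => ?_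
  · ext i j
    have hent (i j : Fin p) : Vec.toMat T i j = inner ℝ (EuclideanSpace.single i (1 : ℝ))
        (T (EuclideanSpace.single j 1)) := by
      have := Vec.dotProduct_toMat T (Pi.single j 1) (Pi.single i 1)
      simpa using this
    rw [Matrix.conjTranspose_apply, star_trivial, hent, hent, ← hs, real_inner_comm]
  · rw [star_trivial, Vec.dotProduct_toMat]
    exact h0 _

end ToMatrix

namespace ContinualModel

variable {p : ℕ} {𝒵 : Type*} [MeasurableSpace 𝒵] {M : ContinualModel p 𝒵}
  {Ω : Type*} [MeasurableSpace Ω] {P : Measure Ω} [IsProbabilityMeasure P] {K : ℕ} {n : ℕ → ℕ}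
  {task : ℕ → Ω → Vec p} {obs : ℕ → ℕ → Ω → 𝒵} {ρ lam C₁ s : ℝ}

omit [MeasurableSpace Ω] in
theorem avgGrad_eq (m : ℕ) (θ : Vec p) (ω : Ω) :
    M.avgGrad n obs m θ ω = sampleAvg n obs (fun z => M.grad z θ) m ω := rfl

omit [MeasurableSpace Ω] in
theorem avgHess_eq (m : ℕ) (θ : Vec p) (ω : Ω) :
    M.avgHess n obs m θ ω = sampleAvg n obs (fun z => M.hess z θ) m ω := rfl

omit [MeasurableSpace Ω] in
theorem avgLoss_eq (m : ℕ) (θ : Vec p) (ω : Ω) :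
    M.avgLoss n obs m θ ω = sampleAvg n obs (fun z => M.loss z θ) m ω := rfl

omit [MeasurableSpace Ω] in
theorem avgHess_apply (m : ℕ) (θ u : Vec p) (ω : Ω) :
    M.avgHess n obs m θ ω u = sampleAvg n obs (fun z => M.hess z θ u) m ω :=
  sampleAvg_map (ContinuousLinearMap.apply ℝ (Vec p) u) (fun z => M.hess z θ)

omit [IsProbabilityMeasure P] in
-- Makes the matrix tail bound applicable to the stream Hessians at θ*, with μ = λ⁻¹ from the
-- eigenvalue condition and B proportional to p from summing the p coordinates of the Hessian
-- applied to a vector.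
theorem isMomentBounded_streamAvg_hess (h : M.Assumptions ρ lam C₁ s)
    (hd : M.IsSample P K n task obs) {k : ℕ} (hk : k < K) (hn : 0 < n k) :
    Matrix.IsMomentBounded (fun ω => Vec.toMat (streamAvg n obs (fun z => M.hess z M.θstar) k ω)) P
      lam⁻¹ (p * hessBound ρ C₁ s) := by
  have hstar := h.θstar_mem
  have happ (ω : Ω) (u : Vec p) : streamAvg n obs (fun z => M.hess z M.θstar) k ω u
      = streamAvg n obs (fun z => M.hess z M.θstar u) k ω :=
    streamAvg_map (ContinuousLinearMap.apply ℝ (Vec p) u) (fun z => M.hess z M.θstar) k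
  have hinn (ω : Ω) (u v : Vec p) :
      inner ℝ v (streamAvg n obs (fun z => M.hess z M.θstar) k ω u)
      = streamAvg n obs (fun z => inner ℝ v (M.hess z M.θstar u)) k ω := by
    rw [happ]
    exact streamAvg_map (innerSL ℝ v) (fun z => M.hess z M.θstar u) k
  have hsq (u : Fin p → ℝ) (ω : Ω) :
      ((Vec.toMat (streamAvg n obs (fun z => M.hess z M.θstar) k ω)).mulVec u) ⬝ᵥ
        ((Vec.toMat (streamAvg n obs (fun z => M.hess z M.θstar) k ω)).mulVec u)
      = ‖streamAvg n obs (fun z => M.hess z M.θstar (WithLp.toLp 2 u)) k ω‖ ^ 2 := by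
    rw [Vec.toMat_mulVec, Vec.dotProduct_eq_inner, real_inner_self_eq_norm_sq, happ]
  have hle (u : Vec p) (ω : Ω) : ‖streamAvg n obs (fun z => M.hess z M.θstar u) k ω‖ ^ 2
      ≤ streamAvg n obs (fun z => ‖M.hess z M.θstar u‖ ^ 2) k ω :=
    (pow_le_pow_left₀ (norm_nonneg _) (norm_streamAvg_le _ k) 2).trans (streamAvg_sq_le _ k)
  have hint (u : Vec p) :
      Integrable (fun ω => ‖streamAvg n obs (fun z => M.hess z M.θstar u) k ω‖ ^ 2) P :=
    (hd.integrable_streamAvg (h.integrable_norm_hess_sq u).1 hk).mono'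
      ((hd.measurable_streamAvg (h.measurable_hess_apply _ u) hk).norm.pow_const 2).aestronglyMeasurable
      (ae_of_all _ fun ω => by
        rw [Real.norm_of_nonneg (sq_nonneg _)]
        exact hle u ω)
  have huu (u : Fin p → ℝ) : u ⬝ᵥ u = ‖(WithLp.toLp 2 u : Vec p)‖ ^ 2 := by
    rw [← real_inner_self_eq_norm_sq, ← Vec.dotProduct_eq_inner]
  refine ⟨Vec.measurable_toMat.comp (hd.measurable_streamAvg (h.measurable_hess _) hk),
    fun ω => Vec.posSemidef_toMat (fun u v => ?_) fun u => ?_, fun u => ?_, fun u => ?_, fun u => ?_⟩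
  · rw [real_inner_comm, hinn, hinn]
    congr 1
    ext z
    rw [real_inner_comm, h.hess_symm z hstar]
  · rw [hinn]
    exact mul_nonneg (by positivity) (Finset.sum_nonneg fun i _ => h.hess_nonneg _ u)
  · simp only [hsq]
    exact hint _
  · simp only [Vec.dotProduct_toMat, hinn]
    rw [hd.integral_streamAvg ((h.integrable_hess_apply _).const_inner _) hk hn, ← h.inner_Sig, huu]
    exact h.Sig_coercive _
  · simp only [hsq]
    rw [huu]
    exact ((integral_mono (hint _) (hd.integrable_streamAvg (h.integrable_norm_hess_sq _).1 hk)
      (hle _)).trans_eq (hd.integral_streamAvg (h.integrable_norm_hess_sq _).1 hk hn)).trans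
      (h.integrable_norm_hess_sq _).2

/-- With high probability the empirical Hessian at the target is bounded below. -/
theorem measureReal_not_avgHess_coercive_le (h : M.Assumptions ρ lam C₁ s)
    (hd : M.IsSample P K n task obs) (hp : 0 < p) (hn : ∀ k < K, 0 < n k) {m : ℕ} (hm0 : 0 < m)
    (hm : m ≤ K) (j : ℕ) (hcard : 8 * (2 ^ j : ℕ) * (p * hessBound ρ C₁ s) ≤ m * lam⁻¹ ^ 2) :
    P.real {ω | ¬ ∀ u, lam⁻¹ / 8 * ‖u‖ ^ 2 ≤ inner ℝ u (M.avgHess n obs m M.θstar ω u)}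
      ≤ p * (2⁻¹ : ℝ) ^ 2 ^ j := by
  have hkK (k : Fin m) : (k : ℕ) < K := k.2.trans_le hm
  have hm0' : (0 : ℝ) < m := by exact_mod_cast hm0
  have hB : 0 < p * hessBound ρ C₁ s := mul_pos (by exact_mod_cast hp) h.hessBound_pos
  have ht := Matrix.measure_not_posSemidef_sum_sub_le (P := P)
    (A := fun (k : Fin m) ω => Vec.toMat (streamAvg n obs (fun z => M.hess z M.θstar) k ω))
    (fun k => isMomentBounded_streamAvg_hess h hd (hkK k) (hn k (hkK k)))
    ((hd.iIndepFun_streamAvg (h.measurable_hess _) hm).comp _ fun _ => Vec.measurable_toMat)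
    hB (inv_pos.2 h.lam_pos) j (by simpa using hcard)
  simp only [Fintype.card_fin] at ht
  refine ENNReal.toReal_le_of_le_ofReal (by positivity) ((measure_mono fun ω hω => ?_).trans ht)
  refine fun hps => hω fun u => ?_
  have h1 := hps.dotProduct_mulVec_nonneg u.ofLp
  simp only [star_trivial, Matrix.sub_mulVec, Matrix.smul_mulVec, Matrix.one_mulVec,
    dotProduct_sub, dotProduct_smul, Matrix.sum_mulVec, dotProduct_sum, smul_eq_mul,
    Vec.dotProduct_toMat, Vec.dotProduct_eq_inner, real_inner_self_eq_norm_sq] at h1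
  have e : inner ℝ u (M.avgHess n obs m M.θstar ω u) = (m : ℝ)⁻¹ *
      ∑ k : Fin m, inner ℝ u (streamAvg n obs (fun z => M.hess z M.θstar) k ω u) := by
    rw [avgHess_eq, sampleAvg, _root_.smul_apply, inner_smul_right,
      Finset.sum_range, _root_.sum_apply, inner_sum]
  rw [e, inv_mul_eq_div, le_div_iff₀ hm0']
  linarith

/-- The mean of C is at most C₁ and its second moment at most C₁², so exceeding 2C₁ is a deviation
of at least C₁, and Chebyshev applies. -/
theorem measureReal_sampleAvg_lipschitz_le (hd : M.IsSample P K n task obs)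
    (hn : ∀ k < K, 0 < n k) {m : ℕ} (hm0 : 0 < m) (hm : m ≤ K) {C : 𝒵 → ℝ} (hCm : Measurable C)
    (hC1 : 0 < C₁)
    (hCi : Integrable (fun z => C z ^ 2) M.marginal) (hC2 : ∫ z, C z ^ 2 ∂M.marginal ≤ C₁ ^ 2) :
    P.real {ω | ¬ sampleAvg n obs C m ω ≤ 2 * C₁} ≤ 1 / m := by
  have hm0' : (0 : ℝ) < m := by exact_mod_cast hm0
  obtain ⟨i1, l1⟩ := hd.integral_sampleAvg_sub_sq_le hn hm0 hm hCm hCi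
  have hL : MemLp C 2 M.marginal := (memLp_two_iff_integrable_sq hCm.aestronglyMeasurable).2 hCi
  have hvar := variance_eq_sub hL
  have hv0 := variance_nonneg C M.marginal
  have hE : ∫ z, C z ∂M.marginal ≤ C₁ := by
    have h2 : (∫ z, C z ∂M.marginal) ^ 2 ≤ C₁ ^ 2 := by
      simp only [Pi.pow_apply] at hvar
      linarith
    exact (abs_le_of_sq_le_sq' h2 hC1.le).2
  have h3 := measureReal_ge_le_div i1 (fun ω => sq_nonneg _)
    (l1.trans (div_le_div_of_nonneg_right hC2 hm0'.le)) (by positivity : 0 < C₁ ^ 2)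
  refine (measureReal_mono (fun ω hω => ?_)).trans (h3.trans_eq (by field_simp))
  have : 2 * C₁ < sampleAvg n obs C m ω := not_le.1 hω
  exact pow_le_pow_left₀ hC1.le (by linarith) 2

theorem measureReal_norm_avgGrad_ge_le (h : M.Assumptions ρ lam C₁ s)
    (hd : M.IsSample P K n task obs) (hp : 0 < p) (hn : ∀ k < K, 0 < n k) {m : ℕ} (hm0 : 0 < m)
    (hm : m ≤ K) {A : ℝ} (hA : 0 < A) :
    P.real {ω | ¬ ‖M.avgGrad n obs m M.θstar ω‖ < A * √(p / m)} ≤ 4 / s ^ 2 / A ^ 2 := by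
  have hm0' : (0 : ℝ) < m := by exact_mod_cast hm0
  have hp' : (0 : ℝ) < p := by exact_mod_cast hp
  obtain ⟨i1, l1⟩ := hd.integral_norm_sampleAvg_sub_sq_le hn hm0 hm (h.measurable_grad M.θstar)
    (h.integrable_norm_grad_sq h.θstar_mem).1 (h.integrable_grad h.θstar_mem)
  simp only [h.integral_grad_eq_zero, sub_zero] at i1 l1
  have h3 := measureReal_ge_le_div i1 (fun ω => sq_nonneg _)
    (l1.trans (div_le_div_of_nonneg_right (h.integrable_norm_grad_sq h.θstar_mem).2 hm0'.le))
    (by positivity : 0 < A ^ 2 * (p / m))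
  refine (measureReal_mono (fun ω hω => ?_)).trans (h3.trans_eq (by field_simp))
  have h4 : A * √(p / m) ≤ ‖M.avgGrad n obs m M.θstar ω‖ := not_lt.1 hω
  have h5 := pow_le_pow_left₀ (by positivity) h4 2
  rwa [mul_pow, Real.sq_sqrt (by positivity)] at h5

/-- Meant for the single deterministic vector w = Σ⁻¹v. Chebyshev in one direction then replaces any
concentration of the Hessian in operator norm. -/
theorem measureReal_norm_avgHess_sub_ge_le (h : M.Assumptions ρ lam C₁ s)
    (hd : M.IsSample P K n task obs) (hp : 0 < p) (hn : ∀ k < K, 0 < n k) {m : ℕ} (hm0 : 0 < m)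
    (hm : m ≤ K) {A : ℝ} (hA : 0 < A) (w : Vec p) :
    P.real {ω | ¬ ‖M.avgHess n obs m M.θstar ω w - M.Sig w‖ ≤ A * √(p / m) * ‖w‖}
      ≤ hessBound ρ C₁ s / A ^ 2 := by
  have hm0' : (0 : ℝ) < m := by exact_mod_cast hm0
  have hp' : (0 : ℝ) < p := by exact_mod_cast hp
  have hhb := h.hessBound_pos
  -- For w = 0 the Chebyshev threshold vanishes, but the bad event is empty.
  rcases eq_or_ne w 0 with rfl | hw
  · simp only [map_zero, sub_zero, norm_zero, mul_zero, le_refl, not_true_eq_false]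
    simp only [Set.ofPred_false, measureReal_empty]
    positivity
  have hw' : 0 < ‖w‖ := norm_pos_iff.2 hw
  obtain ⟨i1, l1⟩ := hd.integral_norm_sampleAvg_sub_sq_le hn hm0 hm
    (h.measurable_hess_apply M.θstar w) (h.integrable_norm_hess_sq w).1 (h.integrable_hess_apply w)
  have h3 := measureReal_ge_le_div i1 (fun ω => sq_nonneg _)
    (l1.trans (div_le_div_of_nonneg_right (h.integrable_norm_hess_sq w).2 hm0'.le))
    (by positivity : 0 < A ^ 2 * (p / m) * ‖w‖ ^ 2)
  refine (measureReal_mono (fun ω hω => ?_)).trans (h3.trans_eq (by field_simp))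
  have h4 : A * √(p / m) * ‖w‖ < ‖M.avgHess n obs m M.θstar ω w - M.Sig w‖ := not_le.1 hω
  have h5 := pow_le_pow_left₀ (by positivity) h4.le 2
  rw [mul_pow, mul_pow, Real.sq_sqrt (by positivity), avgHess_apply, h.Sig_apply] at h5
  exact h5

end ContinualModel

/-! ### Deterministic analysis of the initial estimator and of the Newton step. -/

namespace ContinualModel

variable {p : ℕ} {𝒵 : Type*} [MeasurableSpace 𝒵] {M : ContinualModel p 𝒵}
  {Ω : Type*} {n : ℕ → ℕ} {obs : ℕ → ℕ → Ω → 𝒵} {ρ lam C₁ s : ℝ} {C : 𝒵 → ℝ} {m : ℕ} {ω : Ω}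

/-- The average of the losses satisfies the gradient inequality of convex functions. -/
theorem avgLoss_add_inner_le (h : M.Assumptions ρ lam C₁ s) {θ θ' : Vec p} (hθ : θ ∈ M.Θ)
    (hθ' : θ' ∈ M.Θ) : M.avgLoss n obs m θ ω + inner ℝ (M.avgGrad n obs m θ ω) (θ' - θ)
      ≤ M.avgLoss n obs m θ' ω := by
  rw [avgLoss_eq, avgLoss_eq, avgGrad_eq, real_inner_comm]
  have e := sampleAvg_map (n := n) (obs := obs) (m := m) (ω := ω) (innerSL ℝ (θ' - θ))
    (fun z => M.grad z θ)
  simp only [innerSL_apply_apply] at e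
  rw [e, sampleAvg_add]
  refine sampleAvg_mono fun z => ?_
  rw [real_inner_comm]
  exact h.loss_add_inner_grad_le z hθ hθ'

theorem norm_avgHess_sub_le (hC : ∀ z, ∀ θ ∈ M.Θ, ∀ θ' ∈ M.Θ,
    ‖M.hess z θ - M.hess z θ'‖ ≤ C z * ‖θ - θ'‖) {θ θ' : Vec p} (hθ : θ ∈ M.Θ) (hθ' : θ' ∈ M.Θ) :
    ‖M.avgHess n obs m θ ω - M.avgHess n obs m θ' ω‖ ≤ sampleAvg n obs C m ω * ‖θ - θ'‖ := by
  rw [avgHess_eq, avgHess_eq, sampleAvg_sub]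
  refine (norm_sampleAvg_le _).trans ?_
  rw [← sampleAvg_mul_const]
  exact sampleAvg_mono fun z => hC z θ hθ θ' hθ'

theorem norm_avgGrad_taylor_le (h : M.Assumptions ρ lam C₁ s)
    (hC : ∀ z, ∀ θ ∈ M.Θ, ∀ θ' ∈ M.Θ, ‖M.hess z θ - M.hess z θ'‖ ≤ C z * ‖θ - θ'‖)
    {θ θ' : Vec p} (hθ : θ ∈ M.Θ) (hθ' : θ' ∈ M.Θ) :
    ‖M.avgGrad n obs m θ' ω - M.avgGrad n obs m θ ω - M.avgHess n obs m θ ω (θ' - θ)‖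
      ≤ sampleAvg n obs C m ω * ‖θ' - θ‖ ^ 2 := by
  rw [avgGrad_eq, avgGrad_eq, avgHess_apply, sampleAvg_sub, sampleAvg_sub]
  refine (norm_sampleAvg_le _).trans ?_
  rw [← sampleAvg_mul_const]
  exact sampleAvg_mono fun z => h.grad_taylor hC z hθ hθ'

theorem continuousOn_avgLoss (h : M.Assumptions ρ lam C₁ s) :
    ContinuousOn (fun θ => M.avgLoss n obs m θ ω) M.Θ := by
  unfold avgLoss
  refine continuousOn_const.mul (continuousOn_finsetSum _ fun k _ =>
    continuousOn_const.mul (continuousOn_finsetSum _ fun i _ => fun θ hθ => ?_))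
  exact (h.differentiableAt hθ _).continuousAt.continuousWithinAt

/-- If the empirical Hessian at the target is bounded below and the empirical gradient at the target
is small, then the empirical loss has a minimizer, and every minimizer is close to the target. -/
theorem exists_isMinOn_avgLoss (h : M.Assumptions ρ lam C₁ s)
    (hC : ∀ z, ∀ θ ∈ M.Θ, ∀ θ' ∈ M.Θ, ‖M.hess z θ - M.hess z θ'‖ ≤ C z * ‖θ - θ'‖)
    {c T r : ℝ} (hr : 0 < r) (hrρ : r ≤ ρ) (hT : sampleAvg n obs C m ω ≤ T) (hTr : T * r ≤ c / 2)
    (hH : ∀ u, c * ‖u‖ ^ 2 ≤ inner ℝ u (M.avgHess n obs m M.θstar ω u))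
    (hG : ‖M.avgGrad n obs m M.θstar ω‖ < c / 2 * r) :
    (∃ θ ∈ M.Θ, IsMinOn (fun θ => M.avgLoss n obs m θ ω) M.Θ θ) ∧
      ∀ θ ∈ M.Θ, IsMinOn (fun θ => M.avgLoss n obs m θ ω) M.Θ θ → ‖θ - M.θstar‖ ≤ r := by
  have hball : Metric.closedBall M.θstar r ⊆ M.Θ :=
    (Metric.closedBall_subset_closedBall hrρ).trans h.isRegular.closedBall_subset
  -- On the sphere of radius r coercivity contributes cr². The gradient at θ* takes strictly less
  -- than cr²/2 and the Taylor remainder at most cr²/2, so the loss increases outward.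
  have hout (u : Vec p) (hu : ‖u‖ = r) : 0 < inner ℝ (M.avgGrad n obs m (M.θstar + u) ω) u := by
    have hmem : M.θstar + u ∈ M.Θ := hball (by simp [hu])
    have h1 := norm_avgGrad_taylor_le (n := n) (obs := obs) (m := m) (ω := ω) h hC h.θstar_mem hmem
    rw [add_sub_cancel_left, hu] at h1
    have h2 := (abs_le.1 ((abs_real_inner_le_norm u _).trans
      (mul_le_mul_of_nonneg_left h1 (norm_nonneg u)))).1
    have h3 := (abs_le.1 (abs_real_inner_le_norm u (M.avgGrad n obs m M.θstar ω))).1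
    have h4 := hH u
    rw [inner_sub_right, inner_sub_right, hu] at h2
    rw [hu] at h3 h4
    rw [real_inner_comm]
    have h5 := mul_lt_mul_of_pos_left hG hr
    have h6 : r * (sampleAvg n obs C m ω * r ^ 2) ≤ c / 2 * r ^ 2 := by
      have := mul_le_mul_of_nonneg_right hT (pow_pos hr 3).le
      have := mul_le_mul_of_nonneg_right hTr (sq_nonneg r)
      nlinarith
    nlinarith
  -- Convexity continues the increase beyond the sphere along the ray from θ*. A minimizer over the
  -- compact ball is thus one over Θ, and no minimizer lies outside the ball.
  have hfar (θ : Vec p) (hθ : θ ∈ M.Θ) (hθr : r < ‖θ - M.θstar‖) :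
      ∃ y ∈ Metric.closedBall M.θstar r, M.avgLoss n obs m y ω < M.avgLoss n obs m θ ω := by
    set t := ‖θ - M.θstar‖ with ht
    have ht0 : 0 < t := hr.trans hθr
    set u := (r / t) • (θ - M.θstar) with hu
    have hun : ‖u‖ = r := by
      rw [hu, norm_smul, Real.norm_of_nonneg (by positivity), ← ht]
      field_simp
    have hmem : M.θstar + u ∈ Metric.closedBall M.θstar r := by simp [hun]
    refine ⟨M.θstar + u, hmem, ?_⟩
    have h1 := avgLoss_add_inner_le (n := n) (obs := obs) (m := m) (ω := ω) h (hball hmem) hθ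
    have h2 : θ - (M.θstar + u) = (t / r - 1) • u := by
      have : θ - M.θstar = (t / r) • u := by
        rw [hu, smul_smul, div_mul_div_cancel₀ hr.ne', div_self ht0.ne', one_smul]
      rw [sub_smul, one_smul, ← this]
      abel
    rw [h2, inner_smul_right] at h1
    have h3 : 0 < t / r - 1 := by rw [sub_pos, one_lt_div hr]; exact hθr
    have := mul_pos h3 (hout u hun)
    linarith
  obtain ⟨θ₁, hθ₁, hmin⟩ := (isCompact_closedBall M.θstar r).exists_isMinOn
    ⟨M.θstar, Metric.mem_closedBall_self hr.le⟩ ((continuousOn_avgLoss (n := n) (obs := obs)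
      (m := m) (ω := ω) h).mono hball)
  refine ⟨⟨θ₁, hball hθ₁, fun θ hθ => ?_⟩, fun θ hθ hθmin => ?_⟩
  · rcases le_or_gt ‖θ - M.θstar‖ r with hle | hlt
    · exact hmin (by simpa [dist_eq_norm] using hle)
    · obtain ⟨y, hy, hlt'⟩ := hfar θ hθ hlt
      exact (hmin hy).trans hlt'.le
  · by_contra hcon
    obtain ⟨y, hy, hlt'⟩ := hfar θ hθ (not_le.1 hcon)
    exact absurd (hθmin (hball hy)) (not_le.2 hlt')

/-- The analysis of one Newton step from a point close to the target. -/
theorem newton_step (h : M.Assumptions ρ lam C₁ s)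
    (hC : ∀ z, ∀ θ ∈ M.Θ, ∀ θ' ∈ M.Θ, ‖M.hess z θ - M.hess z θ'‖ ≤ C z * ‖θ - θ'‖)
    {c T r : ℝ} (hc : 0 < c) (hT0 : 0 ≤ T) (hT : sampleAvg n obs C m ω ≤ T) (hTr : T * r ≤ c / 2)
    (hH : ∀ u, c * ‖u‖ ^ 2 ≤ inner ℝ u (M.avgHess n obs m M.θstar ω u))
    {θ d : Vec p} (hθ : θ ∈ M.Θ) (hθr : ‖θ - M.θstar‖ ≤ r)
    (hd : d = θ - (M.avgHess n obs m θ ω).inverse (M.avgGrad n obs m θ ω) - M.θstar) :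
    ‖d‖ ≤ (c / 2)⁻¹ * (‖M.avgGrad n obs m M.θstar ω‖ + T * r ^ 2) ∧
    ∀ v : Vec p, |inner ℝ v d + inner ℝ (M.Sig.inverse v) (M.avgGrad n obs m M.θstar ω)|
      ≤ (c / 2)⁻¹ * ((‖M.avgHess n obs m M.θstar ω (M.Sig.inverse v) - M.Sig (M.Sig.inverse v)‖
          + T * r * ‖M.Sig.inverse v‖) * ‖M.avgGrad n obs m M.θstar ω‖ + ‖v‖ * (T * r ^ 2)) := by
  set H := M.avgHess n obs m θ ω with hHdef
  set H₀ := M.avgHess n obs m M.θstar ω with hH₀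
  set G := M.avgGrad n obs m M.θstar ω with hG
  have hdiff : ‖H - H₀‖ ≤ T * r := by
    refine (norm_avgHess_sub_le hC hθ h.θstar_mem).trans ?_
    exact (mul_le_mul_of_nonneg_right hT (norm_nonneg _)).trans
      (mul_le_mul_of_nonneg_left hθr hT0)
  -- Moving from θ* to θ changes the Hessian by at most Tr ≤ c/2, half of the coercivity constant.
  have hcoer (u : Vec p) : c / 2 * ‖u‖ ^ 2 ≤ inner ℝ u (H u) := by
    have h1 := hH u
    have h2 := (abs_le.1 ((abs_real_inner_le_norm u ((H - H₀) u)).trans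
      (mul_le_mul_of_nonneg_left ((H - H₀).le_of_opNorm_le (hdiff.trans hTr) u) (norm_nonneg u)))).1
    rw [_root_.sub_apply, inner_sub_right] at h2
    nlinarith
  obtain ⟨hinv1, hinv2, hinv3⟩ := ContinuousLinearMap.inverse_of_coercive (half_pos hc) hcoer
  set e := M.avgGrad n obs m M.θstar ω - M.avgGrad n obs m θ ω - H (M.θstar - θ) with he
  have hen : ‖e‖ ≤ T * r ^ 2 := by
    refine (norm_avgGrad_taylor_le h hC hθ h.θstar_mem).trans ?_
    rw [norm_sub_rev]
    exact (mul_le_mul_of_nonneg_right hT (sq_nonneg _)).trans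
      (mul_le_mul_of_nonneg_left (pow_le_pow_left₀ (norm_nonneg _) hθr 2) hT0)
  have hde : d = H.inverse (e - G) := by
    have h1 : e - G = H (θ - M.θstar) - M.avgGrad n obs m θ ω := by
      rw [he, hG, ← neg_sub θ M.θstar, map_neg]
      abel
    rw [h1, map_sub, hinv2, hd]
    abel
  refine ⟨?_, fun v => ?_⟩
  · rw [hde]
    refine (hinv3 _).trans (mul_le_mul_of_nonneg_left ?_ (by positivity))
    refine (norm_sub_le _ _).trans ?_
    linarith
  · set w := M.Sig.inverse v with hw
    have hSw : M.Sig w = v := h.Sig_inverse.1 v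
    have hsymm (x y : Vec p) : inner ℝ (H x) y = inner ℝ x (H y) := by
      rw [real_inner_comm, hHdef, avgHess_apply, avgHess_apply]
      have e1 := sampleAvg_map (n := n) (obs := obs) (m := m) (ω := ω) (innerSL ℝ y)
        (fun z => M.hess z θ x)
      have e2 := sampleAvg_map (n := n) (obs := obs) (m := m) (ω := ω) (innerSL ℝ x)
        (fun z => M.hess z θ y)
      simp only [innerSL_apply_apply] at e1 e2
      rw [e1, e2]
      congr 1
      ext z
      rw [real_inner_comm, h.hess_symm z hθ]
    -- Writing v = Σw and ⟨w, G⟩ = ⟨Hw, H⁻¹G⟩ confines the comparison of H with Σ to the one vector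
    -- w.
    have hkey : inner ℝ v d + inner ℝ w G
        = inner ℝ (H w - M.Sig w) (H.inverse G) + inner ℝ v (H.inverse e) := by
      rw [hde, map_sub, inner_sub_right, inner_sub_left, hsymm, hinv1, hSw]
      ring
    rw [hkey, mul_add]
    refine (abs_add_le _ _).trans (add_le_add ?_ ?_)
    · refine (abs_real_inner_le_norm _ _).trans ?_
      have h1 : ‖H w - M.Sig w‖ ≤ ‖H₀ w - M.Sig w‖ + T * r * ‖w‖ := by
        have h2 : H w - M.Sig w = (H₀ w - M.Sig w) + (H - H₀) w := by
          rw [_root_.sub_apply]; abel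
        rw [h2]
        exact (norm_add_le _ _).trans (by gcongr; exact (H - H₀).le_of_opNorm_le hdiff w)
      refine (mul_le_mul h1 (hinv3 G) (norm_nonneg _) ((norm_nonneg _).trans h1)).trans_eq ?_
      ring
    · refine (abs_real_inner_le_norm _ _).trans ?_
      refine (mul_le_mul_of_nonneg_left ((hinv3 e).trans (mul_le_mul_of_nonneg_left hen
        (by positivity))) (norm_nonneg v)).trans_eq ?_
      ring

end ContinualModel

/-! ### Growth of the number of streams and consequences of the rate condition. -/

section Rates

namespace ContinualModel

theorem numStreams_one (K : ℕ) : numStreams K 1 = K := by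
  simp [numStreams]

variable {α : ℝ}

theorem numStreams_le_rpow (K : ℕ) : (numStreams K α : ℝ) ≤ (K : ℝ) ^ α :=
  Nat.floor_le (by positivity)

theorem numStreams_le (hα : α < 1) {K : ℕ} (hK : 0 < K) : numStreams K α ≤ K := by
  have h1 : (1 : ℝ) ≤ K := by exact_mod_cast hK
  have h2 : (K : ℝ) ^ α ≤ (K : ℝ) ^ (1 : ℝ) := Real.rpow_le_rpow_of_exponent_le h1 hα.le
  rw [Real.rpow_one] at h2
  exact_mod_cast (numStreams_le_rpow K).trans h2

theorem one_le_rpow_natCast (hα : 0 < α) {K : ℕ} (hK : 0 < K) : (1 : ℝ) ≤ (K : ℝ) ^ α :=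
  Real.one_le_rpow (by exact_mod_cast hK) hα.le

theorem numStreams_pos (hα : 0 < α) {K : ℕ} (hK : 0 < K) : 0 < numStreams K α :=
  Nat.floor_pos.2 (one_le_rpow_natCast hα hK)

theorem rpow_le_two_mul_numStreams (hα : 0 < α) {K : ℕ} (hK : 0 < K) :
    (K : ℝ) ^ α ≤ 2 * numStreams K α := by
  have h1 : (1 : ℝ) ≤ numStreams K α := by exact_mod_cast numStreams_pos hα hK
  have h2 := Nat.lt_floor_add_one ((K : ℝ) ^ α)
  unfold numStreams at *
  linarith

theorem tendsto_numStreams (hα : 0 < α) :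
    Tendsto (fun K : ℕ => (numStreams K α : ℝ)) atTop atTop := by
  have h1 : Tendsto (fun K : ℕ => (K : ℝ) ^ α / 2) atTop atTop :=
    ((tendsto_rpow_atTop hα).comp tendsto_natCast_atTop_atTop).atTop_div_const two_pos
  refine tendsto_atTop_mono' _ ?_ h1
  filter_upwards [eventually_gt_atTop 0] with K hK
  linarith [rpow_le_two_mul_numStreams hα hK]

/-- The rate condition in terms of the number of streams of the initial estimator. -/
theorem tendsto_mul_div_numStreams_sq (hα : 0 < α) {a : ℕ → ℝ} (ha : ∀ K, 0 ≤ a K)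
    (h : Tendsto (fun K : ℕ => a K * K / (K : ℝ) ^ (2 * α)) atTop (𝓝 0)) :
    Tendsto (fun K : ℕ => a K * K / (numStreams K α : ℝ) ^ 2) atTop (𝓝 0) := by
  have h4 := h.const_mul 4
  rw [mul_zero] at h4
  refine tendsto_of_tendsto_of_tendsto_of_le_of_le' tendsto_const_nhds h4
    (Eventually.of_forall fun K => div_nonneg (mul_nonneg (ha K) (by positivity)) (by positivity)) ?_
  filter_upwards [eventually_gt_atTop 0] with K hK
  have hm : (0 : ℝ) < numStreams K α := by exact_mod_cast numStreams_pos hα hK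
  have h1 := rpow_le_two_mul_numStreams hα hK
  have h0 := one_le_rpow_natCast hα hK
  have h2 : (K : ℝ) ^ (2 * α) = ((K : ℝ) ^ α) ^ 2 := by
    rw [mul_comm, Real.rpow_mul (by positivity)]
    norm_num
  have h3 : ((K : ℝ) ^ α) ^ 2 ≤ 4 * (numStreams K α : ℝ) ^ 2 := by nlinarith
  have haK : 0 ≤ a K * K := mul_nonneg (ha K) (by positivity)
  rw [h2, mul_div_assoc', div_le_div_iff₀ (by positivity) (by positivity)]
  nlinarith [mul_le_mul_of_nonneg_left h3 haK]

variable {p : ℕ → ℕ}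

/-- From pK ≤ m² and m ≤ K^α, cancelling one factor m. The ratio m/p therefore grows at least like a
power of K. -/
theorem eventually_mul_rpow_le_numStreams (hα : 0 < α)
    (h : Tendsto (fun K : ℕ => (p K : ℝ) * K / (numStreams K α : ℝ) ^ 2) atTop (𝓝 0)) :
    ∀ᶠ K : ℕ in atTop, (p K : ℝ) * (K : ℝ) ^ (1 - α) ≤ numStreams K α := by
  filter_upwards [eventually_gt_atTop 0, h.eventually (gt_mem_nhds one_pos)] with K hK h1
  have hm : (0 : ℝ) < numStreams K α := by exact_mod_cast numStreams_pos hα hK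
  rw [div_lt_one (by positivity)] at h1
  have hK' : (0 : ℝ) < K := by exact_mod_cast hK
  have h2 : (K : ℝ) ^ (1 - α) * (K : ℝ) ^ α = K := by
    rw [← Real.rpow_add hK']; simp
  have h3 : (0 : ℝ) ≤ p K * (K : ℝ) ^ (1 - α) := by positivity
  have h4 := mul_le_mul_of_nonneg_left (numStreams_le_rpow (α := α) K) h3
  rw [mul_assoc (p K : ℝ) _ ((K : ℝ) ^ α), h2] at h4
  nlinarith

theorem tendsto_div_numStreams (hα₀ : 0 < α) (hα₁ : α < 1)
    (h : Tendsto (fun K : ℕ => (p K : ℝ) * K / (numStreams K α : ℝ) ^ 2) atTop (𝓝 0)) :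
    Tendsto (fun K : ℕ => (p K : ℝ) / numStreams K α) atTop (𝓝 0) := by
  refine tendsto_of_tendsto_of_tendsto_of_le_of_le' tendsto_const_nhds h
    (Eventually.of_forall fun K => by positivity) ?_
  filter_upwards [eventually_gt_atTop 0] with K hK
  have hm : (0 : ℝ) < numStreams K α := by exact_mod_cast numStreams_pos hα₀ hK
  have h1 : (numStreams K α : ℝ) ≤ K := by exact_mod_cast numStreams_le hα₁ hK
  rw [div_le_div_iff₀ hm (by positivity), sq, mul_assoc]
  have := mul_le_mul_of_nonneg_right h1 hm.le
  exact mul_le_mul_of_nonneg_left this (by positivity)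

/-- A power of two of the order of `m / p`, which beats the dimension. -/
theorem exists_two_pow_le (hα₀ : 0 < α) (hα₁ : α < 1) (hp : ∀ K, 0 < p K)
    (h : Tendsto (fun K : ℕ => (p K : ℝ) * K / (numStreams K α : ℝ) ^ 2) atTop (𝓝 0))
    {κ : ℝ} (hκ : 0 < κ) : ∃ j : ℕ → ℕ,
      (∀ᶠ K in atTop, ((2 ^ j K : ℕ) : ℝ) * p K ≤ κ * numStreams K α) ∧
      Tendsto (fun K => (p K : ℝ) * (2⁻¹ : ℝ) ^ 2 ^ j K) atTop (𝓝 0) := by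
  have hα' : 0 < 1 - α := by linarith
  have hKα : Tendsto (fun K : ℕ => (K : ℝ) ^ (1 - α)) atTop atTop :=
    (tendsto_rpow_atTop hα').comp tendsto_natCast_atTop_atTop
  set x : ℕ → ℝ := fun K => κ * numStreams K α / p K with hx
  have hp' (K : ℕ) : (0 : ℝ) < p K := by exact_mod_cast hp K
  have hxge : ∀ᶠ K : ℕ in atTop, κ * (K : ℝ) ^ (1 - α) ≤ x K := by
    filter_upwards [eventually_mul_rpow_le_numStreams hα₀ h] with K hK
    rw [hx, le_div_iff₀ (hp' K)]
    nlinarith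
  -- The largest power of two below x = κm/p; it is at least x/2.
  refine ⟨fun K => Nat.log 2 ⌊x K⌋₊, ?_, ?_⟩
  · filter_upwards [hxge, (hKα.const_mul_atTop hκ).eventually_ge_atTop 1] with K h1 h2
    have h3 : 2 ^ Nat.log 2 ⌊x K⌋₊ ≤ ⌊x K⌋₊ :=
      Nat.pow_log_le_self 2 (Nat.floor_pos.2 (h2.trans h1)).ne'
    have h4 : ((2 ^ Nat.log 2 ⌊x K⌋₊ : ℕ) : ℝ) ≤ x K :=
      (Nat.cast_le.2 h3).trans (Nat.floor_le (by linarith))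
    rwa [hx, le_div_iff₀ (hp' K)] at h4
  -- Since p ≤ K eventually and 2^j is at least (κ/4)K^(1−α), the quantity is dominated by K
  -- exp(−bK^(1−α)).
  · set b := κ / 4 * Real.log 2 with hb
    have hb0 : 0 < b := by positivity
    have hlim : Tendsto (fun K : ℕ => (K : ℝ) * Real.exp (-b * (K : ℝ) ^ (1 - α))) atTop (𝓝 0) := by
      have h1 := (tendsto_rpow_mul_exp_neg_mul_atTop_nhds_zero (1 - α)⁻¹ b hb0).comp hKα
      refine h1.congr fun K => ?_
      simp only [Function.comp]
      rw [← Real.rpow_mul (by positivity), mul_inv_cancel₀ hα'.ne', Real.rpow_one]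
    refine tendsto_of_tendsto_of_tendsto_of_le_of_le' tendsto_const_nhds hlim
      (Eventually.of_forall fun K => by positivity) ?_
    filter_upwards [hxge, (hKα.const_mul_atTop hκ).eventually_ge_atTop 1, eventually_gt_atTop 0,
      eventually_mul_rpow_le_numStreams hα₀ h] with K h1 h2 hK h5
    have hK' : (1 : ℝ) ≤ K := by exact_mod_cast hK
    have hpK : (p K : ℝ) ≤ K := by
      have h6 : (numStreams K α : ℝ) ≤ K := by exact_mod_cast numStreams_le hα₁ hK
      have h7 : (1 : ℝ) ≤ (K : ℝ) ^ (1 - α) := Real.one_le_rpow hK' hα'.le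
      have := mul_le_mul_of_nonneg_left h7 (hp' K).le
      linarith
    have h3 : ⌊x K⌋₊ < 2 ^ (Nat.log 2 ⌊x K⌋₊ + 1) := Nat.lt_pow_succ_log_self one_lt_two _
    have h4 : x K ≤ 2 * (2 : ℝ) ^ Nat.log 2 ⌊x K⌋₊ := by
      have h6 := Nat.lt_floor_add_one (x K)
      have h7 : ((⌊x K⌋₊ + 1 : ℕ) : ℝ) ≤ ((2 ^ (Nat.log 2 ⌊x K⌋₊ + 1) : ℕ) : ℝ) :=
        Nat.cast_le.2 h3
      push_cast at h7
      rw [pow_succ] at h7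
      linarith
    have h8 : (2⁻¹ : ℝ) ^ 2 ^ Nat.log 2 ⌊x K⌋₊ = Real.exp (-Real.log 2 * (2 : ℝ) ^ Nat.log 2 ⌊x K⌋₊) := by
      rw [← Real.log_inv, ← Real.rpow_def_of_pos (by norm_num)]
      rw [← Real.rpow_natCast]
      push_cast
      rfl
    rw [h8]
    refine mul_le_mul hpK (Real.exp_le_exp.2 ?_) (Real.exp_nonneg _) (by positivity)
    have hl : 0 < Real.log 2 := Real.log_pos one_lt_two
    have h9 : κ / 4 * (K : ℝ) ^ (1 - α) ≤ (2 : ℝ) ^ Nat.log 2 ⌊x K⌋₊ := by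
      have : (0 : ℝ) < (2 : ℝ) ^ Nat.log 2 ⌊x K⌋₊ := by positivity
      linarith
    rw [hb]
    nlinarith [mul_le_mul_of_nonneg_left h9 hl.le]

end ContinualModel

end Rates

/-! ### Good events and the rate of convergence. -/

namespace ContinualModel

section Good

variable {p : ℕ} {𝒵 : Type*} [MeasurableSpace 𝒵] {M : ContinualModel p 𝒵}
  {Ω : Type*} {n : ℕ → ℕ} {obs : ℕ → ℕ → Ω → 𝒵} {ρ lam C₁ s : ℝ} {C : 𝒵 → ℝ} {m K : ℕ} {ω : Ω}

/-- The sample of the first `m` streams is good: the empirical Lipschitz constant of the Hessian is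
at most `T`, the empirical Hessian at the target is bounded below by `c`, and the empirical gradient
at the target is smaller than `B`. -/
structure IsGood (M : ContinualModel p 𝒵) (n : ℕ → ℕ) (obs : ℕ → ℕ → Ω → 𝒵) (C : 𝒵 → ℝ)
    (T c B : ℝ) (m : ℕ) (ω : Ω) : Prop where
  lipschitz_le : sampleAvg n obs C m ω ≤ T
  coercive : ∀ u, c * ‖u‖ ^ 2 ≤ inner ℝ u (M.avgHess n obs m M.θstar ω u)
  norm_avgGrad_lt : ‖M.avgGrad n obs m M.θstar ω‖ < B

/-- The error of the one-stage estimator when the initial sample and the full sample are good. -/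
theorem oneStage_error (h : M.Assumptions ρ lam C₁ s)
    (hC : ∀ z, ∀ θ ∈ M.Θ, ∀ θ' ∈ M.Θ, ‖M.hess z θ - M.hess z θ'‖ ≤ C z * ‖θ - θ'‖)
    {α T c B B' : ℝ} (hc : 0 < c) (hT : 0 ≤ T) (hB : 0 < B) (hBρ : 2 * B / c ≤ ρ)
    (hTB : T * (2 * B / c) ≤ c / 2)
    (hm : IsGood M n obs C T c B (numStreams K α) ω) (hK : IsGood M n obs C T c B' K ω)
    {θ₀ : Ω → Vec p} (hθ₀ : M.IsInitialEstimator n obs K α θ₀) :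
    ‖M.oneStage n obs K 1 θ₀ ω - M.θstar‖ ≤ (c / 2)⁻¹ * (B' + T * (2 * B / c) ^ 2) ∧
    ∀ v : Vec p, |inner ℝ v (M.oneStage n obs K 1 θ₀ ω - M.θstar)
        + inner ℝ (M.Sig.inverse v) (M.avgGrad n obs K M.θstar ω)|
      ≤ (c / 2)⁻¹ * ((‖M.avgHess n obs K M.θstar ω (M.Sig.inverse v) - M.Sig (M.Sig.inverse v)‖
          + T * (2 * B / c) * ‖M.Sig.inverse v‖) * B' + ‖v‖ * (T * (2 * B / c) ^ 2)) := by
  -- The localization radius 2B/c is the one at which the gradient condition (c/2)·r = B is met.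
  have hr : 0 < 2 * B / c := by positivity
  obtain ⟨hex, hmin⟩ := exists_isMinOn_avgLoss h hC hr hBρ hm.lipschitz_le hTB hm.coercive
    (by rw [show c / 2 * (2 * B / c) = B by field_simp]; exact hm.norm_avgGrad_lt)
  obtain ⟨hmem, hθmin⟩ := hθ₀ ω hex
  obtain ⟨h1, h2⟩ := newton_step h hC hc hT hK.lipschitz_le hTB hK.coercive hmem
    (hmin _ hmem hθmin) (d := M.oneStage n obs K 1 θ₀ ω - M.θstar)
    (by rw [oneStage, numStreams_one])
  have hB' := hK.norm_avgGrad_lt.le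
  refine ⟨h1.trans (by gcongr), fun v => (h2 v).trans (by gcongr)⟩

/-- Union bound over the three requirements. The first two contributions will vanish as K grows; the
last is made small by the choice of A. -/
theorem measureReal_not_isGood_le [MeasurableSpace Ω] {P : Measure Ω} [IsProbabilityMeasure P]
    {task : ℕ → Ω → Vec p} (h : M.Assumptions ρ lam C₁ s)
    (hd : M.IsSample P K n task obs) (hp : 0 < p) (hn : ∀ k < K, 0 < n k) (hm0 : 0 < m)
    (hm : m ≤ K) (hCm : Measurable C) (hCi : Integrable (fun z => C z ^ 2) M.marginal)
    (hC2 : ∫ z, C z ^ 2 ∂M.marginal ≤ C₁ ^ 2) (j : ℕ)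
    (hcard : 8 * (2 ^ j : ℕ) * (p * hessBound ρ C₁ s) ≤ m * lam⁻¹ ^ 2) {A : ℝ} (hA : 0 < A) :
    P.real {ω | ¬ IsGood M n obs C (2 * C₁) (lam⁻¹ / 8) (A * √(p / m)) m ω}
      ≤ 1 / m + p * (2⁻¹ : ℝ) ^ 2 ^ j + 4 / s ^ 2 / A ^ 2 := by
  have h1 := measureReal_sampleAvg_lipschitz_le hd hn hm0 hm hCm h.C₁_pos hCi hC2
  have h2 := measureReal_not_avgHess_coercive_le h hd hp hn hm0 hm j hcard
  have h3 := measureReal_norm_avgGrad_ge_le h hd hp hn hm0 hm hA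
  refine (measureReal_mono (fun ω hω => ?_)).trans ((measureReal_union_le _ _).trans
    (add_le_add ((measureReal_union_le _ _).trans (add_le_add h1 h2)) h3))
  simp only [Set.mem_union, Set.mem_ofPred_eq] at hω ⊢
  by_contra hcon
  push Not at hcon
  exact hω ⟨hcon.1.1, hcon.1.2, hcon.2⟩

end Good

end ContinualModel

namespace ContinualModel

section Sequence

variable {p : ℕ → ℕ} {𝒵 : ℕ → Type*} [∀ K, MeasurableSpace (𝒵 K)]
  {M : ∀ K, ContinualModel (p K) (𝒵 K)} {Ω : ℕ → Type*} [∀ K, MeasurableSpace (Ω K)]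
  {P : ∀ K, Measure (Ω K)} [∀ K, IsProbabilityMeasure (P K)] {n : ℕ → ℕ → ℕ}
  {task : ∀ K, ℕ → Ω K → Vec (p K)} {obs : ∀ K, ℕ → ℕ → Ω K → 𝒵 K} {α ρ lam C₁ s : ℝ}
  {θ₀ : ∀ K, Ω K → Vec (p K)}

/-- Off an event of small probability the error of the one-stage estimator is controlled. -/
theorem eventually_oneStage_error (h : ∀ K, (M K).Assumptions ρ lam C₁ s) (hp : ∀ K, 0 < p K)
    (hn : ∀ K, ∀ k < K, 0 < n K k)
    (hdata : ∀ K, (M K).IsSample (P K) K (n K) (task K) (obs K)) (hα₀ : 0 < α) (hα₁ : α < 1)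
    (hθ₀ : ∀ K, (M K).IsInitialEstimator (n K) (obs K) K α (θ₀ K))
    (hrate : Tendsto (fun K : ℕ => (p K : ℝ) * K / (numStreams K α : ℝ) ^ 2) atTop (𝓝 0))
    {A : ℝ} (hA : 0 < A) {δ : ℝ} (hδ : 0 < δ) :
    ∃ D : ℝ, 0 < D ∧ ∀ᶠ K in atTop, (P K).real {ω | ¬
      (‖(M K).oneStage (n K) (obs K) K 1 (θ₀ K) ω - (M K).θstar‖
          ≤ D * (√(p K / K) + p K / numStreams K α) ∧
      ∀ v : Vec (p K), |inner ℝ v ((M K).oneStage (n K) (obs K) K 1 (θ₀ K) ω - (M K).θstar)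
          + inner ℝ ((M K).Sig.inverse v) ((M K).avgGrad (n K) (obs K) K (M K).θstar ω)|
        ≤ D * ((‖(M K).avgHess (n K) (obs K) K (M K).θstar ω ((M K).Sig.inverse v)
              - (M K).Sig ((M K).Sig.inverse v)‖
            + √(p K / numStreams K α) * ‖v‖) * √(p K / K)
          + ‖v‖ * (p K / numStreams K α)))} ≤ 8 / s ^ 2 / A ^ 2 + δ := by
  have hlam := (h 0).lam_pos
  have hρ := (h 0).ρ_pos
  have hC₁ := (h 0).C₁_pos
  have hhb := (h 0).hessBound_pos
  choose C hCm hC0 hC hCi hC2 using fun K => (h K).exists_lipschitz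
  set c := lam⁻¹ / 8 with hc
  have hc0 : 0 < c := by positivity
  set r : ℕ → ℝ := fun K => 2 * (A * √(p K / numStreams K α)) / c with hr
  have hr0 (K : ℕ) : 0 ≤ r K := by positivity
  have hpm := tendsto_div_numStreams hα₀ hα₁ hrate
  have hrlim : Tendsto r atTop (𝓝 0) := by
    have := (((hpm.sqrt).const_mul A).const_mul 2).div_const c
    rwa [Real.sqrt_zero, mul_zero, mul_zero, zero_div] at this
  -- This κ turns 2^j·p ≤ κm into the cardinality condition of the matrix tail bound.
  obtain ⟨j, hj1, hj2⟩ := exists_two_pow_le hα₀ hα₁ hp hrate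
    (κ := lam⁻¹ ^ 2 / (8 * hessBound ρ C₁ s)) (by positivity)
  have hm1 : Tendsto (fun K : ℕ => 1 / (numStreams K α : ℝ)) atTop (𝓝 0) :=
    (tendsto_numStreams hα₀).const_div_atTop 1
  have hbad : Tendsto (fun K : ℕ => 2 * (1 / (numStreams K α : ℝ)
      + (p K : ℝ) * (2⁻¹ : ℝ) ^ 2 ^ j K)) atTop (𝓝 0) := by
    simpa using (hm1.add hj2).const_mul 2
  -- The factor (c/2)⁻¹ bounds the inverse Hessian. The three terms come from the gradient and
  -- Hessian deviations, the squared radius in the Taylor remainder, and the Hessian's change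
  -- between θ* and θ₀ applied to Σ⁻¹v.
  refine ⟨(c / 2)⁻¹ * (A + 2 * C₁ * (4 * A ^ 2 / c ^ 2) + 2 * C₁ * (2 * A / c) * lam * A), by positivity, ?_⟩
  have hTr := hrlim.const_mul (2 * C₁)
  rw [mul_zero] at hTr
  filter_upwards [eventually_gt_atTop 0, hj1, hbad.eventually (gt_mem_nhds hδ),
    hrlim.eventually (gt_mem_nhds hρ), hTr.eventually (gt_mem_nhds (half_pos hc0))]
    with K hK hjK hbK hrρ hTrK
  have hm0 := numStreams_pos hα₀ hK
  have hmK := numStreams_le hα₁ hK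
  have hm0' : (0 : ℝ) < numStreams K α := by exact_mod_cast hm0
  have hmK' : (numStreams K α : ℝ) ≤ K := by exact_mod_cast hmK
  have hK' : (0 : ℝ) < K := by exact_mod_cast hK
  have hp' : (0 : ℝ) < p K := by exact_mod_cast hp K
  have hcard : 8 * ((2 ^ j K : ℕ) : ℝ) * (p K * hessBound ρ C₁ s)
      ≤ numStreams K α * lam⁻¹ ^ 2 := by
    rw [div_mul_eq_mul_div, le_div_iff₀ (by positivity)] at hjK
    linarith
  have b1 := measureReal_not_isGood_le (h K) (hdata K) (hp K) (hn K) hm0 hmK (hCm K) (hCi K)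
    (hC2 K) (j K) hcard hA
  -- The same exponent serves all K streams, because m ≤ K weakens the cardinality condition.
  have b2 := measureReal_not_isGood_le (h K) (hdata K) (hp K) (hn K) hK le_rfl (hCm K) (hCi K)
    (hC2 K) (j K) (hcard.trans (by gcongr)) hA
  have b3 : (1 : ℝ) / K ≤ 1 / numStreams K α := one_div_le_one_div_of_le hm0' hmK'
  refine (measureReal_mono (fun ω hω => ?_)).trans ((measureReal_union_le _ _).trans
    ((add_le_add b1 b2).trans ?_))
  · simp only [Set.mem_union, Set.mem_ofPred_eq] at hω ⊢
    by_contra hcon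
    push Not at hcon
    refine hω ?_
    have hx := Real.sqrt_nonneg ((p K : ℝ) / numStreams K α)
    have hy := Real.sqrt_nonneg ((p K : ℝ) / K)
    have hx2 : √((p K : ℝ) / numStreams K α) ^ 2 = p K / numStreams K α :=
      Real.sq_sqrt (by positivity)
    have hB : 0 < A * √((p K : ℝ) / numStreams K α) :=
      mul_pos hA (Real.sqrt_pos.2 (by positivity))
    obtain ⟨e1, e2⟩ := oneStage_error (h K) (hC K) hc0 (by positivity) hB hrρ.le hTrK.le
      hcon.1 hcon.2 (hθ₀ K)
    set x := √((p K : ℝ) / numStreams K α)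
    set y := √((p K : ℝ) / K)
    rw [← hx2]
    refine ⟨e1.trans ?_, fun v => (e2 v).trans ?_⟩
    · rw [mul_assoc (c / 2)⁻¹]
      refine mul_le_mul_of_nonneg_left ?_ (by positivity)
      have e3 : 2 * C₁ * (2 * (A * x) / c) ^ 2 = 2 * C₁ * (4 * A ^ 2 / c ^ 2) * x ^ 2 := by
        field_simp
        ring
      rw [e3]
      have z1 : 0 ≤ 2 * C₁ * (4 * A ^ 2 / c ^ 2) := by positivity
      have z2 : 0 ≤ 2 * C₁ * (2 * A / c) * lam * A := by positivity
      linarith [mul_nonneg z1 hy, mul_nonneg z2 hy, mul_nonneg z2 (sq_nonneg x),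
        mul_nonneg hA.le (sq_nonneg x)]
    · rw [mul_assoc (c / 2)⁻¹]
      refine mul_le_mul_of_nonneg_left ?_ (by positivity)
      have e3 : 2 * C₁ * (2 * (A * x) / c) ^ 2 = 2 * C₁ * (4 * A ^ 2 / c ^ 2) * x ^ 2 := by
        field_simp
        ring
      rw [e3]
      have hw := (h K).Sig_inverse.2.2 v
      have hu := norm_nonneg ((M K).avgHess (n K) (obs K) K (M K).θstar ω ((M K).Sig.inverse v)
              - (M K).Sig ((M K).Sig.inverse v))
      set u := ‖(M K).avgHess (n K) (obs K) K (M K).θstar ω ((M K).Sig.inverse v)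
              - (M K).Sig ((M K).Sig.inverse v)‖
      have z1 : 0 ≤ 2 * C₁ * (4 * A ^ 2 / c ^ 2) := by positivity
      have z2 : 0 ≤ 2 * C₁ * (2 * A / c) * lam * A := by positivity
      have hv := norm_nonneg v
      have e4 : (u + 2 * C₁ * (2 * (A * x) / c) * ‖(M K).Sig.inverse v‖) * (A * y)
          ≤ A * (u * y) + 2 * C₁ * (2 * A / c) * lam * A * (x * ‖v‖ * y) := by
        have : 2 * C₁ * (2 * (A * x) / c) * ‖(M K).Sig.inverse v‖
            ≤ 2 * C₁ * (2 * (A * x) / c) * (lam * ‖v‖) := by gcongr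
        have := mul_le_mul_of_nonneg_right this (mul_nonneg hA.le hy)
        have e5 : 2 * C₁ * (2 * (A * x) / c) * (lam * ‖v‖) * (A * y)
          = 2 * C₁ * (2 * A / c) * lam * A * (x * ‖v‖ * y) := by ring
        linarith
      refine (add_le_add_left e4 _).trans ?_
      have q1 : 0 ≤ u * y := mul_nonneg hu hy
      have q2 : 0 ≤ x * ‖v‖ * y := by positivity
      have q3 : 0 ≤ ‖v‖ * x ^ 2 := by positivity
      linarith [mul_nonneg z1 q1, mul_nonneg z1 q2, mul_nonneg z2 q1, mul_nonneg z2 q3,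
        mul_nonneg hA.le q2, mul_nonneg hA.le q3]
  · have : 8 / s ^ 2 / A ^ 2 = 2 * (4 / s ^ 2 / A ^ 2) := by ring
    linarith

/-- The rate of convergence of the one-stage estimator. -/
theorem isBigOInProb_oneStage (h : ∀ K, (M K).Assumptions ρ lam C₁ s) (hp : ∀ K, 0 < p K)
    (hn : ∀ K, ∀ k < K, 0 < n K k)
    (hdata : ∀ K, (M K).IsSample (P K) K (n K) (task K) (obs K)) (hα₀ : 0 < α) (hα₁ : α < 1)
    (hθ₀ : ∀ K, (M K).IsInitialEstimator (n K) (obs K) K α (θ₀ K))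
    (hrate : Tendsto (fun K : ℕ => (p K : ℝ) * K / (numStreams K α : ℝ) ^ 2) atTop (𝓝 0)) :
    IsBigOInProb P
      (fun K ω => ‖(M K).oneStage (n K) (obs K) K 1 (θ₀ K) ω - (M K).θstar‖)
      (fun K => √((p K : ℝ) / K)) := by
  intro ε hε
  have hs := (h 0).s_pos
  -- Makes the Chebyshev contribution of the two samples equal to ε/4; with the ε/2 below, the total
  -- stays under ε.
  set A := √(32 / (s ^ 2 * ε)) with hAdef
  have hA : 0 < A := Real.sqrt_pos.2 (by positivity)
  have hA2 : 8 / s ^ 2 / A ^ 2 = ε / 4 := by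
    rw [hAdef, Real.sq_sqrt (by positivity)]
    field_simp
    norm_num
  obtain ⟨D, hD, hev⟩ := eventually_oneStage_error h hp hn hdata hα₀ hα₁ hθ₀ hrate hA
    (half_pos hε)
  refine ⟨D * 2 + 1, by positivity, ?_⟩
  filter_upwards [hev, eventually_gt_atTop 0, hrate.eventually (gt_mem_nhds one_pos)]
    with K hbad hK hK1
  have hm0' : (0 : ℝ) < numStreams K α := by exact_mod_cast numStreams_pos hα₀ hK
  have hK' : (0 : ℝ) < K := by exact_mod_cast hK
  have hp' : (0 : ℝ) < p K := by exact_mod_cast hp K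
  have hy : 0 < √((p K : ℝ) / K) := Real.sqrt_pos.2 (by positivity)
  -- Equivalent to pK ≤ m²: here the rate condition absorbs the Newton remainder into the target
  -- rate.
  have hxy : (p K : ℝ) / numStreams K α ≤ √((p K : ℝ) / K) := by
    refine Real.le_sqrt_of_sq_le ?_
    rw [div_pow, div_le_div_iff₀ (by positivity) hK']
    rw [div_lt_one (by positivity)] at hK1
    nlinarith
  -- The good and bad events cover the space, so subadditivity alone gives the lower bound and no
  -- measurability of the estimator is needed.
  have hcov : (1 : ℝ) ≤ (P K).real {ω | |‖(M K).oneStage (n K) (obs K) K 1 (θ₀ K) ω - (M K).θstar‖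
      / √((p K : ℝ) / K)| < D * 2 + 1} + (8 / s ^ 2 / A ^ 2 + ε / 2) := by
    refine le_trans ?_ (add_le_add_right hbad _)
    refine (probReal_univ (μ := P K)).symm.trans_le ?_
    refine (measureReal_mono fun ω _ => ?_).trans (measureReal_union_le _ _)
    rw [Set.mem_union, or_iff_not_imp_right]
    intro hω
    simp only [Set.mem_ofPred_eq, not_not] at hω ⊢
    rw [abs_of_nonneg (by positivity), div_lt_iff₀ hy]
    nlinarith [hω.1]
  linarith

end Sequence

end ContinualModel

/-! ### A triangular-array central limit theorem through characteristic functions. -/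

/-- For |x| ≤ 1 this is the exponential series with remainder factor e ≤ 4. For |x| ≥ 1 every term
is dominated by |x|³ and the triangle inequality suffices. -/
theorem Complex.norm_exp_ofReal_mul_I_sub_le (x : ℝ) :
    ‖Complex.exp (x * Complex.I) - (1 + x * Complex.I - x ^ 2 / 2)‖ ≤ 4 * |x| ^ 3 := by
  have hI : ‖(x * Complex.I : ℂ)‖ = |x| := by simp
  rcases le_total |x| 1 with hx | hx
  · have h := Complex.norm_exp_sub_sum_le_norm_mul_exp (x * Complex.I) 3
    have e : ∑ m ∈ Finset.range 3, (x * Complex.I : ℂ) ^ m / (m.factorial : ℂ)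
        = 1 + x * Complex.I - x ^ 2 / 2 := by
      simp [Finset.sum_range_succ, mul_pow]
      ring
    rw [e, hI] at h
    refine h.trans ?_
    rw [mul_comm]
    refine mul_le_mul_of_nonneg_right ?_ (by positivity)
    exact (Real.exp_le_exp.2 hx).trans (by linarith [Real.exp_one_lt_d9])
  · have h1 : ‖(1 + x * Complex.I - x ^ 2 / 2 : ℂ)‖ ≤ 1 + |x| + |x| ^ 2 / 2 := by
      refine (norm_sub_le _ _).trans (add_le_add ((norm_add_le _ _).trans ?_) ?_)
      · simp
      · simp
    refine (norm_sub_le _ _).trans ((add_le_add (Complex.norm_exp_ofReal_mul_I x).le h1).trans ?_)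
    have h2 : |x| ≤ |x| ^ 3 := le_self_pow₀ hx (by norm_num)
    have h3 : |x| ^ 2 ≤ |x| ^ 3 := pow_le_pow_right₀ hx (by norm_num)
    linarith

/-- The second-order expansion of the characteristic function of a standardized law. -/
theorem norm_charFun_sub_le {ν : Measure ℝ} [IsProbabilityMeasure ν] (h0 : ∫ x, x ∂ν = 0)
    (h2 : ∫ x, x ^ 2 ∂ν = 1) (hi : Integrable (fun x => |x| ^ 3) ν) {B : ℝ}
    (hB : ∫ x, |x| ^ 3 ∂ν ≤ B) (t : ℝ) :
    ‖charFun ν t - (1 - (t : ℂ) ^ 2 / 2)‖ ≤ 4 * B * |t| ^ 3 := by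
  -- A non-integrable function has integral 0 by convention, so a second moment equal to 1 forces
  -- integrability.
  have i2 : Integrable (fun x : ℝ => x ^ 2) ν := .of_integral_ne_zero (by rw [h2]; exact one_ne_zero)
  have i1 : Integrable (fun x : ℝ => x) ν :=
    ((memLp_two_iff_integrable_sq measurable_id.aestronglyMeasurable).2 i2).integrable one_le_two
  have iexp : Integrable (fun x : ℝ => Complex.exp (t * x * Complex.I)) ν := by
    refine (integrable_const (1 : ℝ)).mono' (by fun_prop) (ae_of_all _ fun x => ?_)
    rw [← Complex.ofReal_mul, Complex.norm_exp_ofReal_mul_I]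
  have ilin : Integrable (fun x : ℝ => (1 + ((t * x : ℝ) : ℂ) * Complex.I)) ν :=
    (integrable_const _).add ((i1.const_mul t).ofReal.mul_const _)
  have iquad : Integrable (fun x : ℝ => (((t ^ 2 / 2 * x ^ 2 : ℝ)) : ℂ)) ν :=
    (i2.const_mul _).ofReal
  have isub : Integrable (fun x : ℝ => (1 + ((t * x : ℝ) : ℂ) * Complex.I)
      - ((t ^ 2 / 2 * x ^ 2 : ℝ) : ℂ)) ν := ilin.sub iquad
  have e : (1 - (t : ℂ) ^ 2 / 2)
      = ∫ x : ℝ, ((1 + ((t * x : ℝ) : ℂ) * Complex.I) - ((t ^ 2 / 2 * x ^ 2 : ℝ) : ℂ)) ∂ν := by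
    rw [integral_sub ilin iquad, integral_add (integrable_const _)
      ((i1.const_mul t).ofReal.mul_const _), integral_mul_const, integral_complex_ofReal,
      integral_complex_ofReal, integral_const_mul, integral_const_mul, h0, h2]
    simp
  rw [charFun_apply_real, e, ← integral_sub iexp isub]
  have hbi : Integrable (fun x : ℝ => 4 * |t| ^ 3 * |x| ^ 3) ν := hi.const_mul _
  refine (norm_integral_le_of_norm_le hbi (ae_of_all _ fun x => ?_)).trans ?_
  · have := Complex.norm_exp_ofReal_mul_I_sub_le (t * x)
    rw [abs_mul, mul_pow, ← mul_assoc] at this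
    refine le_trans (le_of_eq ?_) this
    congr 1
    push_cast
    ring
  · rw [integral_const_mul]
    have := mul_le_mul_of_nonneg_left hB (by positivity : 0 ≤ 4 * |t| ^ 3)
    linarith

/-- The central limit theorem, in terms of characteristic functions, for a triangular array whose
rows are independent and identically distributed with bounded third moments. -/
theorem tendsto_charFun_sum_of_bounded_third_moment {Ω : ℕ → Type*} [∀ K, MeasurableSpace (Ω K)]
    {P : ∀ K, Measure (Ω K)} [∀ K, IsProbabilityMeasure (P K)] {X : ∀ K, Fin K → Ω K → ℝ}
    {ν : ℕ → Measure ℝ} [∀ K, IsProbabilityMeasure (ν K)] (hm : ∀ K k, Measurable (X K k))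
    (hind : ∀ K, iIndepFun (X K) (P K)) (hlaw : ∀ K k, (P K).map (X K k) = ν K)
    (h0 : ∀ K, ∫ x, x ∂ν K = 0) (h2 : ∀ K, ∫ x, x ^ 2 ∂ν K = 1)
    (hi : ∀ K, Integrable (fun x => |x| ^ 3) (ν K)) {B : ℝ} (hB : ∀ K, ∫ x, |x| ^ 3 ∂ν K ≤ B)
    (t : ℝ) :
    Tendsto (fun K : ℕ => charFun ((P K).map fun ω => (√(K : ℝ))⁻¹ * ∑ k, X K k ω) t) atTop
      (𝓝 (charFun (gaussianReal 0 1) t)) := by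
  have e1 (K : ℕ) : charFun ((P K).map fun ω => (√(K : ℝ))⁻¹ * ∑ k, X K k ω) t
      = charFun (ν K) ((√(K : ℝ))⁻¹ * t) ^ K := by
    rw [charFun_map_mul_comp (Finset.measurable_fun_sum _ fun k _ => hm K k).aemeasurable,
      (hind K).charFun_map_fun_sum_eq_prod fun k => (hm K k).aemeasurable]
    simp [hlaw]
  have e2 : charFun (gaussianReal 0 1) t = Complex.exp (-(t : ℂ) ^ 2 / 2) := by
    rw [charFun_gaussianReal]
    simp [neg_div]
  simp only [e1, e2]
  refine Complex.tendsto_pow_exp_of_isLittleO_sub_add_div _ ?_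
  -- The expansion at t/√K has error of order K^(-3/2), which is o(1/K) as the limit of K-th powers
  -- requires.
  refine Asymptotics.IsBigO.trans_isLittleO
    (g := fun K : ℕ => (K : ℝ)⁻¹ * (√(K : ℝ))⁻¹) ?_ ?_
  · refine Asymptotics.IsBigO.of_bound (4 * B * |t| ^ 3) ?_
    filter_upwards [eventually_gt_atTop 0] with K hK
    have hK' : (0 : ℝ) < K := by exact_mod_cast hK
    have h := norm_charFun_sub_le (h0 K) (h2 K) (hi K) (hB K) ((√(K : ℝ))⁻¹ * t)
    have hsq : √(K : ℝ) ^ 2 = K := Real.sq_sqrt hK'.le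
    have hs : 0 < √(K : ℝ) := Real.sqrt_pos.2 hK'
    have h3 : ((((√(K : ℝ))⁻¹ * t : ℝ) : ℂ)) ^ 2 = (t : ℂ) ^ 2 / K := by
      rw [← Complex.ofReal_pow, mul_pow, inv_pow, hsq]
      push_cast
      field_simp
    rw [h3] at h
    have h4 : |(√(K : ℝ))⁻¹ * t| ^ 3 = |t| ^ 3 * ((K : ℝ)⁻¹ * (√(K : ℝ))⁻¹) := by
      rw [abs_mul, mul_pow, abs_of_pos (by positivity), inv_pow, pow_succ, hsq, mul_inv]
      ring
    rw [h4, ← mul_assoc] at h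
    rw [Real.norm_of_nonneg (by positivity)]
    refine le_trans (le_of_eq ?_) h
    congr 1
    ring
  · have h1 : Tendsto (fun K : ℕ => (√(K : ℝ))⁻¹) atTop (𝓝 0) :=
      tendsto_inv_atTop_zero.comp (Real.tendsto_sqrt_atTop.comp tendsto_natCast_atTop_atTop)
    have h2 : (fun K : ℕ => (√(K : ℝ))⁻¹) =o[atTop] fun _ => (1 : ℝ) :=
      (Asymptotics.isLittleO_one_iff ℝ).2 h1
    have h3 := (Asymptotics.isBigO_refl (fun K : ℕ => (K : ℝ)⁻¹) atTop).mul_isLittleO h2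
    refine h3.trans_isBigO (Asymptotics.IsBigO.of_bound 1 (Eventually.of_forall fun K => ?_))
    simp

/-- Characteristic functions of random variables that are close in probability. -/
theorem norm_charFun_map_sub_le {Ω : Type*} [MeasurableSpace Ω] {P : Measure Ω}
    [IsProbabilityMeasure P] {X Y : Ω → ℝ} (hX : Measurable X) (hY : Measurable Y) {ε : ℝ}
    (hε : 0 ≤ ε) (t : ℝ) :
    ‖charFun (P.map Y) t - charFun (P.map X) t‖
      ≤ |t| * ε + 2 * P.real {ω | ¬ |Y ω - X ω| ≤ ε} := by
  have hi {Z : Ω → ℝ} (hZ : Measurable Z) :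
      Integrable (fun ω => Complex.exp (t * Z ω * Complex.I)) P := by
    refine (integrable_const (1 : ℝ)).mono' (by fun_prop) (ae_of_all _ fun x => ?_)
    rw [← Complex.ofReal_mul, Complex.norm_exp_ofReal_mul_I]
  have hS : MeasurableSet {ω | ¬ |Y ω - X ω| ≤ ε} :=
    (measurableSet_le (hY.sub hX).norm measurable_const).compl
  have hc {Z : Ω → ℝ} (hZ : Measurable Z) :
      charFun (P.map Z) t = ∫ ω, Complex.exp (t * Z ω * Complex.I) ∂P := by
    rw [charFun_apply_real]
    exact integral_map (f := fun x : ℝ => Complex.exp (t * x * Complex.I)) hZ.aemeasurable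
      (by fun_prop)
  rw [hc hX, hc hY, ← integral_sub (hi hY) (hi hX)]
  -- Where X and Y are close the two exponentials differ by at most |t|ε; elsewhere by at most 2.
  have hbi : Integrable (fun ω => |t| * ε + {ω | ¬ |Y ω - X ω| ≤ ε}.indicator (fun _ => (2 : ℝ)) ω) P :=
    (integrable_const _).add ((integrable_const _).indicator hS)
  refine (norm_integral_le_of_norm_le hbi (ae_of_all _ fun ω => ?_)).trans_eq ?_
  · by_cases hω : |Y ω - X ω| ≤ ε
    · rw [Set.indicator_of_notMem (by simpa using hω), add_zero]
      have e : Complex.exp (t * Y ω * Complex.I) - Complex.exp (t * X ω * Complex.I)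
          = Complex.exp ((t * X ω : ℝ) * Complex.I)
            * (Complex.exp (Complex.I * (t * (Y ω - X ω) : ℝ)) - 1) := by
        rw [mul_sub, ← Complex.exp_add, mul_one]
        push_cast
        congr 2
        ring
      rw [e, norm_mul, Complex.norm_exp_ofReal_mul_I, one_mul]
      refine Real.norm_exp_I_mul_ofReal_sub_one_le.trans ?_
      rw [norm_mul, Real.norm_eq_abs, Real.norm_eq_abs]
      gcongr
    · rw [Set.indicator_of_mem (by simpa using hω)]
      refine (norm_sub_le _ _).trans ?_
      rw [← Complex.ofReal_mul, ← Complex.ofReal_mul, Complex.norm_exp_ofReal_mul_I,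
        Complex.norm_exp_ofReal_mul_I]
      have : 0 ≤ |t| * ε := by positivity
      linarith
  · rw [integral_add (integrable_const _) ((integrable_const _).indicator hS),
      integral_indicator hS]
    simp [mul_comm]

/-- Convergence in distribution to the standard normal law from that of the characteristic functions
of random variables that are close in probability. -/
theorem tendstoInDistribution_gaussian_of_approx {Ω : ℕ → Type*} [∀ K, MeasurableSpace (Ω K)]
    {P : ∀ K, Measure (Ω K)} [∀ K, IsProbabilityMeasure (P K)] {X Y : ∀ K, Ω K → ℝ}
    (hX : ∀ K, Measurable (X K)) (hY : ∀ K, Measurable (Y K))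
    (hchar : ∀ t, Tendsto (fun K => charFun ((P K).map (X K)) t) atTop
      (𝓝 (charFun (gaussianReal 0 1) t)))
    (happ : ∀ ε > 0, ∀ δ > 0, ∀ᶠ K in atTop, (P K).real {ω | ¬ |Y K ω - X K ω| ≤ ε} ≤ δ) :
    TendstoInDistribution Y atTop (id : ℝ → ℝ) P (gaussianReal 0 1) where
  forall_aemeasurable K := (hY K).aemeasurable
  aemeasurable_limit := aemeasurable_id
  tendsto := by
    refine ProbabilityMeasure.tendsto_iff_tendsto_charFun.2 fun t => ?_
    simp only [ProbabilityMeasure.coe_mk, Measure.map_id]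
    have hdiff : Tendsto (fun K => charFun ((P K).map (Y K)) t - charFun ((P K).map (X K)) t)
        atTop (𝓝 0) := by
      refine Metric.tendsto_nhds.2 fun η hη => ?_
      have hε : 0 < η / (2 * (|t| + 1)) := by positivity
      filter_upwards [happ _ hε (η / 8) (by positivity)] with K hK
      rw [dist_zero_right]
      refine (norm_charFun_map_sub_le (hX K) (hY K) hε.le t).trans_lt ?_
      have : |t| * (η / (2 * (|t| + 1))) ≤ η / 2 := by
        rw [mul_div_assoc', div_le_div_iff₀ (by positivity) (by positivity)]
        nlinarith [abs_nonneg t]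
      linarith
    simpa using hdiff.add (hchar t)

/-! ### Measurability of the Newton estimator. -/

section Inverse

variable {p : ℕ}

/-- Inversion is continuous on the open set of invertible operators and constantly 0 off it. -/
theorem ContinuousLinearMap.measurable_inverse :
    Measurable (ContinuousLinearMap.inverse : (Vec p →L[ℝ] Vec p) → (Vec p →L[ℝ] Vec p)) := by
  classical
  rw [← ContinuousLinearMap.ringInverse_eq_inverse]
  have h : (Ring.inverse : (Vec p →L[ℝ] Vec p) → _)
      = {T | IsUnit T}.piecewise Ring.inverse (fun _ => 0) := by
    ext1 T
    by_cases hT : IsUnit T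
    · rw [Set.piecewise_eq_of_mem _ _ _ (show T ∈ {T | IsUnit T} from hT)]
    · rw [Set.piecewise_eq_of_notMem _ _ _ (show T ∉ {T | IsUnit T} from hT),
        Ring.inverse_non_unit _ hT]
  rw [h]
  refine ContinuousOn.measurable_piecewise (fun T hT => ?_) continuousOn_const
    Units.isOpen.measurableSet
  obtain ⟨u, rfl⟩ := hT
  exact (NormedRing.inverse_continuousAt u).continuousWithinAt

theorem measurable_clm_apply {α : Type*} [MeasurableSpace α] {T : α → Vec p →L[ℝ] Vec p}
    {u : α → Vec p} (hT : Measurable T) (hu : Measurable u) : Measurable fun a => T a (u a) :=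
  (isBoundedBilinearMap_apply (𝕜 := ℝ) (E := Vec p) (F := Vec p)).continuous.measurable.comp
    (hT.prodMk hu)

end Inverse

namespace ContinualModel

variable {p : ℕ} {𝒵 : Type*} [MeasurableSpace 𝒵] {M : ContinualModel p 𝒵}
  {Ω : Type*} [MeasurableSpace Ω] {P : Measure Ω} {K : ℕ} {n : ℕ → ℕ}
  {task : ℕ → Ω → Vec p} {obs : ℕ → ℕ → Ω → 𝒵} {ρ lam C₁ s : ℝ}

/-- The evaluation point is itself random, which is why joint measurability of the integrand is
needed. -/
theorem measurable_sampleAvg_random (hd : M.IsSample P K n task obs) {E : Type*}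
    [NormedAddCommGroup E] [NormedSpace ℝ E] [MeasurableSpace E] [BorelSpace E]
    [SecondCountableTopology E] {a : 𝒵 × Vec p → E} (ha : Measurable a) {θ₀ : Ω → Vec p}
    (hθ₀ : Measurable θ₀) :
    Measurable fun ω => sampleAvg n obs (fun z => a (z, θ₀ ω)) K ω := by
  unfold sampleAvg streamAvg
  exact (Finset.measurable_fun_sum _ fun k hk => (Finset.measurable_fun_sum _ fun i hi =>
    ha.comp ((hd.measurable_obs k (Finset.mem_range.1 hk) i (Finset.mem_range.1 hi)).prodMk
      hθ₀)).const_smul _).const_smul _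

theorem measurable_oneStage (h : M.Assumptions ρ lam C₁ s) (hd : M.IsSample P K n task obs)
    {θ₀ : Ω → Vec p} (hθ₀ : Measurable θ₀) : Measurable (M.oneStage n obs K 1 θ₀) := by
  have hG : Measurable fun ω => M.avgGrad n obs K (θ₀ ω) ω :=
    measurable_sampleAvg_random hd h.isRegular.measurable_grad hθ₀
  have hH : Measurable fun ω => M.avgHess n obs K (θ₀ ω) ω :=
    measurable_sampleAvg_random hd h.isRegular.measurable_hess hθ₀
  unfold oneStage
  rw [numStreams_one]
  exact hθ₀.sub (measurable_clm_apply (ContinuousLinearMap.measurable_inverse.comp hH) hG)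

/-! ### Within-stream noise, conditionally on the discrepancy. -/

section Conditional

variable {g : 𝒵 → ℝ} {f : Vec p → ℝ}

theorem integrable_of_pow (hg : Measurable g) {k : ℕ} (hk : 1 ≤ k) {μ : Measure 𝒵}
    [IsFiniteMeasure μ] (hi : Integrable (fun z => |g z| ^ k) μ) : Integrable g μ := by
  refine ((integrable_const 1).add hi).mono' hg.aestronglyMeasurable (ae_of_all _ fun z => ?_)
  simp only [Pi.add_apply, Real.norm_eq_abs]
  rcases le_total |g z| 1 with h1 | h1
  · have : 0 ≤ |g z| ^ k := by positivity
    linarith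
  · have : |g z| ≤ |g z| ^ k := le_self_pow₀ h1 (by omega)
    linarith

/-- Jensen's inequality for the conditional expectation given the discrepancy. -/
theorem integrable_abs_pow_integral_obsLaw (hg : Measurable g) (hf : Measurable f)
    (hfg : ∀ᵐ δ ∂M.taskLaw, f δ = ∫ z, g z ∂M.obsLaw δ) {k : ℕ} (hk : 1 ≤ k)
    (hi : Integrable (fun z => |g z| ^ k) M.marginal) :
    Integrable (fun δ => |f δ| ^ k) M.taskLaw ∧
      ∫ δ, |f δ| ^ k ∂M.taskLaw ≤ ∫ z, |g z| ^ k ∂M.marginal := by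
  have hle : ∀ᵐ δ ∂M.taskLaw, |f δ| ^ k ≤ ∫ z, |g z| ^ k ∂M.obsLaw δ := by
    filter_upwards [hfg, ae_integrable_obsLaw hi] with δ h1 h2
    have h3 := integrable_of_pow hg hk h2
    have h4 := (convexOn_pow (𝕜 := ℝ) k).map_integral_le (μ := M.obsLaw δ) (f := fun z => |g z|)
      (continuous_pow k).continuousOn isClosed_Ici (ae_of_all _ fun z => Set.mem_Ici.2 (abs_nonneg _))
      h3.abs h2
    rw [h1]
    exact (pow_le_pow_left₀ (abs_nonneg _) abs_integral_le_integral_abs k).trans h4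
  have hI := integrable_integral_obsLaw hi
  have h1 : Integrable (fun δ => |f δ| ^ k) M.taskLaw :=
    hI.mono' (hf.norm.pow_const k).aestronglyMeasurable (hle.mono fun δ hδ => by
      rwa [Real.norm_of_nonneg (by positivity)])
  exact ⟨h1, (integral_mono_ae h1 hI hle).trans_eq (integral_marginal hi).symm⟩

variable (hd : M.IsSample P K n task obs)

include hd

namespace IsSample

/-- Two observations of a stream are conditionally independent given the discrepancy. -/
theorem map_disc_obs_obs {k i j : ℕ} (hk : k < K) (hi : i < n k) (hj : j < n k) (hij : i ≠ j)
    [IsFiniteMeasure P] :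
    P.map (fun ω => (task k ω - M.θstar, obs k i ω, obs k j ω))
      = M.taskLaw ⊗ₘ (M.obsLaw ×ₖ M.obsLaw) := by
  classical
  have hm : Measurable fun ω => (task k ω - M.θstar, obs k i ω, obs k j ω) :=
    (hd.measurable_disc hk).prodMk
      ((hd.measurable_obs k hk i hi).prodMk (hd.measurable_obs k hk j hj))
  refine Measure.ext_prod₃ fun {B S T} hB hS hT => ?_
  rw [Measure.map_apply hm (hB.prod (hS.prod hT)), Measure.compProd_apply_prod hB (hS.prod hT)]
  have hij' : (⟨i, hi⟩ : Fin (n k)) ≠ ⟨j, hj⟩ := by simpa using hij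
  set A : Fin (n k) → Set 𝒵 := fun l => if l = ⟨i, hi⟩ then S else if l = ⟨j, hj⟩ then T
    else Set.univ with hA
  have hAm (l : Fin (n k)) : MeasurableSet (A l) := by
    simp only [hA]
    split_ifs
    exacts [hS, hT, MeasurableSet.univ]
  have hAi : A ⟨i, hi⟩ = S := by simp [hA]
  have hAj : A ⟨j, hj⟩ = T := by simp [hA, hij.symm]
  have h := hd.law k hk B hB A hAm
  have e1 : (fun ω => (task k ω - M.θstar, obs k i ω, obs k j ω)) ⁻¹' B ×ˢ S ×ˢ T
      = {ω | task k ω - M.θstar ∈ B ∧ ∀ l : Fin (n k), obs k l ω ∈ A l} := by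
    ext ω
    simp only [Set.mem_preimage, Set.mem_prod, Set.mem_ofPred_eq]
    refine and_congr_right fun _ => ⟨fun h l => ?_, fun h => ⟨?_, ?_⟩⟩
    · by_cases h1 : l = ⟨i, hi⟩
      · subst h1; rw [hAi]; exact h.1
      by_cases h2 : l = ⟨j, hj⟩
      · subst h2; rw [hAj]; exact h.2
      · simp [hA, h1, h2]
    · have := h ⟨i, hi⟩; rwa [hAi] at this
    · have := h ⟨j, hj⟩; rwa [hAj] at this
  rw [e1, h]
  refine lintegral_congr fun δ => ?_
  rw [Kernel.prod_apply, Measure.prod_prod, Fintype.prod_eq_mul _ _ hij', hAi, hAj]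
  rintro l ⟨h1, h2⟩
  simp [hA, h1, h2]

variable [IsProbabilityMeasure P] (hg : Measurable g) (hf : Measurable f)
  (hfg : ∀ᵐ δ ∂M.taskLaw, f δ = ∫ z, g z ∂M.obsLaw δ)
  (hi2 : Integrable (fun z => g z ^ 2) M.marginal)

include hg hf hfg hi2

omit [IsProbabilityMeasure P] in
theorem integrable_sub_disc_sq {k i : ℕ} (hk : k < K) (hi : i < n k) :
    Integrable (fun ω => (g (obs k i ω) - f (task k ω - M.θstar)) ^ 2) P ∧
      ∫ ω, (g (obs k i ω) - f (task k ω - M.θstar)) ^ 2 ∂P ≤ 4 * ∫ z, g z ^ 2 ∂M.marginal := by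
  obtain ⟨f1, f2⟩ := integrable_abs_pow_integral_obsLaw hg hf hfg one_le_two
    (by simpa only [sq_abs] using hi2)
  simp only [sq_abs] at f1 f2
  have g1 := hd.integrable_comp_obs hi2 hk hi
  have g2 := hd.integral_comp_obs hi2 hk hi
  have hdm := hd.measurable_disc hk
  have f3 : Integrable (fun ω => f (task k ω - M.θstar) ^ 2) P := by
    rw [← hd.map_disc hk] at f1
    exact f1.comp_measurable hdm
  have f4 : ∫ ω, f (task k ω - M.θstar) ^ 2 ∂P = ∫ δ, f δ ^ 2 ∂M.taskLaw := by
    rw [← hd.map_disc hk, integral_map hdm.aemeasurable (hf.pow_const 2).aestronglyMeasurable]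
  have hle (ω : Ω) : (g (obs k i ω) - f (task k ω - M.θstar)) ^ 2
      ≤ 2 * g (obs k i ω) ^ 2 + 2 * f (task k ω - M.θstar) ^ 2 := by
    nlinarith [sq_nonneg (g (obs k i ω) + f (task k ω - M.θstar))]
  have hI := (g1.const_mul 2).add (f3.const_mul 2)
  have hint : Integrable (fun ω => (g (obs k i ω) - f (task k ω - M.θstar)) ^ 2) P :=
    hI.mono' (((hg.comp (hd.measurable_obs k hk i hi)).sub (hf.comp hdm)).pow_const
      2).aestronglyMeasurable (ae_of_all _ fun ω => by
        rw [Real.norm_of_nonneg (sq_nonneg _)]; exact hle ω)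
  refine ⟨hint, (integral_mono hint hI hle).trans ?_⟩
  simp only [Pi.add_apply]
  rw [integral_add (g1.const_mul 2) (f3.const_mul 2), integral_const_mul, integral_const_mul, g2, f4]
  linarith

/-- Given the discrepancy, the two factors are independent and centred, so the conditional
expectation of the product vanishes. -/
theorem integral_sub_disc_mul_sub_disc {k i j : ℕ} (hk : k < K) (hi : i < n k) (hj : j < n k)
    (hij : i ≠ j) :
    ∫ ω, (g (obs k i ω) - f (task k ω - M.θstar)) * (g (obs k j ω) - f (task k ω - M.θstar)) ∂P
      = 0 := by
  have hm : Measurable fun ω => (task k ω - M.θstar, obs k i ω, obs k j ω) :=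
    (hd.measurable_disc hk).prodMk
      ((hd.measurable_obs k hk i hi).prodMk (hd.measurable_obs k hk j hj))
  set F : Vec p × 𝒵 × 𝒵 → ℝ := fun q => (g q.2.1 - f q.1) * (g q.2.2 - f q.1) with hF
  have hFm : Measurable F := by fun_prop
  have hint : Integrable (fun ω => F (task k ω - M.θstar, obs k i ω, obs k j ω)) P := by
    have hx := (integrable_sub_disc_sq hd hg hf hfg hi2 hk hi).1
    have hy := (integrable_sub_disc_sq hd hg hf hfg hi2 hk hj).1
    refine (hx.add hy).mono' (hFm.comp hm).aestronglyMeasurable (ae_of_all _ fun ω => ?_)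
    simp only [hF, Pi.add_apply, Real.norm_eq_abs, abs_mul]
    set x := g (obs k i ω) - f (task k ω - M.θstar)
    set y := g (obs k j ω) - f (task k ω - M.θstar)
    nlinarith [sq_abs x, sq_abs y, sq_nonneg (|x| - |y|), sq_nonneg (|x|), sq_nonneg (|y|)]
  have hFi : Integrable F (M.taskLaw ⊗ₘ (M.obsLaw ×ₖ M.obsLaw)) := by
    rw [← hd.map_disc_obs_obs hk hi hj hij]
    exact (integrable_map_measure hFm.aestronglyMeasurable hm.aemeasurable).2 hint
  have e : ∫ ω, F (task k ω - M.θstar, obs k i ω, obs k j ω) ∂P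
      = ∫ q, F q ∂(M.taskLaw ⊗ₘ (M.obsLaw ×ₖ M.obsLaw)) := by
    rw [← hd.map_disc_obs_obs hk hi hj hij,
      integral_map hm.aemeasurable hFm.aestronglyMeasurable]
  refine Eq.trans e ?_
  rw [Measure.integral_compProd hFi]
  have hgi : Integrable g M.marginal := integrable_of_pow hg one_le_two
    (by simpa only [sq_abs] using hi2)
  refine integral_eq_zero_of_ae ?_
  filter_upwards [hfg, ae_integrable_obsLaw hgi] with δ h1 h2
  simp only [hF, Kernel.prod_apply, Pi.zero_apply]
  rw [integral_prod_mul (fun z => g z - f δ) (fun z => g z - f δ), integral_sub h2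
    (integrable_const _), ← h1]
  simp

/-- The within-stream noise: mean and mean square. -/
theorem integral_streamAvg_sub_disc {k : ℕ} (hk : k < K) (hn : 0 < n k) :
    ∫ ω, (streamAvg n obs g k ω - f (task k ω - M.θstar)) ∂P = 0 ∧
    Integrable (fun ω => (streamAvg n obs g k ω - f (task k ω - M.θstar)) ^ 2) P ∧
    ∫ ω, (streamAvg n obs g k ω - f (task k ω - M.θstar)) ^ 2 ∂P
      ≤ (n k : ℝ)⁻¹ * (4 * ∫ z, g z ^ 2 ∂M.marginal) := by
  have hn' : (0 : ℝ) < n k := by exact_mod_cast hn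
  have hgi : Integrable g M.marginal := integrable_of_pow hg one_le_two
    (by simpa only [sq_abs] using hi2)
  have hdm := hd.measurable_disc hk
  have hfi : Integrable f M.taskLaw := (integrable_integral_obsLaw hgi).congr
    (hfg.mono fun δ h => h.symm)
  have hfi' : Integrable (fun ω => f (task k ω - M.θstar)) P := by
    rw [← hd.map_disc hk] at hfi
    exact hfi.comp_measurable hdm
  have hfe : ∫ ω, f (task k ω - M.θstar) ∂P = ∫ z, g z ∂M.marginal := by
    rw [integral_marginal hgi, ← integral_congr_ae hfg, ← hd.map_disc hk,
      integral_map hdm.aemeasurable hf.aestronglyMeasurable]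
  have hexp (ω : Ω) : streamAvg n obs g k ω - f (task k ω - M.θstar)
      = (n k : ℝ)⁻¹ * ∑ i : Fin (n k), (g (obs k i ω) - f (task k ω - M.θstar)) := by
    rw [Finset.sum_sub_distrib, mul_sub, streamAvg, smul_eq_mul, Finset.sum_range]
    simp [inv_mul_cancel_left₀ hn'.ne']
  have hL (i : Fin (n k)) : MemLp (fun ω => g (obs k i ω) - f (task k ω - M.θstar)) 2 P :=
    (memLp_two_iff_integrable_sq ((hg.comp (hd.measurable_obs k hk i i.2)).sub
      (hf.comp hdm)).aestronglyMeasurable).2 (integrable_sub_disc_sq hd hg hf hfg hi2 hk i.2).1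
  refine ⟨?_, ?_, ?_⟩
  · rw [integral_sub (hd.integrable_streamAvg hgi hk) hfi', hd.integral_streamAvg hgi hk hn, hfe,
      sub_self]
  · simp only [hexp]
    exact ((memLp_finsetSum _ fun i _ => hL i).const_mul _).integrable_sq
  · simp only [hexp, mul_pow]
    rw [integral_const_mul]
    simp only [sq (∑ i, _), Finset.sum_mul_sum]
    have hij (i j : Fin (n k)) : Integrable (fun ω => (g (obs k i ω) - f (task k ω - M.θstar))
        * (g (obs k j ω) - f (task k ω - M.θstar))) P := (hL i).integrable_mul (hL j)
    rw [integral_finsetSum _ fun i _ => integrable_finsetSum _ fun j _ => hij i j]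
    -- Only the diagonal of the double sum survives. This turns the factor n_k⁻² into n_k⁻¹.
    have hrow (i : Fin (n k)) : ∫ ω, ∑ j : Fin (n k), (g (obs k i ω) - f (task k ω - M.θstar))
        * (g (obs k j ω) - f (task k ω - M.θstar)) ∂P ≤ 4 * ∫ z, g z ^ 2 ∂M.marginal := by
      rw [integral_finsetSum _ fun j _ => hij i j, Finset.sum_eq_single i]
      · simp only [← sq]
        exact (integrable_sub_disc_sq hd hg hf hfg hi2 hk i.2).2
      · intro j _ hne
        exact integral_sub_disc_mul_sub_disc hd hg hf hfg hi2 hk i.2 j.2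
          (fun h => hne (Fin.ext h.symm))
      · simp
    refine (mul_le_mul_of_nonneg_left (Finset.sum_le_sum fun i _ => hrow i)
      (by positivity)).trans_eq ?_
    simp only [Finset.sum_const, Finset.card_univ, Fintype.card_fin, nsmul_eq_mul]
    field_simp

/-- The mean square of the averaged within-stream noise. -/
theorem integral_average_noise_sq_le (hn : ∀ k < K, 0 < n k) (hK : 0 < K) :
    Integrable (fun ω => (sampleAvg n obs g K ω
      - (K : ℝ)⁻¹ * ∑ k : Fin K, f (task k ω - M.θstar)) ^ 2) P ∧
    ∫ ω, (sampleAvg n obs g K ω - (K : ℝ)⁻¹ * ∑ k : Fin K, f (task k ω - M.θstar)) ^ 2 ∂P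
      ≤ (K : ℝ)⁻¹ * ((K : ℝ)⁻¹ * ∑ k ∈ Finset.range K, (n k : ℝ)⁻¹)
        * (4 * ∫ z, g z ^ 2 ∂M.marginal) := by
  have : Nonempty (Fin K) := ⟨⟨0, hK⟩⟩
  have hN (k : Fin K) := integral_streamAvg_sub_disc hd hg hf hfg hi2 k.2 (hn k k.2)
  have hind : iIndepFun (fun (k : Fin K) ω => streamAvg n obs g k ω - f (task k ω - M.θstar)) P := by
    have h := hd.indep.comp (fun k (q : Vec p × (Fin (n k) → 𝒵)) =>
      (n k : ℝ)⁻¹ • ∑ i, g (q.2 i) - f (q.1 - M.θstar)) fun k => by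
        fun_prop
    convert h using 2 with k
    ext ω
    simp [streamAvg, Finset.sum_range]
  have hm (k : Fin K) : Measurable fun ω => streamAvg n obs g k ω - f (task k ω - M.θstar) :=
    (hd.measurable_streamAvg hg k.2).sub (hf.comp (hd.measurable_disc k.2))
  have h := integral_sq_average_sub_le (P := P) hm (fun k => (hN k).2.1) hind
    (fun k => (hN k).1) (fun k => (hN k).2.2)
  simp only [Fintype.card_fin, sub_zero, Finset.sum_sub_distrib, mul_sub, ← Finset.sum_mul] at h
  simp only [sampleAvg, smul_eq_mul, Finset.sum_range]
  refine ⟨h.1, h.2.trans_eq ?_⟩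
  rw [sq, mul_inv]
  ring

end IsSample

end Conditional

end ContinualModel

/-! ### The conditional gradient: variance and standardization. -/

namespace ContinualModel

section CondGrad

variable {p : ℕ} {𝒵 : Type*} [MeasurableSpace 𝒵] {M : ContinualModel p 𝒵} {ρ lam C₁ s : ℝ}

namespace Assumptions

variable (h : M.Assumptions ρ lam C₁ s)

include h

theorem measurable_condGrad : Measurable M.condGrad :=
  ((h.measurable_grad M.θstar).stronglyMeasurable.integral_kernel (κ := M.obsLaw)).measurable

theorem measurable_inner_grad (w : Vec p) : Measurable fun z => inner ℝ w (M.grad z M.θstar) :=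
  (innerSL ℝ w).continuous.measurable.comp (h.measurable_grad M.θstar)

theorem measurable_inner_condGrad (w : Vec p) : Measurable fun δ => inner ℝ w (M.condGrad δ) :=
  (innerSL ℝ w).continuous.measurable.comp h.measurable_condGrad

/-- Holds almost everywhere only: marginal integrability of the gradient gives conditional
integrability for almost every δ. -/
theorem inner_condGrad (w : Vec p) : ∀ᵐ δ ∂M.taskLaw,
    inner ℝ w (M.condGrad δ) = ∫ z, inner ℝ w (M.grad z M.θstar) ∂M.obsLaw δ := by
  filter_upwards [ae_integrable_obsLaw (h.integrable_grad h.θstar_mem)] with δ hδ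
  exact (integral_inner hδ w).symm

theorem integrable_abs_inner_grad_pow (w : Vec p) {k : ℕ} (hk : 1 ≤ k) :
    Integrable (fun z => |inner ℝ w (M.grad z M.θstar)| ^ k) M.marginal := by
  have hj (j : Fin p) : MemLp (fun z => M.grad z M.θstar j) k M.marginal := by
    refine (integrable_norm_rpow_iff (h.measurable_grad_apply _ j).aestronglyMeasurable
      (by exact_mod_cast (by omega : k ≠ 0)) (ENNReal.natCast_ne_top k)).1 ?_
    simpa using (h.integrable_grad_apply_pow h.θstar_mem j k).1
  have hsum : MemLp (fun z => ∑ j, w j * M.grad z M.θstar j) k M.marginal :=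
    memLp_finsetSum _ fun j _ => (hj j).const_mul _
  have e : (fun z => ∑ j, w j * M.grad z M.θstar j) = fun z => inner ℝ w (M.grad z M.θstar) := by
    ext z
    rw [← Vec.dotProduct_eq_inner]
    rfl
  rw [e] at hsum
  exact hsum.integrable_norm_pow (by omega)

/-- Cauchy-Schwarz against the whole gradient costs the factor p that appears in the sample-size
condition. -/
theorem integral_inner_grad_sq_le (w : Vec p) :
    ∫ z, (inner ℝ w (M.grad z M.θstar)) ^ 2 ∂M.marginal ≤ ‖w‖ ^ 2 * (p * (4 / s ^ 2)) := by
  obtain ⟨i1, l1⟩ := h.integrable_norm_grad_sq h.θstar_mem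
  have i2 := h.integrable_abs_inner_grad_pow w one_le_two
  simp only [sq_abs] at i2
  have hle (z : 𝒵) : (inner ℝ w (M.grad z M.θstar)) ^ 2 ≤ ‖w‖ ^ 2 * ‖M.grad z M.θstar‖ ^ 2 := by
    rw [← mul_pow, ← sq_abs]
    exact pow_le_pow_left₀ (abs_nonneg _) (abs_real_inner_le_norm _ _) 2
  refine (integral_mono i2 (i1.const_mul _) hle).trans ?_
  rw [integral_const_mul]
  exact mul_le_mul_of_nonneg_left l1 (sq_nonneg _)

theorem integrable_abs_inner_condGrad_pow (w : Vec p) {k : ℕ} (hk : 1 ≤ k) :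
    Integrable (fun δ => |inner ℝ w (M.condGrad δ)| ^ k) M.taskLaw :=
  (integrable_abs_pow_integral_obsLaw (h.measurable_inner_grad w) (h.measurable_inner_condGrad w)
    (h.inner_condGrad w) hk (h.integrable_abs_inner_grad_pow w hk)).1

theorem integral_inner_condGrad (w : Vec p) : ∫ δ, inner ℝ w (M.condGrad δ) ∂M.taskLaw = 0 := by
  have hg := h.integrable_grad h.θstar_mem
  rw [integral_congr_ae (h.inner_condGrad w), ← integral_marginal (hg.const_inner w),
    integral_inner hg, h.integral_grad_eq_zero, inner_zero_right]

theorem integrable_rankOne_condGrad : Integrable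
    (fun δ => InnerProductSpace.rankOne ℝ (M.condGrad δ) (M.condGrad δ)) M.taskLaw := by
  have hsq : Integrable (fun δ => ‖M.condGrad δ‖ ^ 2) M.taskLaw := by
    simp only [Vec.norm_sq_eq_sum]
    refine integrable_finsetSum _ fun j _ => ?_
    have := h.integrable_abs_inner_condGrad_pow (EuclideanSpace.single j 1) one_le_two
    have e (δ : Vec p) : inner ℝ (EuclideanSpace.single j 1) (M.condGrad δ) = M.condGrad δ j := by
      rw [EuclideanSpace.inner_single_left]; simp
    simpa only [sq_abs, e] using this
  refine hsq.mono' ?_ (ae_of_all _ fun δ => ?_)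
  · have : Continuous fun x : Vec p => InnerProductSpace.rankOne ℝ x x :=
      (InnerProductSpace.rankOne ℝ : Vec p →L[ℝ] Vec p →L⋆[ℝ] _).continuous.clm_apply continuous_id
    exact (this.measurable.comp h.measurable_condGrad).aestronglyMeasurable
  · rw [InnerProductSpace.norm_rankOne, sq]

/-- The asymptotic variance is the variance of `wᵀ Z` for `w = Σ⁻¹ v`. -/
theorem asympVar_eq (v : Vec p) : M.asympVar v
    = ∫ δ, (inner ℝ (M.Sig.inverse v) (M.condGrad δ)) ^ 2 ∂M.taskLaw := by
  rw [asympVar, ← h.Sig_inverse_symm, condGradCov,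
    ContinuousLinearMap.integral_apply h.integrable_rankOne_condGrad,
    ← integral_inner (h.integrable_rankOne_condGrad.apply_continuousLinearMap _)]
  refine integral_congr_ae (ae_of_all _ fun δ => ?_)
  simp only [InnerProductSpace.rankOne_apply, inner_smul_right]
  rw [real_inner_comm, sq]

/-- The law of `-wᵀ Z / σ`, for `w = Σ⁻¹ v`, is standardized, and its third moment is bounded. -/
theorem standardized_condGrad {v : Vec p} (hv : 0 < M.asympVar v) {C : ℝ} (hC : 0 < C)
    (hBE : M.BerryEsseenBound (M.Sig.inverse v) C) {ν : Measure ℝ}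
    (hν : ν = M.taskLaw.map fun δ => -(inner ℝ (M.Sig.inverse v) (M.condGrad δ)) / √(M.asympVar v)) :
    ∫ x, x ∂ν = 0 ∧ ∫ x, x ^ 2 ∂ν = 1 ∧ Integrable (fun x => |x| ^ 3) ν ∧
      ∫ x, |x| ^ 3 ∂ν ≤ C ^ (3 / 2 : ℝ) := by
  set w := M.Sig.inverse v
  set V := M.asympVar v with hV
  have hs : 0 < √V := Real.sqrt_pos.2 hv
  have hm : Measurable fun δ => -(inner ℝ w (M.condGrad δ)) / √V :=
    (h.measurable_inner_condGrad w).neg.div_const _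
  have e3 (δ : Vec p) : |-(inner ℝ w (M.condGrad δ)) / √V| ^ 3
      = (√V ^ 3)⁻¹ * |inner ℝ w (M.condGrad δ)| ^ 3 := by
    rw [abs_div, abs_neg, abs_of_pos hs, div_pow, inv_mul_eq_div]
  have i3 := (h.integrable_abs_inner_condGrad_pow w (k := 3) (by norm_num)).const_mul (√V ^ 3)⁻¹
  have hEV := h.asympVar_eq v
  rw [hν]
  refine ⟨?_, ?_, ?_, ?_⟩
  · rw [integral_map hm.aemeasurable (f := fun x : ℝ => x) (by fun_prop), integral_div,
      integral_neg, h.integral_inner_condGrad, neg_zero, zero_div]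
  · rw [integral_map hm.aemeasurable (by fun_prop)]
    simp only [div_pow, neg_sq, Real.sq_sqrt hv.le]
    rw [integral_div, ← hEV, div_self hv.ne']
  · rw [integrable_map_measure (by fun_prop) hm.aemeasurable]
    exact i3.congr (ae_of_all _ fun δ => (e3 δ).symm)
  · rw [integral_map hm.aemeasurable (by fun_prop)]
    simp only [e3]
    rw [integral_const_mul, inv_mul_eq_div, div_le_iff₀ (by positivity)]
    set I := ∫ δ, |inner ℝ w (M.condGrad δ)| ^ 3 ∂M.taskLaw
    have hI : 0 ≤ I := integral_nonneg fun δ => by positivity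
    -- Raising this to the power 3/2 gives I ≤ C^(3/2)·(√V)³, the bound on the third moment after
    -- division by (√V)³.
    have h1 : I ^ (2 / 3 : ℝ) ≤ C * V := by
      rw [hV, hEV]; exact hBE
    have h2 := Real.rpow_le_rpow (by positivity) h1 (by norm_num : (0 : ℝ) ≤ 3 / 2)
    rw [← Real.rpow_mul hI, Real.mul_rpow hC.le hv.le] at h2
    norm_num at h2
    have h3 : V ^ (3 / 2 : ℝ) = √V ^ 3 := by
      rw [Real.sqrt_eq_rpow, ← Real.rpow_natCast, ← Real.rpow_mul hv.le]
      norm_num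
    rwa [h3] at h2

end Assumptions

end CondGrad

end ContinualModel

/-! ### Linearization in a fixed direction and asymptotic normality. -/

namespace ContinualModel

section SingleK

variable {p : ℕ} {𝒵 : Type*} [MeasurableSpace 𝒵] {M : ContinualModel p 𝒵}
  {Ω : Type*} [MeasurableSpace Ω] {P : Measure Ω} [IsProbabilityMeasure P] {K : ℕ} {n : ℕ → ℕ}
  {task : ℕ → Ω → Vec p} {obs : ℕ → ℕ → Ω → 𝒵} {ρ lam C₁ s : ℝ}

omit [MeasurableSpace Ω] in
theorem inner_avgGrad (w θ : Vec p) (m : ℕ) (ω : Ω) : inner ℝ w (M.avgGrad n obs m θ ω)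
    = sampleAvg n obs (fun z => inner ℝ w (M.grad z θ)) m ω :=
  sampleAvg_map (innerSL ℝ w) (fun z => M.grad z θ)

/-- Replacing the stream averages of the gradient by their conditional expectations. -/
theorem measureReal_noise_ge_le (h : M.Assumptions ρ lam C₁ s) (hd : M.IsSample P K n task obs)
    (hn : ∀ k < K, 0 < n k) (hK : 0 < K) (w : Vec p) {τ : ℝ} (hτ : 0 < τ) :
    P.real {ω | ¬ √(K : ℝ) * |inner ℝ w (M.avgGrad n obs K M.θstar ω)
        - (K : ℝ)⁻¹ * ∑ k : Fin K, inner ℝ w (M.condGrad (task k ω - M.θstar))| ≤ τ * ‖w‖}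
      ≤ 16 / s ^ 2 / τ ^ 2 * (p * ((K : ℝ)⁻¹ * ∑ k ∈ Finset.range K, (n k : ℝ)⁻¹)) := by
  have hK' : (0 : ℝ) < K := by exact_mod_cast hK
  have hs := h.s_pos
  set nb := (K : ℝ)⁻¹ * ∑ k ∈ Finset.range K, (n k : ℝ)⁻¹ with hnb
  have hnb0 : 0 ≤ nb := by positivity
  rcases eq_or_ne w 0 with rfl | hw
  · simp only [inner_zero_left, Finset.sum_const_zero, mul_zero, sub_zero, abs_zero, norm_zero,
      le_refl, not_true_eq_false, Set.ofPred_false, measureReal_empty]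
    positivity
  have hw' : 0 < ‖w‖ := norm_pos_iff.2 hw
  have hi2 := h.integrable_abs_inner_grad_pow w one_le_two
  simp only [sq_abs] at hi2
  obtain ⟨i1, l1⟩ := IsSample.integral_average_noise_sq_le hd (h.measurable_inner_grad w)
    (h.measurable_inner_condGrad w) (h.inner_condGrad w) hi2 hn hK
  have l2 := l1.trans (mul_le_mul_of_nonneg_left (mul_le_mul_of_nonneg_left
    (h.integral_inner_grad_sq_le w) (by norm_num : (0 : ℝ) ≤ 4)) (by positivity))
  rw [← hnb] at l2
  have l3 := measureReal_ge_le_div i1 (fun ω => sq_nonneg _) l2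
    (by positivity : 0 < (τ * ‖w‖) ^ 2 / K)
  refine (measureReal_mono fun ω hω => ?_).trans (l3.trans_eq (by field_simp; ring))
  simp only [Set.mem_ofPred_eq, not_le, inner_avgGrad] at hω ⊢
  rw [div_le_iff₀ hK']
  have h1 := pow_le_pow_left₀ (by positivity) hω.le 2
  rw [mul_pow √(K : ℝ), sq_abs, Real.sq_sqrt hK'.le] at h1
  linarith

omit [IsProbabilityMeasure P] in
theorem iIndepFun_standardized (h : M.Assumptions ρ lam C₁ s) (hd : M.IsSample P K n task obs)
    (w : Vec p) (σ : ℝ) : iIndepFun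
      (fun (k : Fin K) ω => -(inner ℝ w (M.condGrad (task k ω - M.θstar))) / σ) P := by
  have hm : Measurable fun δ => -(inner ℝ w (M.condGrad δ)) / σ :=
    (h.measurable_inner_condGrad w).neg.div_const _
  exact hd.indep.comp (fun k (q : Vec p × (Fin (n k) → 𝒵)) =>
    -(inner ℝ w (M.condGrad (q.1 - M.θstar))) / σ) fun k =>
      hm.comp (measurable_fst.sub_const _)

end SingleK

section Sequence

variable {p : ℕ → ℕ} {𝒵 : ℕ → Type*} [∀ K, MeasurableSpace (𝒵 K)]
  {M : ∀ K, ContinualModel (p K) (𝒵 K)} {Ω : ℕ → Type*} [∀ K, MeasurableSpace (Ω K)]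
  {P : ∀ K, Measure (Ω K)} [∀ K, IsProbabilityMeasure (P K)] {n : ℕ → ℕ → ℕ}
  {task : ∀ K, ℕ → Ω K → Vec (p K)} {obs : ∀ K, ℕ → ℕ → Ω K → 𝒵 K} {α ρ lam C₁ s : ℝ}
  {θ₀ : ∀ K, Ω K → Vec (p K)}

/-- The standardized error of the one-stage estimator is close in probability to the standardized
sum of the conditional expectations of the gradients. -/
theorem eventually_standardized_error_le (h : ∀ K, (M K).Assumptions ρ lam C₁ s)
    (hp : ∀ K, 0 < p K) (hn : ∀ K, ∀ k < K, 0 < n K k)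
    (hdata : ∀ K, (M K).IsSample (P K) K (n K) (task K) (obs K)) (hα₀ : 0 < α) (hα₁ : α < 1)
    (hθ₀ : ∀ K, (M K).IsInitialEstimator (n K) (obs K) K α (θ₀ K))
    (hrate : Tendsto (fun K : ℕ => (p K : ℝ) ^ 2 * K / (numStreams K α : ℝ) ^ 2) atTop (𝓝 0))
    (hsizes : Tendsto (fun K : ℕ => (p K : ℝ) * ((K : ℝ)⁻¹ * ∑ k ∈ Finset.range K, (n K k : ℝ)⁻¹))
      atTop (𝓝 0))
    {v : ∀ K, Vec (p K)} (hv : ∀ K, v K ≠ 0) {c : ℝ} (hc : 0 < c)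
    (hvar : ∀ K, c * ‖v K‖ ^ 2 ≤ (M K).asympVar (v K)) {ε : ℝ} (hε : 0 < ε) {δ : ℝ} (hδ : 0 < δ) :
    ∀ᶠ K : ℕ in atTop, (P K).real {ω | ¬ |√(K : ℝ) *
          inner ℝ (v K) ((M K).oneStage (n K) (obs K) K 1 (θ₀ K) ω - (M K).θstar)
            / √((M K).asympVar (v K))
        - (√(K : ℝ))⁻¹ * ∑ k : Fin K, -(inner ℝ ((M K).Sig.inverse (v K))
            ((M K).condGrad (task K k ω - (M K).θstar))) / √((M K).asympVar (v K))| ≤ ε} ≤ δ := by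
  have hlam := (h 0).lam_pos
  have hs := (h 0).s_pos
  have hhb := (h 0).hessBound_pos
  -- The square root of the rate condition: √K times the order p/m of the Newton remainder.
  have hb : Tendsto (fun K : ℕ => √(K : ℝ) * (p K / numStreams K α)) atTop (𝓝 0) := by
    have h1 := hrate.sqrt
    rw [Real.sqrt_zero] at h1
    refine h1.congr fun K => ?_
    rw [Real.sqrt_div (by positivity), Real.sqrt_mul (by positivity),
      Real.sqrt_sq (by positivity), Real.sqrt_sq (by positivity)]
    ring
  have hrate1 : Tendsto (fun K : ℕ => (p K : ℝ) * K / (numStreams K α : ℝ) ^ 2) atTop (𝓝 0) := by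
    refine squeeze_zero (fun K => by positivity) (fun K => ?_) hrate
    have : (1 : ℝ) ≤ p K := by exact_mod_cast hp K
    gcongr
    nlinarith
  -- Makes the Chebyshev terms for the gradients and for the Hessian applied to w add up to δ/8.
  set A := √((64 / s ^ 2 + 8 * hessBound ρ C₁ s) / δ) with hAdef
  have hA : 0 < A := Real.sqrt_pos.2 (by positivity)
  have hA2 : A ^ 2 = (64 / s ^ 2 + 8 * hessBound ρ C₁ s) / δ := Real.sq_sqrt (by positivity)
  have hb1 : 8 / s ^ 2 / A ^ 2 + hessBound ρ C₁ s / A ^ 2 = δ / 8 := by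
    rw [← add_div, hA2]
    field_simp
    ring
  obtain ⟨D, hD, hev⟩ := eventually_oneStage_error h hp hn hdata hα₀ hα₁ hθ₀ hrate1 hA
    (by positivity : 0 < δ / 8)
  -- Calibrated so that τ‖w‖ ≤ τλ‖v‖ = (ε/2)√c‖v‖ ≤ (ε/2)σ(v). The lower bound on the variance in
  -- direction v enters here.
  set τ := ε / 2 * √c / lam with hτdef
  have hτ : 0 < τ := by positivity
  have hnoise := hsizes.const_mul (16 / s ^ 2 / τ ^ 2)
  have hrem := (hb.const_mul (D * (A * lam + 2))).const_mul (√c)⁻¹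
  rw [mul_zero] at hnoise hrem
  rw [mul_zero] at hrem
  filter_upwards [hev, eventually_gt_atTop 0,
    hnoise.eventually (gt_mem_nhds (by positivity : 0 < δ / 8)),
    hrem.eventually (gt_mem_nhds (half_pos hε))] with K hK1 hK hK2 hK3
  have hm0' : (0 : ℝ) < numStreams K α := by exact_mod_cast numStreams_pos hα₀ hK
  have hmK' : (numStreams K α : ℝ) ≤ K := by exact_mod_cast numStreams_le hα₁ hK
  have hK' : (0 : ℝ) < K := by exact_mod_cast hK
  have hp' : (0 : ℝ) < p K := by exact_mod_cast hp K
  set w := (M K).Sig.inverse (v K) with hw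
  have hwv : ‖w‖ ≤ lam * ‖v K‖ := (h K).Sig_inverse.2.2 (v K)
  have hv' : 0 < ‖v K‖ := norm_pos_iff.2 (hv K)
  set V := (M K).asympVar (v K) with hVdef
  have hV : 0 < V := lt_of_lt_of_le (by positivity) (hvar K)
  have hσ : 0 < √V := Real.sqrt_pos.2 hV
  have hσv : √c * ‖v K‖ ≤ √V := by
    rw [← Real.sqrt_sq hv'.le, ← Real.sqrt_mul hc.le]
    exact Real.sqrt_le_sqrt (hvar K)
  have b2 := measureReal_norm_avgHess_sub_ge_le (h K) (hdata K) (hp K) (hn K) hK le_rfl hA w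
  have b3 := measureReal_noise_ge_le (h K) (hdata K) (hn K) hK w hτ
  refine (measureReal_mono (fun ω hω => ?_)).trans ((measureReal_union_le _ _).trans
    ((add_le_add ((measureReal_union_le _ _).trans (add_le_add hK1 b2)) b3).trans (by linarith)))
  simp only [Set.mem_union, Set.mem_ofPred_eq] at hω ⊢
  by_contra hcon
  rw [not_or, not_or, not_not, not_not, not_not] at hcon
  obtain ⟨⟨⟨-, e1⟩, e2⟩, e3⟩ := hcon
  refine hω ?_
  have e1 := e1 (v K)
  rw [← hw] at e1
  set d := (M K).oneStage (n K) (obs K) K 1 (θ₀ K) ω - (M K).θstar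
  set G := (M K).avgGrad (n K) (obs K) K (M K).θstar ω
  set S := ∑ k : Fin K, inner ℝ w ((M K).condGrad (task K k ω - (M K).θstar)) with hS
  have hsum : (√(K : ℝ))⁻¹ * ∑ k : Fin K, -(inner ℝ w
      ((M K).condGrad (task K k ω - (M K).θstar))) / √V = -(√(K : ℝ) * ((K : ℝ)⁻¹ * S) / √V) := by
    rw [← Finset.sum_div, Finset.sum_neg_distrib, ← hS]
    have hsq : √(K : ℝ) * (K : ℝ)⁻¹ = (√(K : ℝ))⁻¹ := by
      rw [← div_eq_mul_inv, Real.sqrt_div_self]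
    rw [← mul_assoc, hsq]
    ring
  have hsplit : √(K : ℝ) * inner ℝ (v K) d / √V - -(√(K : ℝ) * ((K : ℝ)⁻¹ * S) / √V)
      = (√(K : ℝ) * (inner ℝ (v K) d + inner ℝ w G)
        - √(K : ℝ) * (inner ℝ w G - (K : ℝ)⁻¹ * S)) / √V := by ring
  rw [hsum, hsplit, abs_div, abs_of_pos hσ, div_le_iff₀ hσ]
  refine (abs_sub _ _).trans ?_
  rw [abs_mul, abs_mul, abs_of_nonneg (Real.sqrt_nonneg (K : ℝ))]
  have q3 : τ * ‖w‖ ≤ ε / 2 * √V := by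
    refine (mul_le_mul_of_nonneg_left hwv hτ.le).trans ?_
    have : τ * (lam * ‖v K‖) = ε / 2 * (√c * ‖v K‖) := by
      rw [hτdef]; field_simp
    rw [this]
    exact mul_le_mul_of_nonneg_left hσv (by positivity)
  set q := (p K : ℝ) / numStreams K α with hq
  have hq0 : 0 ≤ q := by positivity
  -- Since m ≤ K, each product of a deviation of order √(p/m) with the gradient bound √(p/K) is at
  -- most of order q = p/m, like the Taylor remainder.
  have hyq : √((p K : ℝ) / K) ≤ √q := Real.sqrt_le_sqrt (by rw [hq]; gcongr)
  have hqq : √q * √q = q := Real.mul_self_sqrt hq0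
  have hy0 := Real.sqrt_nonneg ((p K : ℝ) / K)
  have q1 : |inner ℝ (v K) d + inner ℝ w G| ≤ ‖v K‖ * (D * (A * lam + 2) * q) := by
    refine e1.trans ?_
    have r1 : (‖(M K).avgHess (n K) (obs K) K (M K).θstar ω w - (M K).Sig w‖ + √q * ‖v K‖)
        * √((p K : ℝ) / K) ≤ (A * √q * (lam * ‖v K‖) + √q * ‖v K‖) * √q := by
      refine mul_le_mul (add_le_add_left (e2.trans ?_) _) hyq hy0 (by positivity)
      gcongr
    have r2 : (A * √q * (lam * ‖v K‖) + √q * ‖v K‖) * √q = ‖v K‖ * ((A * lam + 1) * q) := by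
      linear_combination (A * lam + 1) * ‖v K‖ * hqq
    rw [r2] at r1
    refine (mul_le_mul_of_nonneg_left (add_le_add_left r1 _) hD.le).trans_eq ?_
    ring
  have q2 : √(K : ℝ) * |inner ℝ (v K) d + inner ℝ w G| ≤ ε / 2 * √V := by
    have r1 := mul_le_mul_of_nonneg_left q1 (Real.sqrt_nonneg (K : ℝ))
    have hsc : 0 < √c := Real.sqrt_pos.2 hc
    rw [inv_mul_eq_div, div_lt_iff₀ hsc] at hK3
    have r2 := mul_le_mul_of_nonneg_left hK3.le hv'.le
    have r3 := mul_le_mul_of_nonneg_left hσv (half_pos hε).le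
    linarith
  linarith

/-- The asymptotic normality of the one-stage estimator. -/
theorem tendstoInDistribution_oneStage (h : ∀ K, (M K).Assumptions ρ lam C₁ s)
    (hp : ∀ K, 0 < p K) (hn : ∀ K, ∀ k < K, 0 < n K k)
    (hdata : ∀ K, (M K).IsSample (P K) K (n K) (task K) (obs K)) (hα₀ : 0 < α) (hα₁ : α < 1)
    (hθ₀m : ∀ K, Measurable (θ₀ K))
    (hθ₀ : ∀ K, (M K).IsInitialEstimator (n K) (obs K) K α (θ₀ K))
    (hrate : Tendsto (fun K : ℕ => (p K : ℝ) ^ 2 * K / (numStreams K α : ℝ) ^ 2) atTop (𝓝 0))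
    (hsizes : Tendsto (fun K : ℕ => (p K : ℝ) * ((K : ℝ)⁻¹ * ∑ k ∈ Finset.range K, (n K k : ℝ)⁻¹))
      atTop (𝓝 0))
    {v : ∀ K, Vec (p K)} (hv : ∀ K, v K ≠ 0) {c : ℝ} (hc : 0 < c)
    (hvar : ∀ K, c * ‖v K‖ ^ 2 ≤ (M K).asympVar (v K)) {C : ℝ} (hC : 0 < C)
    (hBE : ∀ K, (M K).BerryEsseenBound ((M K).Sig.inverse (v K)) C) :
    TendstoInDistribution (fun (K : ℕ) (ω : Ω K) => √(K : ℝ) *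
        inner ℝ (v K) ((M K).oneStage (n K) (obs K) K 1 (θ₀ K) ω - (M K).θstar)
          / √((M K).asympVar (v K))) atTop (id : ℝ → ℝ) P (gaussianReal 0 1) := by
  have hV (K : ℕ) : 0 < (M K).asympVar (v K) :=
    lt_of_lt_of_le (mul_pos hc (pow_pos (norm_pos_iff.2 (hv K)) 2)) (hvar K)
  have hmf (K : ℕ) : Measurable fun δ => -(inner ℝ ((M K).Sig.inverse (v K)) ((M K).condGrad δ))
      / √((M K).asympVar (v K)) := ((h K).measurable_inner_condGrad _).neg.div_const _
  have hm (K : ℕ) (k : Fin K) : Measurable fun ω => -(inner ℝ ((M K).Sig.inverse (v K))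
      ((M K).condGrad (task K k ω - (M K).θstar))) / √((M K).asympVar (v K)) :=
    (hmf K).comp ((hdata K).measurable_disc k.2)
  have hst (K : ℕ) := (h K).standardized_condGrad (hV K) hC (hBE K) rfl
  have hprob (K : ℕ) : IsProbabilityMeasure ((M K).taskLaw.map fun δ =>
      -(inner ℝ ((M K).Sig.inverse (v K)) ((M K).condGrad δ)) / √((M K).asympVar (v K))) :=
    Measure.isProbabilityMeasure_map (hmf K).aemeasurable
  refine tendstoInDistribution_gaussian_of_approx (X := fun K ω => (√(K : ℝ))⁻¹ *
    ∑ k : Fin K, -(inner ℝ ((M K).Sig.inverse (v K))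
      ((M K).condGrad (task K k ω - (M K).θstar))) / √((M K).asympVar (v K))) (fun K => ?_)
    (fun K => ?_) (fun t => ?_) fun ε hε δ hδ => ?_
  · exact (Finset.measurable_fun_sum _ fun k _ => hm K k).const_mul _
  · exact (((innerSL ℝ (v K)).continuous.measurable.comp
      ((measurable_oneStage (h K) (hdata K) (hθ₀m K)).sub_const _)).const_mul _).div_const _
  · refine tendsto_charFun_sum_of_bounded_third_moment hm
      (fun K => iIndepFun_standardized (h K) (hdata K) _ _) (fun K k => ?_)
      (fun K => (hst K).1) (fun K => (hst K).2.1) (fun K => (hst K).2.2.1)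
      (fun K => (hst K).2.2.2) t
    rw [← (hdata K).map_disc k.2, Measure.map_map (hmf K) ((hdata K).measurable_disc k.2)]
    rfl
  · exact eventually_standardized_error_le h hp hn hdata hα₀ hα₁ hθ₀ hrate hsizes hv hc hvar hε hδ

end Sequence

end ContinualModel

end

theorem theorem2
    -- for each number `K` of streams: dimension, population model, sample sizes, data
    (p : ℕ → ℕ) (hp : ∀ K, 0 < p K)
    {𝒵 : ℕ → Type*} [∀ K, MeasurableSpace (𝒵 K)]
    (M : ∀ K, ContinualModel (p K) (𝒵 K))
    {Ω : ℕ → Type*} [∀ K, MeasurableSpace (Ω K)]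
    (P : ∀ K, Measure (Ω K)) [∀ K, IsProbabilityMeasure (P K)]
    (n : ℕ → ℕ → ℕ) (hn : ∀ K, ∀ k < K, 0 < n K k)
    (task : ∀ K, ℕ → Ω K → Vec (p K)) (obs : ∀ K, ℕ → ℕ → Ω K → 𝒵 K)
    (hdata : ∀ K, (M K).IsSample (P K) K (n K) (task K) (obs K))
    -- the initial estimator
    (α : ℝ) (hα₀ : 0 < α) (hα₁ : α < 1)
    (θ₀ : ∀ K, Ω K → Vec (p K)) (hθ₀_meas : ∀ K, Measurable (θ₀ K))
    (hθ₀ : ∀ K, (M K).IsInitialEstimator (n K) (obs K) K α (θ₀ K))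
    -- the assumptions, with constants that do not depend on `K`
    (ρ lam C₁ s C₃ : ℝ) (hρ : 0 < ρ) (hlam : 0 < lam) (hC₁ : 0 < C₁) (hs : 0 < s) (hC₃ : 0 < C₃)
    (hreg : ∀ K, (M K).IsRegular ρ)
    (hconv : ∀ K, (M K).ConvexLoss)
    (heig : ∀ K, (M K).BoundedEigenvalues lam)
    (hlip : ∀ K, (M K).LipschitzHess C₁)
    (hsub : ∀ K, (M K).SubExpGrad s)
    (hmom : ∀ K, (M K).MomentHess C₃) :
    -- the rate
    (Tendsto (fun K : ℕ => (p K : ℝ) * K / (K : ℝ) ^ (2 * α)) atTop (𝓝 0) →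
      IsBigOInProb P
        (fun K ω => ‖(M K).oneStage (n K) (obs K) K 1 (θ₀ K) ω - (M K).θstar‖)
        (fun K => √((p K : ℝ) / K))) ∧
    -- asymptotic normality
    (Tendsto (fun K : ℕ => (p K : ℝ) ^ 2 * K / (K : ℝ) ^ (2 * α)) atTop (𝓝 0) →
      -- the Berry-Esseen condition
      (∀ w : ∀ K, Vec (p K), ∃ C_BE : ℝ, 0 < C_BE ∧ ∀ K, (M K).BerryEsseenBound (w K) C_BE) →
      -- adequate sample sizes within the streams
      Tendsto (fun K : ℕ => (p K : ℝ) * ((K : ℝ)⁻¹ * ∑ k ∈ Finset.range K, (n K k : ℝ)⁻¹))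
        atTop (𝓝 0) →
      -- a direction in which the stream parameters vary at constant order
      ∀ v : ∀ K, Vec (p K), (∀ K, v K ≠ 0) →
      (∃ c : ℝ, 0 < c ∧ ∀ K, c * ‖v K‖ ^ 2 ≤ (M K).asympVar (v K)) →
      TendstoInDistribution
        (fun (K : ℕ) (ω : Ω K) =>
          √(K : ℝ) *
              inner ℝ (v K) ((M K).oneStage (n K) (obs K) K 1 (θ₀ K) ω - (M K).θstar)
            / √((M K).asympVar (v K)))
        atTop (id : ℝ → ℝ) P (gaussianReal 0 1)) := by
  have h (K : ℕ) : (M K).Assumptions ρ lam C₁ s :=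
    ⟨hρ, hlam, hC₁, hs, hreg K, hconv K, heig K, hlip K, hsub K⟩
  refine ⟨fun hrate => ContinualModel.isBigOInProb_oneStage h hp hn hdata hα₀ hα₁ hθ₀
    (ContinualModel.tendsto_mul_div_numStreams_sq hα₀ (fun K => by positivity) hrate), ?_⟩
  rintro hrate hBE hsizes v hv ⟨c, hc, hvar⟩
  -- The direction w = Σ⁻¹v is the one in which the leading term ⟨w, Z⟩ is standardized.
  obtain ⟨C, hC, hCB⟩ := hBE fun K => (M K).Sig.inverse (v K)
  exact ContinualModel.tendstoInDistribution_oneStage h hp hn hdata hα₀ hα₁ hθ₀_meas hθ₀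
    (ContinualModel.tendsto_mul_div_numStreams_sq hα₀ (fun K => by positivity) hrate) hsizes hv hc
    hvar hC hCB
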